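/- Let $\Phi$ be a (possibly singular) genus one model of degree $n\in\{2,3,4\}$ over an arbitrary field $K$, that is * $n=2$: an equation $y^2+P(x_1,x_2)y=Q(x_1,x_2)$ with $P=lx_1^2+mx_1x_2+nx_2^2$ and $Q=ax_1^4+bx_1^3x_2+cx_1^2x_2^2+dx_1x_2^3+ex_2^4$; * $n=3$: a ternary cubic $U=ax_1^3+bx_2^3+cx_3^3+fx_2^2x_3+gx_3^2x_1+hx_1^2x_2+ix_2x_3^2+jx_3x_1^2+kx_1x_2^2+mx_1x_2x_3$; * $n=4$: a pair of quadratic forms $Q_1,Q_2$ in $x_1,\dots,x_4$. All coefficients are in $K$, and the forms may be zero. Let $\mathcal C_\Phi$ be the subscheme defined by $\Phi$ of the weighted projective plane $\mathbb P(1,1,2)$ ($n=2$), of $\mathbb P^2$ ($n=3$), respectively of $\mathbb P^3$ ($n=4$). Define forms $F_n,G_n$ of degree $2n$ in $x_1,\dots,x_n$ as follows; divisions by integers are carried out for the model with indeterminate coefficients, where the results have integer coefficients, and are then specialised to $K$. * $n=2$: $F_2=P^2+4Q$ and $$\begin{aligned}G_2={}&(-l^2c+lmb-m^2a-4ac+b^2)x_1^4+(-2l^2d+2lnb-4mna-8ad)x_1^3x_2\\&+(-4l^2e-lmd+2lnc-mnb-4n^2a-16ae-2bd)x_1^2x_2^2\\&+(-4lme+2lnd-2n^2b-8be)x_1x_2^3+(-m^2e+mnd-n^2c-4ce+d^2)x_2^4.\end{aligned}$$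 * $n=3$: let $b_2=m^2-4(fj+gk+hi)$, $H=-\tfrac12\det(\partial^2U/\partial x_r\partial x_s)$, and let $\Theta=\tfrac13\det\begin{pmatrix}\partial^2U/\partial x_r\partial x_s&\nabla H\\(\nabla H)^T&0\end{pmatrix}$. Put $Z=\tfrac14(H+b_2U)$. Then $F_3=Z^2$ and $G_3=\tfrac1{192}(\Theta-16b_2Z^2-12b_2^2ZU+b_2^3U^2)$. * $n=4$: let $A,B$ be the matrices of second partial derivatives of $Q_1,Q_2$, and let $\sum_{r\le s}a^*_{rs}x_rx_s$, $\sum_{r\le s}b^*_{rs}x_rx_s$ be the quadratic forms whose matrices of second partial derivatives are $\operatorname{adj}A$, $\operatorname{adj}B$. Put $$T_1=\sum_{i,j}\sum_{r\le s}b^*_{rs}(A_{ij}A_{rs}-A_{is}A_{jr})x_ix_j,\qquad T_2=\sum_{i,j}\sum_{r\le s}a^*_{rs}(B_{ij}B_{rs}-B_{is}B_{jr})x_ix_j.$$ For a quadratic form $\Gamma=\sum_{i\le j}c_{ij}x_ix_j$ in four variables let $\operatorname{pf}(\Gamma)=c_{12}c_{34}+c_{13}c_{24}+c_{14}c_{23}$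 and $\operatorname{rd}(\Gamma)=\tfrac14\bigl(\det(\partial^2\Gamma/\partial x_i\partial x_j)-\operatorname{pf}(\Gamma)^2\bigr)$. Let $F_2,G_2$ be the forms attached as above to the degree $2$ model with $P=\operatorname{pf}(x_1Q_1+x_2Q_2)$ and $Q=\operatorname{rd}(x_1Q_1+x_2Q_2)$. Then $F_4=F_2(T_1,-T_2)$ and $G_4=G_2(T_1,-T_2)$. Let $L$ be any algebraically closed extension of $K$ and let $P\in\mathcal C_\Phi(L)$, say $P=(x_1:x_2:y)$ if $n=2$ and $P=(x_1:\dots:x_n)$ if $n=3,4$. Call $P$ singular if the gradients at $P$ of the defining equations ($y^2+Py-Q$; $U$; $Q_1,Q_2$ respectively) are linearly dependent over $L$, i.e. if $\mathcal C_\Phi$ is not a smooth curve at $P$; components are irreducible components of $\mathcal C_\Phi$ over $L$. Then $$F_n(x_1,\dots,x_n)=G_n(x_1,\dots,x_n)=0$$ if and only if $P$ is singular or lies on a component of $\mathcal C_\Phi$ of degree at most $n-2$. For $n=2$ there are no components of degree $\le 0$, so that the condition is that $P$ is singular. For $n=3$ the condition is equivalent to: $P$ is singular or lies on a component that is a line.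 For $n=4$ it is equivalent to: $P$ is singular or lies on a component that is a line or an irreducible (plane) conic. -/

import Mathlib

open scoped LinearAlgebra.Projectivization

/-! ## Projective sets, components, degree, singular points -/

namespace GenusOne

section Projective

variable {L : Type*} [Field L] {n : ℕ}

/-- The zero set in projective space of a homogeneous ideal. -/
def projZeros (I : Ideal (MvPolynomial (Fin n) L)) : Set (ℙ L (Fin n → L)) :=
  {p | ∀ f ∈ I, MvPolynomial.eval p.rep f = 0}

/-- The irreducible components of the projective scheme defined by a family `f` of forms (over an
algebraically closed field): the nonempty zero sets of the minimal primes over the ideal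
generated by the forms. -/
def components {ι : Type*} (f : ι → MvPolynomial (Fin n) L) : Set (Set (ℙ L (Fin n → L))) :=
  {Z | Z.Nonempty ∧ ∃ 𝔭 ∈ (Ideal.span (Set.range f)).minimalPrimes, Z = projZeros 𝔭}

/-- The projective linear subspace attached to a vector subspace. -/
def linearLocus (W : Submodule L (Fin n → L)) : Set (ℙ L (Fin n → L)) :=
  {p | p.submodule ≤ W}

/-- The degree of an irreducible closed subset `Z` of projective space over an algebraically
closed field: the largest cardinality of a finite intersection of `Z` with a linear subspace.
(Every linear subspace meeting `Z` in a finite set is contained in one of codimension `dim Z` that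
still meets `Z` in a finite set; the number of points is then at most the degree, with equality
for a general linear subspace of codimension `dim Z`.) -/
noncomputable def projDegree (Z : Set (ℙ L (Fin n → L))) : ℕ∞ :=
  ⨆ (W : Submodule L (Fin n → L)) (_ : (Z ∩ linearLocus W).Finite), (Z ∩ linearLocus W).encard

/-- A line in projective space. -/
def IsLine (Z : Set (ℙ L (Fin n → L))) : Prop :=
  ∃ W : Submodule L (Fin n → L), Module.finrank L W = 2 ∧ Z = linearLocus W

/-- An irreducible conic in projective space: the zero set, in a plane, of a quadratic form that
does not vanish identically on that plane, and which contains no line. -/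
def IsConic (Z : Set (ℙ L (Fin n → L))) : Prop :=
  (∃ (W : Submodule L (Fin n → L)) (q : MvPolynomial (Fin n) L),
    Module.finrank L W = 3 ∧ q.IsHomogeneous 2 ∧ (∃ w ∈ W, MvPolynomial.eval w q ≠ 0) ∧
    Z = {p ∈ linearLocus W | MvPolynomial.eval p.rep q = 0}) ∧
  ¬ ∃ Y, IsLine Y ∧ Y ⊆ Z

/-- Singular points of the scheme cut out by the equations `f`, by the Jacobian criterion: the
gradients of the equations at the point are linearly dependent. -/
def IsSingularAt {ι : Type*} (f : ι → MvPolynomial (Fin n) L) (x : Fin n → L) : Prop :=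
  ¬ LinearIndependent L (fun j i => MvPolynomial.eval x (MvPolynomial.pderiv i (f j)))

end Projective

/-! ## Models of degree 2 -/

/-- A genus one model of degree 2, the generalised binary quartic
`y² + (l x₁² + m x₁ x₂ + n x₂²) y = a x₁⁴ + b x₁³ x₂ + c x₁² x₂² + d x₁ x₂³ + e x₂⁴`. -/
structure Model2 (R : Type*) where
  (l m n a b c d e : R)

namespace Model2

open MvPolynomial

variable {R : Type*} [CommRing R] (Φ : Model2 R)

/-- The binary quadratic form `P`. -/
noncomputable def P : MvPolynomial (Fin 2) R :=
  C Φ.l * X 0 ^ 2 + C Φ.m * X 0 * X 1 + C Φ.n * X 1 ^ 2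

/-- The binary quartic form `Q`. -/
noncomputable def Q : MvPolynomial (Fin 2) R :=
  C Φ.a * X 0 ^ 4 + C Φ.b * X 0 ^ 3 * X 1 + C Φ.c * X 0 ^ 2 * X 1 ^ 2 + C Φ.d * X 0 * X 1 ^ 3
    + C Φ.e * X 1 ^ 4

/-- The equation `y² + P y - Q` in the variables `x₁ = X 0`, `x₂ = X 1` of weight 1 and `y = X 2`
of weight 2. -/
noncomputable def eqn : Fin 1 → MvPolynomial (Fin 3) R :=
  fun _ => X 2 ^ 2 + rename Fin.castSucc Φ.P * X 2 - rename Fin.castSucc Φ.Q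

/-- The form `F₂ = P² + 4 Q`. -/
noncomputable def F : MvPolynomial (Fin 2) R := Φ.P ^ 2 + 4 * Φ.Q

/-- The form `G₂`. -/
noncomputable def G : MvPolynomial (Fin 2) R :=
  let ⟨l, m, n, a, b, c, d, e⟩ := Φ
  C (-l ^ 2 * c + l * m * b - m ^ 2 * a - 4 * a * c + b ^ 2) * X 0 ^ 4
  + C (-2 * l ^ 2 * d + 2 * l * n * b - 4 * m * n * a - 8 * a * d) * X 0 ^ 3 * X 1
  + C (-4 * l ^ 2 * e - l * m * d + 2 * l * n * c - m * n * b - 4 * n ^ 2 * a - 16 * a * e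
      - 2 * b * d) * X 0 ^ 2 * X 1 ^ 2
  + C (-4 * l * m * e + 2 * l * n * d - 2 * n ^ 2 * b - 8 * b * e) * X 0 * X 1 ^ 3
  + C (-m ^ 2 * e + m * n * d - n ^ 2 * c - 4 * c * e + d ^ 2) * X 1 ^ 4

end Model2

/-! ## Models of degree 3 -/

/-- A genus one model of degree 3, the ternary cubic
`a x³ + b y³ + c z³ + f y² z + g z² x + h x² y + i y z² + j z x² + k x y² + m x y z`. -/
structure Model3 (R : Type*) where
  (a b c f g h i j k m : R)

namespace Model3

open MvPolynomial

variable {R : Type*} [CommRing R] (Φ : Model3 R)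

/-- The ternary cubic. -/
noncomputable def U : MvPolynomial (Fin 3) R :=
  C Φ.a * X 0 ^ 3 + C Φ.b * X 1 ^ 3 + C Φ.c * X 2 ^ 3 + C Φ.f * X 1 ^ 2 * X 2
    + C Φ.g * X 2 ^ 2 * X 0 + C Φ.h * X 0 ^ 2 * X 1 + C Φ.i * X 1 * X 2 ^ 2
    + C Φ.j * X 2 * X 0 ^ 2 + C Φ.k * X 0 * X 1 ^ 2 + C Φ.m * X 0 * X 1 * X 2

/-- The equation of the curve. -/
noncomputable def eqn : Fin 1 → MvPolynomial (Fin 3) R := fun _ => Φ.U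

def a₁ : R := Φ.m

def a₂ : R := -(Φ.f * Φ.j + Φ.g * Φ.k + Φ.h * Φ.i)

def b₂ : R := Φ.a₁ ^ 2 + 4 * Φ.a₂

/-- The forms `W₁, W₂, W₃` with `∂Z/∂xᵢ = 3 Wᵢ` and `Z = x W₁ + y W₂ + z W₃`, see
`pderiv_covZ`. -/
noncomputable def W : Fin 3 → MvPolynomial (Fin 3) R :=
  let ⟨a, b, c, f, g, h, i, j, k, m⟩ := Φ
  let z300 := C (-a * f * j - 4 * a * g * k - a * h * i + a * m ^ 2 + g * h ^ 2 - h * j * m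
    + j ^ 2 * k)
  let z030 := C (-b * f * j - b * g * k - 4 * b * h * i + b * m ^ 2 + f ^ 2 * h - f * k * m
    + i * k ^ 2)
  let z003 := C (-4 * c * f * j - c * g * k - c * h * i + c * m ^ 2 + f * g ^ 2 - g * i * m
    + i ^ 2 * j)
  let z210 := C (-3 * a * b * g + a * f * m - a * i * k + b * j ^ 2 - f * h * j)
  let z201 := C (-3 * a * c * k - a * f * g + a * i * m + c * h ^ 2 - h * i * j)
  let z120 := C (-3 * a * b * i + a * f ^ 2 - b * g * h + b * j * m - f * j * k)
  let z111 := C (-9 * a * b * c + a * f * i + b * g * j + c * h * k - f * g * h - i * j * k)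
  let z102 := C (-3 * a * c * f + a * i ^ 2 + c * h * m - c * j * k - g * h * i)
  let z021 := C (-3 * b * c * h + b * g * m - b * i * j + c * k ^ 2 - f * g * k)
  let z012 := C (-3 * b * c * j + b * g ^ 2 - c * f * h + c * k * m - g * i * k)
  let x := X 0
  let y := X 1
  let z := X 2
  ![z300 * x ^ 2 + 2 * z210 * x * y + 2 * z201 * x * z + z120 * y ^ 2 + z111 * y * z
      + z102 * z ^ 2,
    z030 * y ^ 2 + z210 * x ^ 2 + 2 * z120 * x * y + z111 * x * z + 2 * z021 * y * z
      + z012 * z ^ 2,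
    z003 * z ^ 2 + z201 * x ^ 2 + z111 * x * y + 2 * z102 * x * z + z021 * y ^ 2
      + 2 * z012 * y * z]

/-- The form `Z = (H + b₂ U) / 4`, written with integer coefficients; see `hessian_eq`. -/
noncomputable def covZ : MvPolynomial (Fin 3) R := X 0 * Φ.W 0 + X 1 * Φ.W 1 + X 2 * Φ.W 2

/-- The form `X = (Θ - 16 b₂ Z² - 12 b₂² Z U + b₂³ U²) / 192`, written with integer coefficients;
see `theta_eq`. -/
noncomputable def covX : MvPolynomial (Fin 3) R :=
  let Z := Φ.covZ
  let w₁ := Φ.W 0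
  let w₂ := Φ.W 1
  let w₃ := Φ.W 2
  let A := 3 * C Φ.a * X 0 + C Φ.h * X 1 + C Φ.j * X 2
  let B := C Φ.k * X 0 + 3 * C Φ.b * X 1 + C Φ.f * X 2
  let C' := C Φ.g * X 0 + C Φ.i * X 1 + 3 * C Φ.c * X 2
  let d := C Φ.f * X 1 + C Φ.i * X 2
  let e := C Φ.j * X 0 + C Φ.g * X 2
  let φ := C Φ.h * X 0 + C Φ.k * X 1
  let D := C Φ.m * X 0 + 2 * d
  let E := C Φ.m * X 1 + 2 * e
  let F := C Φ.m * X 2 + 2 * φ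
  let t := d * w₁ + e * w₂ + φ * w₃
  t ^ 2 + C Φ.m * Z * t - C Φ.a₂ * Z ^ 2
    - (B * C' * w₁ ^ 2 + A * C' * w₂ ^ 2 + A * B * w₃ ^ 2 - C' * F * w₁ * w₂ - B * E * w₁ * w₃
      - A * D * w₂ * w₃ + D * E * w₁ * w₂ + D * F * w₁ * w₃ + E * F * w₂ * w₃)

/-- The form `F₃ = Z²`. -/
noncomputable def F : MvPolynomial (Fin 3) R := Φ.covZ ^ 2

/-- The form `G₃ = X`. -/
noncomputable def G : MvPolynomial (Fin 3) R := Φ.covX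

/-- The Hessian covariant `H = -(1/2) det (∂²U/∂xᵢ∂xⱼ)`, written with integer coefficients; see
`hessian_eq`. -/
noncomputable def hessian : MvPolynomial (Fin 3) R := 4 * Φ.covZ - C Φ.b₂ * Φ.U

/-- The matrix of second partial derivatives of `U`. -/
noncomputable def hess : Matrix (Fin 3) (Fin 3) (MvPolynomial (Fin 3) R) :=
  Matrix.of fun i j => pderiv i (pderiv j Φ.U)

theorem pderiv_covZ (i : Fin 3) : pderiv i Φ.covZ = 3 * Φ.W i := by
  obtain ⟨a, b, c, f, g, h, i', j, k, m⟩ := Φ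
  have h2 : pderiv i (2 : MvPolynomial (Fin 3) R) = 0 := by
    simpa using (pderiv (R := R) i).map_natCast 2
  simp only [covZ, W]
  generalize -a * f * j - 4 * a * g * k - a * h * i' + a * m ^ 2 + g * h ^ 2 - h * j * m
    + j ^ 2 * k = z1
  generalize -b * f * j - b * g * k - 4 * b * h * i' + b * m ^ 2 + f ^ 2 * h - f * k * m
    + i' * k ^ 2 = z2
  generalize -4 * c * f * j - c * g * k - c * h * i' + c * m ^ 2 + f * g ^ 2 - g * i' * m
    + i' ^ 2 * j = z3
  generalize -3 * a * b * g + a * f * m - a * i' * k + b * j ^ 2 - f * h * j = z4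
  generalize -3 * a * c * k - a * f * g + a * i' * m + c * h ^ 2 - h * i' * j = z5
  generalize -3 * a * b * i' + a * f ^ 2 - b * g * h + b * j * m - f * j * k = z6
  generalize -9 * a * b * c + a * f * i' + b * g * j + c * h * k - f * g * h - i' * j * k = z7
  generalize -3 * a * c * f + a * i' ^ 2 + c * h * m - c * j * k - g * h * i' = z8
  generalize -3 * b * c * h + b * g * m - b * i' * j + c * k ^ 2 - f * g * k = z9
  generalize -3 * b * c * j + b * g ^ 2 - c * f * h + c * k * m - g * i' * k = z10
  fin_cases i <;>
  · simp [pderiv_X] at h2 ⊢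
    simp only [h2]
    ring

theorem pderiv_U (i : Fin 3) : pderiv i Φ.U =
    ![(3 * C Φ.a * X 0 + C Φ.h * X 1 + C Φ.j * X 2) * X 0 + C Φ.m * X 1 * X 2
        + (C Φ.h * X 0 + C Φ.k * X 1) * X 1 + (C Φ.j * X 0 + C Φ.g * X 2) * X 2,
      (C Φ.k * X 0 + 3 * C Φ.b * X 1 + C Φ.f * X 2) * X 1 + C Φ.m * X 0 * X 2
        + (C Φ.h * X 0 + C Φ.k * X 1) * X 0 + (C Φ.f * X 1 + C Φ.i * X 2) * X 2,
      (C Φ.g * X 0 + C Φ.i * X 1 + 3 * C Φ.c * X 2) * X 2 + C Φ.m * X 0 * X 1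
        + (C Φ.j * X 0 + C Φ.g * X 2) * X 0 + (C Φ.f * X 1 + C Φ.i * X 2) * X 1] i := by
  fin_cases i <;>
  · simp [U, pderiv_X]
    ring

theorem hess_eq : Φ.hess =
    !![2 * (3 * C Φ.a * X 0 + C Φ.h * X 1 + C Φ.j * X 2),
        C Φ.m * X 2 + 2 * (C Φ.h * X 0 + C Φ.k * X 1),
        C Φ.m * X 1 + 2 * (C Φ.j * X 0 + C Φ.g * X 2);
      C Φ.m * X 2 + 2 * (C Φ.h * X 0 + C Φ.k * X 1),
        2 * (C Φ.k * X 0 + 3 * C Φ.b * X 1 + C Φ.f * X 2),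
        C Φ.m * X 0 + 2 * (C Φ.f * X 1 + C Φ.i * X 2);
      C Φ.m * X 1 + 2 * (C Φ.j * X 0 + C Φ.g * X 2),
        C Φ.m * X 0 + 2 * (C Φ.f * X 1 + C Φ.i * X 2),
        2 * (C Φ.g * X 0 + C Φ.i * X 1 + 3 * C Φ.c * X 2)] := by
  have h3 (i : Fin 3) : pderiv i (3 : MvPolynomial (Fin 3) R) = 0 := by
    simpa using (pderiv (R := R) i).map_natCast 3
  ext1 i j
  simp only [hess, Matrix.of_apply, pderiv_U]
  fin_cases i <;> fin_cases j <;>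
  · simp [pderiv_X, h3]
    ring

theorem three_U : 3 * Φ.U =
    X 0 * pderiv 0 Φ.U + X 1 * pderiv 1 Φ.U + X 2 * pderiv 2 Φ.U := by
  simp [U, pderiv_X]
  ring

theorem hessian_eq_neg :
    let A := 3 * C Φ.a * X 0 + C Φ.h * X 1 + C Φ.j * X 2
    let B := C Φ.k * X 0 + 3 * C Φ.b * X 1 + C Φ.f * X 2
    let C' := C Φ.g * X 0 + C Φ.i * X 1 + 3 * C Φ.c * X 2
    let D := C Φ.m * X 0 + 2 * (C Φ.f * X 1 + C Φ.i * X 2)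
    let E := C Φ.m * X 1 + 2 * (C Φ.j * X 0 + C Φ.g * X 2)
    let F := C Φ.m * X 2 + 2 * (C Φ.h * X 0 + C Φ.k * X 1)
    Φ.hessian = -(4 * A * B * C' + D * E * F - A * D ^ 2 - B * E ^ 2 - C' * F ^ 2) := by
  obtain ⟨a, b, c, f, g, h, i', j, k, m⟩ := Φ
  simp [hessian, covZ, W, U, b₂, a₁, a₂]
  have h3 : (C (3 : R) : MvPolynomial (Fin 3) R) = 3 := map_ofNat C 3
  have h4 : (C (4 : R) : MvPolynomial (Fin 3) R) = 4 := map_ofNat C 4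
  have h9 : (C (9 : R) : MvPolynomial (Fin 3) R) = 9 := map_ofNat C 9
  simp only [h3, h4, h9]
  ring

theorem hessian_eq : 2 * Φ.hessian = -Φ.hess.det := by
  rw [hessian_eq_neg, hess_eq, Matrix.det_fin_three]
  simp
  ring

theorem quadratic_aux {S : Type*} [CommRing S] {x y z p₁₁ p₁₂ p₁₃ p₂₂ p₂₃ p₃₃ u₁ u₂ u₃ w₁ w₂ w₃ : S}
    {b U G T : S} (hU : 3 * U = x * u₁ + y * u₂ + z * u₃)
    (hH : 4 * (x * w₁ + y * w₂ + z * w₃) - b * U = -G)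
    (h₁ : p₁₁ * u₁ + p₁₂ * u₂ + p₁₃ * u₃ = G * x) (h₂ : p₁₂ * u₁ + p₂₂ * u₂ + p₂₃ * u₃ = G * y)
    (h₃ : p₁₃ * u₁ + p₂₃ * u₂ + p₃₃ * u₃ = G * z)
    (hT : 4 * T = -(p₁₁ * w₁ ^ 2 + p₂₂ * w₂ ^ 2 + p₃₃ * w₃ ^ 2 + 2 * p₁₂ * w₁ * w₂
      + 2 * p₁₃ * w₁ * w₃ + 2 * p₂₃ * w₂ * w₃) - b * (x * w₁ + y * w₂ + z * w₃) ^ 2) :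
    3 * (192 * T + 16 * b * (x * w₁ + y * w₂ + z * w₃) ^ 2
      + 12 * b ^ 2 * (x * w₁ + y * w₂ + z * w₃) * U - b ^ 3 * U ^ 2) =
      -(p₁₁ * (12 * w₁ - b * u₁) ^ 2 + p₂₂ * (12 * w₂ - b * u₂) ^ 2 + p₃₃ * (12 * w₃ - b * u₃) ^ 2
        + 2 * p₁₂ * (12 * w₁ - b * u₁) * (12 * w₂ - b * u₂)
        + 2 * p₁₃ * (12 * w₁ - b * u₁) * (12 * w₃ - b * u₃)
        + 2 * p₂₃ * (12 * w₂ - b * u₂) * (12 * w₃ - b * u₃)) := by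
  linear_combination 144 * hT
    + (b ^ 2 * u₁ - 24 * b * w₁) * h₁ + (b ^ 2 * u₂ - 24 * b * w₂) * h₂
    + (b ^ 2 * u₃ - 24 * b * w₃) * h₃
    + (-24 * b * (x * w₁ + y * w₂ + z * w₃) + b ^ 2 * (x * u₁ + y * u₂ + z * u₃)) * hH
    + b ^ 2 * (4 * (x * w₁ + y * w₂ + z * w₃) - b * U) * hU

theorem theta_aux {S : Type*} [CommRing S] (x y z A B C d e φ m a w₁ w₂ w₃ U : S)
    (hU : 3 * U = x * (A * x + m * y * z + φ * y + e * z)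
      + y * (B * y + m * x * z + φ * x + d * z) + z * (C * z + m * x * y + e * x + d * y))
    (hH : 4 * (x * w₁ + y * w₂ + z * w₃) - (m ^ 2 + 4 * a) * U
      = -(4 * A * B * C + (m * x + 2 * d) * (m * y + 2 * e) * (m * z + 2 * φ)
        - A * (m * x + 2 * d) ^ 2 - B * (m * y + 2 * e) ^ 2 - C * (m * z + 2 * φ) ^ 2)) :
    let D := m * x + 2 * d
    let E := m * y + 2 * e
    let F := m * z + 2 * φ
    let Z := x * w₁ + y * w₂ + z * w₃
    let b := m ^ 2 + 4 * a
    let t := d * w₁ + e * w₂ + φ * w₃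
    let v₁ := 12 * w₁ - b * (A * x + m * y * z + φ * y + e * z)
    let v₂ := 12 * w₂ - b * (B * y + m * x * z + φ * x + d * z)
    let v₃ := 12 * w₃ - b * (C * z + m * x * y + e * x + d * y)
    3 * (192 * (t ^ 2 + m * Z * t - a * Z ^ 2
      - (B * C * w₁ ^ 2 + A * C * w₂ ^ 2 + A * B * w₃ ^ 2 - C * F * w₁ * w₂ - B * E * w₁ * w₃
      - A * D * w₂ * w₃ + D * E * w₁ * w₂ + D * F * w₁ * w₃ + E * F * w₂ * w₃))
      + 16 * b * Z ^ 2 + 12 * b ^ 2 * Z * U - b ^ 3 * U ^ 2) =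
      -((4 * B * C - D ^ 2) * v₁ ^ 2 + (4 * A * C - E ^ 2) * v₂ ^ 2 + (4 * A * B - F ^ 2) * v₃ ^ 2
        + 2 * (D * E - 2 * C * F) * v₁ * v₂ + 2 * (D * F - 2 * B * E) * v₁ * v₃
        + 2 * (E * F - 2 * A * D) * v₂ * v₃) := by
  intro D E F Z b t v₁ v₂ v₃
  refine quadratic_aux hU hH ?_ ?_ ?_ ?_
  all_goals
    simp only [D, E, F, Z, b, t]
    ring

theorem bordered_aux {S : Type*} [CommRing S] (A B C D E F v₁ v₂ v₃ : S) :
    Matrix.det !![2 * A, F, E, v₁; F, 2 * B, D, v₂; E, D, 2 * C, v₃; v₁, v₂, v₃, 0] =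
      -((4 * B * C - D ^ 2) * v₁ ^ 2 + (4 * A * C - E ^ 2) * v₂ ^ 2 + (4 * A * B - F ^ 2) * v₃ ^ 2
        + 2 * (D * E - 2 * C * F) * v₁ * v₂ + 2 * (D * F - 2 * B * E) * v₁ * v₃
        + 2 * (E * F - 2 * A * D) * v₂ * v₃) := by
  simp [Matrix.det_succ_row_zero, Fin.sum_univ_succ, Fin.succAbove]
  ring

/-- The right hand side is `3 Θ`, the bordered Hessian determinant; so this is the
formula `192 X = Θ - 16 b₂ Z² - 12 b₂² Z U + b₂³ U²`. -/
theorem theta_eq :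
    let H := Φ.hessian
    let Z := Φ.covZ
    let b := C Φ.b₂
    let V : Fin 3 → MvPolynomial (Fin 3) R := fun i => pderiv i H
    let M := Φ.hess
    3 * (192 * Φ.covX + 16 * b * Z ^ 2 + 12 * b ^ 2 * Z * Φ.U - b ^ 3 * Φ.U ^ 2) =
      Matrix.det !![M 0 0, M 0 1, M 0 2, V 0; M 1 0, M 1 1, M 1 2, V 1;
        M 2 0, M 2 1, M 2 2, V 2; V 0, V 1, V 2, 0] := by
  intro H Z b V M
  have h4 (i : Fin 3) : pderiv i (4 : MvPolynomial (Fin 3) R) = 0 := by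
    simpa using (pderiv (R := R) i).map_natCast 4
  have hb : b = C Φ.m ^ 2 + 4 * C Φ.a₂ := by
    simp only [b, b₂, a₁, C_add, C_mul, C_pow]
    rw [map_ofNat C 4]
  have hV (i : Fin 3) : V i = 12 * Φ.W i - b * pderiv i Φ.U := by
    simp only [V, H, hessian, map_sub, Derivation.leibniz, h4, pderiv_covZ, pderiv_C, smul_eq_mul]
    ring
  have hU := Φ.three_U
  have hH := Φ.hessian_eq_neg
  simp only [hessian] at hH
  rw [show C Φ.b₂ = C Φ.m ^ 2 + 4 * C Φ.a₂ from hb] at hH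
  simp only [pderiv_U] at hU
  have key := theta_aux (X 0) (X 1) (X 2) _ _ _ _ _ _ _ _ _ _ _ Φ.U hU hH
  refine Eq.trans ?_ (key.trans ?_)
  · rw [hb]; rfl
  · simp only [hV, M, hess_eq, pderiv_U, hb]
    exact (bordered_aux _ _ _ _ _ _ _ _ _).symm

end Model3

/-! ## Models of degree 4 -/

/-- A quadratic form `∑_{i ≤ j} cᵢⱼ xᵢ xⱼ` in four variables. -/
structure Quadric4 (R : Type*) where
  (c11 c12 c13 c14 c22 c23 c24 c33 c34 c44 : R)

namespace Quadric4

open MvPolynomial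

variable {R : Type*} [CommRing R] (q : Quadric4 R)

/-- The upper triangular matrix of the coefficients `cᵢⱼ`, `i ≤ j`. -/
def coeffs : Matrix (Fin 4) (Fin 4) R :=
  !![q.c11, q.c12, q.c13, q.c14;
     0, q.c22, q.c23, q.c24;
     0, 0, q.c33, q.c34;
     0, 0, 0, q.c44]

/-- The quadratic form as a polynomial. -/
noncomputable def toPoly : MvPolynomial (Fin 4) R := ∑ i, ∑ j, C (q.coeffs i j) * X i * X j

/-- The matrix of second partial derivatives. -/
def hess : Matrix (Fin 4) (Fin 4) R := q.coeffs + q.coeffs.transpose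

/-- The quadric `q*` whose matrix of second partial derivatives is the adjugate of that of `q`,
see `hess_dual`. -/
def dual : Quadric4 R where
  c11 := 4 * q.c22 * q.c33 * q.c44 - q.c22 * q.c34 ^ 2 - q.c23 ^ 2 * q.c44
    + q.c23 * q.c24 * q.c34 - q.c24 ^ 2 * q.c33
  c22 := 4 * q.c11 * q.c33 * q.c44 - q.c11 * q.c34 ^ 2 - q.c13 ^ 2 * q.c44
    + q.c13 * q.c14 * q.c34 - q.c14 ^ 2 * q.c33
  c33 := 4 * q.c11 * q.c22 * q.c44 - q.c11 * q.c24 ^ 2 - q.c12 ^ 2 * q.c44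
    + q.c12 * q.c14 * q.c24 - q.c14 ^ 2 * q.c22
  c44 := 4 * q.c11 * q.c22 * q.c33 - q.c11 * q.c23 ^ 2 - q.c12 ^ 2 * q.c33
    + q.c12 * q.c13 * q.c23 - q.c13 ^ 2 * q.c22
  c12 := q.hess.adjugate 0 1
  c13 := q.hess.adjugate 0 2
  c14 := q.hess.adjugate 0 3
  c23 := q.hess.adjugate 1 2
  c24 := q.hess.adjugate 1 3
  c34 := q.hess.adjugate 2 3

/-- The Pfaffian `pf`. -/
def pf : R := q.c12 * q.c34 + q.c13 * q.c24 + q.c14 * q.c23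

/-- The reduced discriminant `rd`, with `det = pf² + 4 rd`, see `det_hess`. -/
def rd : R :=
  4 * q.c11 * q.c22 * q.c33 * q.c44 - q.c11 * q.c22 * q.c34 ^ 2 - q.c11 * q.c23 ^ 2 * q.c44
    + q.c11 * q.c23 * q.c24 * q.c34 - q.c11 * q.c24 ^ 2 * q.c33 - q.c12 ^ 2 * q.c33 * q.c44
    + q.c12 * q.c13 * q.c23 * q.c44 - q.c12 * q.c13 * q.c24 * q.c34
    - q.c12 * q.c14 * q.c23 * q.c34 + q.c12 * q.c14 * q.c24 * q.c33 - q.c13 ^ 2 * q.c22 * q.c44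
    + q.c13 * q.c14 * q.c22 * q.c34 - q.c13 * q.c14 * q.c23 * q.c24 - q.c14 ^ 2 * q.c22 * q.c33

theorem det_hess : q.hess.det = q.pf ^ 2 + 4 * q.rd := by
  simp [hess, coeffs, Matrix.det_succ_row_zero, Fin.sum_univ_succ, Fin.succAbove, pf, rd]
  ring

theorem hess_dual : q.dual.hess = q.hess.adjugate := by
  ext i j
  fin_cases i <;> fin_cases j <;>
    simp [hess, coeffs, dual, Matrix.adjugate_fin_succ_eq_det_submatrix, Matrix.det_fin_three,
      Fin.succAbove] <;> ring

end Quadric4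

/-- A genus one model of degree 4, the pair of quadrics `Q₁`, `Q₂`. -/
structure Model4 (R : Type*) where
  (Q₁ Q₂ : Quadric4 R)

namespace Model4

open MvPolynomial

variable {R : Type*} [CommRing R] (Φ : Model4 R)

/-- The equations of the curve. -/
noncomputable def eqn : Fin 2 → MvPolynomial (Fin 4) R := ![Φ.Q₁.toPoly, Φ.Q₂.toPoly]

/-- The quadric `Q₁ + t Q₂` over the polynomial ring `R[t]`. -/
noncomputable def pencil : Quadric4 (Polynomial R) :=
  let p (a b : R) : Polynomial R := Polynomial.C a + Polynomial.X * Polynomial.C b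
  ⟨p Φ.Q₁.c11 Φ.Q₂.c11, p Φ.Q₁.c12 Φ.Q₂.c12, p Φ.Q₁.c13 Φ.Q₂.c13, p Φ.Q₁.c14 Φ.Q₂.c14,
    p Φ.Q₁.c22 Φ.Q₂.c22, p Φ.Q₁.c23 Φ.Q₂.c23, p Φ.Q₁.c24 Φ.Q₂.c24, p Φ.Q₁.c33 Φ.Q₂.c33,
    p Φ.Q₁.c34 Φ.Q₂.c34, p Φ.Q₁.c44 Φ.Q₂.c44⟩

/-- The generalised binary quartic `y² + P(x, z) y = Q(x, z)` with `P = pf (x Q₁ + z Q₂)` and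
`Q = rd (x Q₁ + z Q₂)`, whose coefficients are read off at `x = 1`. -/
noncomputable def toModel2 : Model2 R where
  l := Φ.pencil.pf.coeff 0
  m := Φ.pencil.pf.coeff 1
  n := Φ.pencil.pf.coeff 2
  a := Φ.pencil.rd.coeff 0
  b := Φ.pencil.rd.coeff 1
  c := Φ.pencil.rd.coeff 2
  d := Φ.pencil.rd.coeff 3
  e := Φ.pencil.rd.coeff 4

/-- The form `∑_{i,j} ∑_{r ≤ s} b*ᵣₛ (Aᵢⱼ Aᵣₛ - Aᵢₛ Aⱼᵣ) xᵢ xⱼ` attached to a pair of quadrics, where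
`A` is the matrix of second partial derivatives of the first one, and the `b*ᵣₛ` are the
coefficients of the dual of the second one (they are zero for `s < r`). -/
noncomputable def T (q q' : Quadric4 R) : MvPolynomial (Fin 4) R :=
  ∑ i, ∑ j, ∑ r, ∑ s, C (q'.dual.coeffs r s *
    (q.hess i j * q.hess r s - q.hess i s * q.hess j r)) * X i * X j

noncomputable def T₁ : MvPolynomial (Fin 4) R := T Φ.Q₁ Φ.Q₂

noncomputable def T₂ : MvPolynomial (Fin 4) R := T Φ.Q₂ Φ.Q₁

/-- The form `F₄ = F₂(T₁, -T₂)`. -/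
noncomputable def F : MvPolynomial (Fin 4) R := aeval ![Φ.T₁, -Φ.T₂] Φ.toModel2.F

/-- The form `G₄ = G₂(T₁, -T₂)`. -/
noncomputable def G : MvPolynomial (Fin 4) R := aeval ![Φ.T₁, -Φ.T₂] Φ.toModel2.G

end Model4

end GenusOne

namespace GenusOne

/-! At a point p of the curve the vanishing of F and G depends only on local geometry: the
gradients, the tangent line, and the tangent plane of one quadric of the pencil. Integral polynomial
identities, valid in every characteristic, express F = G = 0 in these terms; height arguments then
translate the local conditions into statements about components and degrees.

Degree 2. On the curve F₂ = (2y + P)². Where 2y + P = 0, multiplying G₂ by x₁² or x₂² gives the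
square of the derivative with respect to x₂ or x₁ (`Model2.valG_mul_sq`). Hence the common zeros are
the singular points.

Degree 3. Write U₁, U₂, U₃ for the partial derivatives at p. If x₁ ≠ 0 and (U₂, U₃) ≠ 0, the tangent
line at p meets x₁ = 0 at q = (0, U₃, -U₂). On the curve x₁² Z is the second order term of U at p in
the direction q (`Model3.valZ_mul_sq`), and if it vanishes then x₁⁶ X = U(q)²
(`Model3.valX_mul_pow`). The restriction of U to the line pq is a binary cubic whose first two
coefficients vanish and whose other two are this term and U(q). So Z = X = 0 says that p is singular
or that its tangent line lies in the curve. The other coordinates follow by cyclic symmetry.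

Degree 4. At a singular point T₁ and T₂ both vanish. At a nonsingular p let ℓ be the tangent line of
the curve. If ℓ lies in both quadrics, then again T₁ = T₂ = 0. Otherwise (T₁ : -T₂) is the unique
member of the pencil containing ℓ, and F₂ = G₂ = 0 there says that y² + pf y = rd has a double root
to first order in the pencil parameter. This condition is invariant under linear changes of
variables, although pf alone is not. In a basis adapted to p it says that the quadric contains its
tangent plane at p (`Model4.isLineDir_or_hasPlane_iff`).

Components. Krull's height theorem shows that every component is infinite. Nonsingularity at p
bounds from below the height of every prime through p containing the equations (`two_le_height`), so
a line or an irreducible conic through p inside the curve is a whole component. Conversely, a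
component of degree at most 1 contains the line joining any two of its points. One of degree at most
2 meets a linear space through three of its points in infinitely many points; comparing this with a
suitable member of the pencil yields a line through p in the curve or a quadric containing its
tangent plane at p. -/

theorem X_sq_dvd_iff {R : Type*} [CommRing R] (p : Polynomial R) : Polynomial.X ^ 2 ∣ p ↔
    p.eval 0 = 0 ∧ p.derivative.eval 0 = 0 := by
  rw [Polynomial.X_pow_dvd_iff, ← Polynomial.coeff_zero_eq_eval_zero,
    ← Polynomial.coeff_zero_eq_eval_zero, Polynomial.coeff_derivative]
  refine ⟨fun h => ⟨h 0 (by norm_num), by simp [h 1 (by norm_num)]⟩, fun ⟨h, h'⟩ d hd => ?_⟩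
  interval_cases d
  · exact h
  · simpa using h'

/-! ### Degree 2: double roots and singular points. -/

namespace Model2

open MvPolynomial

section Values

variable {R S : Type*} [CommRing R] [CommRing S]

/-- Base change of a model. -/
def map (f : R →+* S) (Φ : Model2 R) : Model2 S :=
  ⟨f Φ.l, f Φ.m, f Φ.n, f Φ.a, f Φ.b, f Φ.c, f Φ.d, f Φ.e⟩

variable (Φ : Model2 R) (x z y : R)

/-- The value of `P` at `(x, z)`. -/
def valP : R := Φ.l * x ^ 2 + Φ.m * x * z + Φ.n * z ^ 2

/-- The value of `Q` at `(x, z)`. -/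
def valQ : R :=
  Φ.a * x ^ 4 + Φ.b * x ^ 3 * z + Φ.c * x ^ 2 * z ^ 2 + Φ.d * x * z ^ 3 + Φ.e * z ^ 4

/-- The value of `F₂` at `(x, z)`. -/
def valF : R := Φ.valP x z ^ 2 + 4 * Φ.valQ x z

/-- The value of `G₂` at `(x, z)`. -/
def valG : R :=
  (-Φ.l ^ 2 * Φ.c + Φ.l * Φ.m * Φ.b - Φ.m ^ 2 * Φ.a - 4 * Φ.a * Φ.c + Φ.b ^ 2) * x ^ 4
  + (-2 * Φ.l ^ 2 * Φ.d + 2 * Φ.l * Φ.n * Φ.b - 4 * Φ.m * Φ.n * Φ.a - 8 * Φ.a * Φ.d) * x ^ 3 * z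
  + (-4 * Φ.l ^ 2 * Φ.e - Φ.l * Φ.m * Φ.d + 2 * Φ.l * Φ.n * Φ.c - Φ.m * Φ.n * Φ.b
      - 4 * Φ.n ^ 2 * Φ.a - 16 * Φ.a * Φ.e - 2 * Φ.b * Φ.d) * x ^ 2 * z ^ 2
  + (-4 * Φ.l * Φ.m * Φ.e + 2 * Φ.l * Φ.n * Φ.d - 2 * Φ.n ^ 2 * Φ.b - 8 * Φ.b * Φ.e) * x * z ^ 3
  + (-Φ.m ^ 2 * Φ.e + Φ.m * Φ.n * Φ.d - Φ.n ^ 2 * Φ.c - 4 * Φ.c * Φ.e + Φ.d ^ 2) * z ^ 4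

/-- The value of `∂(y² + P y - Q)/∂x₁`. -/
def dX : R := (2 * Φ.l * x + Φ.m * z) * y
  - (4 * Φ.a * x ^ 3 + 3 * Φ.b * x ^ 2 * z + 2 * Φ.c * x * z ^ 2 + Φ.d * z ^ 3)

/-- The value of `∂(y² + P y - Q)/∂x₂`. -/
def dZ : R := (Φ.m * x + 2 * Φ.n * z) * y
  - (Φ.b * x ^ 3 + 2 * Φ.c * x ^ 2 * z + 3 * Φ.d * x * z ^ 2 + 4 * Φ.e * z ^ 3)

/-- The hypotheses say that y is a double root of y² + P y - Q. The identity holds modulo these two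
relations with integer coefficients, so y never has to be eliminated as -P/2, which would exclude
characteristic 2. -/
theorem valG_mul_sq (h : y ^ 2 + Φ.valP x z * y - Φ.valQ x z = 0) (h' : 2 * y + Φ.valP x z = 0) :
    Φ.valG x z * x ^ 2 = Φ.dZ x z y ^ 2 := by
  obtain ⟨l, m, n, a, b, c, d, e⟩ := Φ
  simp only [valP, valQ, valG, dZ] at h h' ⊢
  linear_combination (4*c*x^2 + 8*d*x*z + 16*e*z^2 + 4*m*n*x*z + m^2*x^2 + 4*n^2*z^2) * h
    + (b*m*x^4 + 2*b*n*x^3*z - c*l*x^4 + c*m*x^3*z + 3*c*n*x^2*z^2 - 2*c*x^2*y - 2*d*l*x^3*z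
      + d*m*x^2*z^2 + 4*d*n*x*z^3 - 4*d*x*z*y - 4*e*l*x^2*z^2 + 4*e*n*z^4 - 8*e*z^2*y
      - 4*m*n*x*z*y - m^2*x^2*y - 4*n^2*z^2*y) * h'

theorem valG_mul_sq' (h : y ^ 2 + Φ.valP x z * y - Φ.valQ x z = 0) (h' : 2 * y + Φ.valP x z = 0) :
    Φ.valG x z * z ^ 2 = Φ.dX x z y ^ 2 := by
  have key := valG_mul_sq ⟨Φ.n, Φ.m, Φ.l, Φ.e, Φ.d, Φ.c, Φ.b, Φ.a⟩ z x y
    (by simp only [valP, valQ] at h ⊢; linear_combination h)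
    (by simp only [valP] at h' ⊢; linear_combination h')
  simp only [valG, dZ, dX] at key ⊢
  linear_combination key

theorem valF_eq (h : y ^ 2 + Φ.valP x z * y - Φ.valQ x z = 0) :
    Φ.valF x z = (2 * y + Φ.valP x z) ^ 2 := by
  rw [valF]
  linear_combination -4 * h

end Values

section Field

variable {L : Type*} [Field L] (Φ : Model2 L) (x z y : L)

theorem valF_valG_eq_zero_iff (hxz : x ≠ 0 ∨ z ≠ 0)
    (h : y ^ 2 + Φ.valP x z * y - Φ.valQ x z = 0) :
    (Φ.valF x z = 0 ∧ Φ.valG x z = 0) ↔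
      Φ.dX x z y = 0 ∧ Φ.dZ x z y = 0 ∧ 2 * y + Φ.valP x z = 0 := by
  rw [Φ.valF_eq x z y h, pow_eq_zero_iff two_ne_zero]
  constructor
  · rintro ⟨h1, h2⟩
    have h3 := Φ.valG_mul_sq x z y h h1
    have h4 := Φ.valG_mul_sq' x z y h h1
    rw [h2, zero_mul, eq_comm, pow_eq_zero_iff two_ne_zero] at h3 h4
    exact ⟨h4, h3, h1⟩
  · rintro ⟨h1, h2, h3⟩
    refine ⟨h3, ?_⟩
    have h4 := Φ.valG_mul_sq x z y h h3
    have h5 := Φ.valG_mul_sq' x z y h h3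
    rw [h2, zero_pow two_ne_zero] at h4
    rw [h1, zero_pow two_ne_zero] at h5
    rcases hxz with hx | hx
    · simpa [hx] using h4
    · simpa [hx] using h5

theorem exists_root [IsAlgClosed L] : ∃ y, y ^ 2 + Φ.valP x z * y - Φ.valQ x z = 0 := by
  have hd : (Polynomial.X ^ 2 + Polynomial.C (Φ.valP x z) * Polynomial.X
      - Polynomial.C (Φ.valQ x z)).degree = 2 := by compute_degree!
  obtain ⟨y, hy⟩ := IsAlgClosed.exists_root _ (by rw [hd]; norm_num)
  exact ⟨y, by simpa using hy⟩

/-- The common zeros of `F₂` and `G₂` correspond to the singular points, with tangent vectors in the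
form of a first order deformation. -/
theorem valF_valG_eq_zero_iff_exists [IsAlgClosed L] (x' z' : L) (hd : x * z' - z * x' ≠ 0) :
    (Φ.valF x z = 0 ∧ Φ.valG x z = 0) ↔ ∃ Y : Polynomial L,
      Polynomial.X ^ 2 ∣ Y ^ 2
        + Y * (Φ.map Polynomial.C).valP (.C x + .X * .C x') (.C z + .X * .C z')
        - (Φ.map Polynomial.C).valQ (.C x + .X * .C x') (.C z + .X * .C z') ∧
      Polynomial.X ∣ 2 * Y
        + (Φ.map Polynomial.C).valP (.C x + .X * .C x') (.C z + .X * .C z') := by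
  have hxz : x ≠ 0 ∨ z ≠ 0 := by
    by_contra! h
    simp [h.1, h.2] at hd
  simp only [X_sq_dvd_iff, Polynomial.X_dvd_iff, Polynomial.coeff_zero_eq_eval_zero]
  constructor
  · intro h
    obtain ⟨y, hy⟩ := Φ.exists_root x z
    obtain ⟨h1, h2, h3⟩ := (Φ.valF_valG_eq_zero_iff x z y hxz hy).1 h
    -- A constant Y suffices: in the first order term the derivative of Y is multiplied by 2y + P,
    -- which is zero.
    refine ⟨.C y, ⟨?_, ?_⟩, ?_⟩
    · simp [valP, valQ, map] at hy ⊢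
      linear_combination hy
    · simp [valP, valQ, map, dX, dZ, Polynomial.derivative_pow] at h1 h2 h3 ⊢
      linear_combination x' * h1 + z' * h2
    · simp [valP, map] at h3 ⊢
      linear_combination h3
  · rintro ⟨Y, ⟨hY1, hY2⟩, hY3⟩
    simp [valP, valQ, map, Polynomial.derivative_pow] at hY1 hY2 hY3
    set y := Y.eval 0
    have hy : y ^ 2 + Φ.valP x z * y - Φ.valQ x z = 0 := by
      simp only [valP, valQ]
      linear_combination hY1
    have hP : 2 * y + Φ.valP x z = 0 := by
      simp only [valP]
      linear_combination hY3
    refine (Φ.valF_valG_eq_zero_iff x z y hxz hy).2 ?_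
    have h1 : x' * Φ.dX x z y + z' * Φ.dZ x z y = 0 := by
      simp only [dX, dZ, valP] at hP ⊢
      linear_combination hY2 - Y.derivative.eval 0 * hP
    -- The weighted Euler relation, modulo the equation and 2y + P = 0. It gives the derivative
    -- along (x, z); `h1` gives the one along (x', z'), and the two directions are independent by
    -- `hd`.
    have h2 : x * Φ.dX x z y + z * Φ.dZ x z y = 0 := by
      simp only [dX, dZ, valP, valQ] at hy hP ⊢
      linear_combination 4 * hy - 2 * y * hP
    refine ⟨?_, ?_, hP⟩
    · refine (mul_eq_zero.1 ?_).resolve_left hd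
      linear_combination z' * h2 - z * h1
    · refine (mul_eq_zero.1 ?_).resolve_left hd
      linear_combination x * h1 - x' * h2

end Field

section Main

variable {K L : Type*} [Field K] [Field L] [Algebra K L] (Φ : Model2 K)

theorem aeval_F {A : Type*} [CommRing A] [Algebra K A] (x z : A) :
    aeval ![x, z] Φ.F = (Φ.map (algebraMap K A)).valF x z := by
  simp [F, P, Q, valF, valP, valQ, map]

theorem aeval_G {A : Type*} [CommRing A] [Algebra K A] (x z : A) :
    aeval ![x, z] Φ.G = (Φ.map (algebraMap K A)).valG x z := by
  simp only [G, valG, map, map_mul, map_add, map_sub, map_neg, map_pow, aeval_C,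
    aeval_X, map_ofNat]
  simp

theorem main (v : Fin 3 → L) (hv : v ≠ 0) (h : ∀ i, aeval v (Φ.eqn i) = 0) :
    (aeval ![v 0, v 1] Φ.F = 0 ∧ aeval ![v 0, v 1] Φ.G = 0) ↔
      IsSingularAt (fun i => MvPolynomial.map (algebraMap K L) (Φ.eqn i)) v := by
  set Ψ := Φ.map (algebraMap K L)
  have h0 : v 2 ^ 2 + Ψ.valP (v 0) (v 1) * v 2 - Ψ.valQ (v 0) (v 1) = 0 := by
    have := h 0
    simp [eqn, P, Q] at this
    simp [Ψ, valP, valQ, map]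
    linear_combination this
  -- The point (0 : 0 : 1) is never on the curve, since the equation there reads y² = 0.
  have hxz : v 0 ≠ 0 ∨ v 1 ≠ 0 := by
    by_contra! h1
    apply hv
    have h2 : v 2 = 0 := by simpa [h1.1, h1.2, valP, valQ] using h0
    ext i
    fin_cases i <;> simp [h1.1, h1.2, h2]
  have hX : eval v (pderiv 0 (MvPolynomial.map (algebraMap K L) (Φ.eqn 0))) =
      Ψ.dX (v 0) (v 1) (v 2) := by
    simp [eqn, P, Q, Ψ, map, dX, pderiv_X]
    ring
  have hZ : eval v (pderiv 1 (MvPolynomial.map (algebraMap K L) (Φ.eqn 0))) =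
      Ψ.dZ (v 0) (v 1) (v 2) := by
    simp [eqn, P, Q, Ψ, map, dZ, pderiv_X]
    ring
  have hY : eval v (pderiv 2 (MvPolynomial.map (algebraMap K L) (Φ.eqn 0))) =
      2 * v 2 + Ψ.valP (v 0) (v 1) := by
    simp [eqn, P, Q, Ψ, map, valP, pderiv_X]
  rw [aeval_F, aeval_G, Ψ.valF_valG_eq_zero_iff _ _ _ hxz h0, IsSingularAt,
    linearIndependent_unique_iff, not_not, funext_iff, Fin.forall_fin_succ, Fin.forall_fin_two,
    ← hX, ← hZ, ← hY]
  rfl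

end Main

end Model2

/-! ### Degree 3: the covariants Z and X and the tangent line. -/

namespace Model3

open MvPolynomial

/-- The model obtained by a cyclic permutation of the variables. -/
def rot {R : Type*} (Φ : Model3 R) : Model3 R :=
  ⟨Φ.b, Φ.c, Φ.a, Φ.g, Φ.h, Φ.f, Φ.j, Φ.k, Φ.i, Φ.m⟩

theorem rot_rot_rot {R : Type*} (Φ : Model3 R) : Φ.rot.rot.rot = Φ := rfl

section Values

variable {R S : Type*} [CommRing R] [CommRing S]

/-- Base change of a model. -/
def map (f : R →+* S) (Φ : Model3 R) : Model3 S :=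
  ⟨f Φ.a, f Φ.b, f Φ.c, f Φ.f, f Φ.g, f Φ.h, f Φ.i, f Φ.j, f Φ.k, f Φ.m⟩

variable (Φ : Model3 R) (x y z : R)

/-- The value of `U`. -/
def valU : R := Φ.a * x ^ 3 + Φ.b * y ^ 3 + Φ.c * z ^ 3 + Φ.f * y ^ 2 * z
    + Φ.g * z ^ 2 * x + Φ.h * x ^ 2 * y + Φ.i * y * z ^ 2
    + Φ.j * z * x ^ 2 + Φ.k * x * y ^ 2 + Φ.m * x * y * z

/-- The value of `W₁`. -/
def valW : R :=
  (-Φ.a * Φ.f * Φ.j - 4 * Φ.a * Φ.g * Φ.k - Φ.a * Φ.h * Φ.i + Φ.a * Φ.m ^ 2 + Φ.g * Φ.h ^ 2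
    - Φ.h * Φ.j * Φ.m + Φ.j ^ 2 * Φ.k) * x ^ 2
  + 2 * (-3 * Φ.a * Φ.b * Φ.g + Φ.a * Φ.f * Φ.m - Φ.a * Φ.i * Φ.k + Φ.b * Φ.j ^ 2
    - Φ.f * Φ.h * Φ.j) * x * y
  + 2 * (-3 * Φ.a * Φ.c * Φ.k - Φ.a * Φ.f * Φ.g + Φ.a * Φ.i * Φ.m + Φ.c * Φ.h ^ 2
    - Φ.h * Φ.i * Φ.j) * x * z
  + (-3 * Φ.a * Φ.b * Φ.i + Φ.a * Φ.f ^ 2 - Φ.b * Φ.g * Φ.h + Φ.b * Φ.j * Φ.m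
    - Φ.f * Φ.j * Φ.k) * y ^ 2
  + (-9 * Φ.a * Φ.b * Φ.c + Φ.a * Φ.f * Φ.i + Φ.b * Φ.g * Φ.j + Φ.c * Φ.h * Φ.k
    - Φ.f * Φ.g * Φ.h - Φ.i * Φ.j * Φ.k) * y * z
  + (-3 * Φ.a * Φ.c * Φ.f + Φ.a * Φ.i ^ 2 + Φ.c * Φ.h * Φ.m - Φ.c * Φ.j * Φ.k
    - Φ.g * Φ.h * Φ.i) * z ^ 2

/-- The value of `Z`. -/
def valZ : R := x * Φ.valW x y z + y * Φ.rot.valW y z x + z * Φ.rot.rot.valW z x y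

/-- The value of half of `∂²U/∂x₁²`. -/
def valA : R := 3 * Φ.a * x + Φ.h * y + Φ.j * z

/-- The value of `f x₂ + i x₃`. -/
def vald : R := Φ.f * y + Φ.i * z

/-- The value of `∂U/∂x₁`. -/
def dU : R := Φ.valA x y z * x + Φ.m * y * z + Φ.rot.rot.vald x y * y + Φ.rot.vald z x * z

/-- The value of `∂²U/∂x₂∂x₃`. -/
def valD : R := Φ.m * x + 2 * Φ.vald y z

/-- The expression `X` of `covX` in terms of the quantities that enter it. -/
def exprX (x y z A B C d e φ m a₂ w₁ w₂ w₃ : R) : R :=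
  (d * w₁ + e * w₂ + φ * w₃) ^ 2
    + m * (x * w₁ + y * w₂ + z * w₃) * (d * w₁ + e * w₂ + φ * w₃)
    - a₂ * (x * w₁ + y * w₂ + z * w₃) ^ 2
    - (B * C * w₁ ^ 2 + A * C * w₂ ^ 2 + A * B * w₃ ^ 2 - C * (m * z + 2 * φ) * w₁ * w₂
      - B * (m * y + 2 * e) * w₁ * w₃ - A * (m * x + 2 * d) * w₂ * w₃
      + (m * x + 2 * d) * (m * y + 2 * e) * w₁ * w₂ + (m * x + 2 * d) * (m * z + 2 * φ) * w₁ * w₃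
      + (m * y + 2 * e) * (m * z + 2 * φ) * w₂ * w₃)

/-- The value of `X`. -/
def valX : R := exprX x y z (Φ.valA x y z) (Φ.rot.valA y z x) (Φ.rot.rot.valA z x y)
  (Φ.vald y z) (Φ.rot.vald z x) (Φ.rot.rot.vald x y) Φ.m Φ.a₂
  (Φ.valW x y z) (Φ.rot.valW y z x) (Φ.rot.rot.valW z x y)

theorem valU_rot : Φ.rot.valU y z x = Φ.valU x y z := by
  simp only [valU, rot]
  ring

theorem valZ_rot : Φ.rot.valZ y z x = Φ.valZ x y z := by
  simp only [valZ, rot_rot_rot]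
  ring

theorem valX_rot : Φ.rot.valX y z x = Φ.valX x y z := by
  have h : Φ.rot.a₂ = Φ.a₂ := by
    simp only [a₂, rot]
    ring
  simp only [valX, exprX, rot_rot_rot, h, show Φ.rot.m = Φ.m from rfl]
  ring

theorem euler : x * Φ.dU x y z + y * Φ.rot.dU y z x + z * Φ.rot.rot.dU z x y
    = 3 * Φ.valU x y z := by
  simp only [dU, valA, vald, valU, rot]
  ring

/-- Both w and the gradient u of U are orthogonal to the point, so their cross product should be a
multiple λ of the point, and X plays the role of λ². The identity is the first coordinate of this
relation. Treating the entries of the Hessian as independent quantities keeps the computation small.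
-/
theorem sq_mul_exprX (A B C d e φ m a₂ w₁ w₂ w₃ : R)
    (h : x * (A * x + m * y * z + φ * y + e * z) + y * (B * y + m * x * z + φ * x + d * z)
      + z * (C * z + m * x * y + e * x + d * y) = 0) (h' : x * w₁ + y * w₂ + z * w₃ = 0) :
    x ^ 2 * exprX x y z A B C d e φ m a₂ w₁ w₂ w₃ =
      ((C * z + m * x * y + e * x + d * y) * w₂ - (B * y + m * x * z + φ * x + d * z) * w₃) ^ 2 := by
  rw [exprX]
  linear_combination (- B*w₃^2 - C*w₂^2 + 2*d*w₂*w₃ + m*w₂*w₃*x) * h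
    + (- B*C*w₁*x + B*C*w₂*y + B*C*w₃*z + 2*B*e*w₃*x + B*m*w₃*x*y + C*m*w₂*x*z + 2*C*φ*w₂*x
      - a₂*w₁*x^3 - a₂*w₂*x^2*y - a₂*w₃*x^2*z - 2*d*e*w₂*x + d*m*w₁*x^2 - 2*d*m*w₂*x*y
      - 2*d*m*w₃*x*z - 2*d*φ*w₃*x + d^2*w₁*x - d^2*w₂*y - d^2*w₃*z - e*m*w₂*x^2 - m*φ*w₃*x^2
      - m^2*w₂*x^2*y - m^2*w₃*x^2*z) * h'

-- The right side is the second order term `quad` of U in the direction (0, U₃, -U₂) of the tangent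
-- line.
set_option maxRecDepth 4000 in
theorem valZ_mul_sq (h : Φ.valU x y z = 0) :
    Φ.valZ x y z * x ^ 2 = Φ.rot.rot.valA z x y * Φ.rot.dU y z x ^ 2
      - Φ.valD x y z * Φ.rot.dU y z x * Φ.rot.rot.dU z x y
      + Φ.rot.valA y z x * Φ.rot.rot.dU z x y ^ 2 := by
  obtain ⟨a, b, c, f, g, h', i, j, k, m⟩ := Φ
  simp only [valZ, valW, valA, valD, dU, vald, rot, valU] at h ⊢
  linear_combination (- 27*b*c*y*z - 9*b*g*x*y - 9*b*i*y^2 - 9*c*f*z^2 - 9*c*k*x*z - 3*f*g*x*z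
    + 3*f*i*y*z - f*j*x^2 + 3*f*m*x*y + 3*f^2*y^2 - 4*g*k*x^2 - h'*i*x^2 - 3*i*k*x*y + 3*i*m*x*z
    + 3*i^2*z^2 + m^2*x^2) * h

-- This identifies the first coordinate of the cross product in `sq_mul_exprX`, up to x², with the
-- value of U at the point where the tangent line meets x₁ = 0.
set_option maxRecDepth 4000 in
theorem dU_mul_valW (h : Φ.valU x y z = 0) :
    (Φ.rot.rot.dU z x y * Φ.rot.valW y z x - Φ.rot.dU y z x * Φ.rot.rot.valW z x y) * x ^ 2 =
      Φ.valU 0 (Φ.rot.rot.dU z x y) (-Φ.rot.dU y z x) := by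
  obtain ⟨a, b, c, f, g, h', i, j, k, m⟩ := Φ
  simp only [valW, valA, dU, vald, rot, valU] at h ⊢
  linear_combination (27*b*c*f*y^2*z - 27*b*c*g*x*z^2 + 9*b*c*h'*x^2*y - 27*b*c*i*y*z^2
    - 9*b*c*j*x^2*z + 27*b*c*k*x*y^2 - 27*b*c^2*z^3 - 9*b*f*i*y^3 - 18*b*g*i*x*y*z - 3*b*g*j*x^3
    - 3*b*g*m*x^2*y - 6*b*g^2*x^2*z - 6*b*i*j*x^2*y - 9*b*i*m*x*y^2 - 18*b*i^2*y^2*z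
    + 27*b^2*c*y^3 + 6*c*f*h'*x^2*z + 9*c*f*i*z^3 + 18*c*f*k*x*y*z + 9*c*f*m*x*z^2
    + 18*c*f^2*y*z^2 + 3*c*h'*k*x^3 + 3*c*k*m*x^2*z + 6*c*k^2*x^2*y + f*g*h'*x^3 + 3*f*g*i*x*z^2
    + 2*f*g*k*x^2*y + 3*f*g*m*x^2*z - f*h'*i*x^2*y + f*i*j*x^2*z - 3*f*i*k*x*y^2 - 3*f*i^2*y*z^2
    + f*j*m*x^3 + f*m^2*x^2*y + 6*f^2*g*x*y*z + 3*f^2*i*y^2*z + 2*f^2*j*x^2*y + 3*f^2*m*x*y^2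
    + 2*f^3*y^3 - 2*g*i*k*x^2*z - h'*i*m*x^3 - 2*h'*i^2*x^2*z - i*j*k*x^3 - 3*i*k*m*x^2*y
    - i*m^2*x^2*z - 6*i^2*k*x*y*z - 3*i^2*m*x*z^2 - 2*i^3*z^3) * h

theorem valX_mul_pow (h : Φ.valU x y z = 0) (h' : Φ.valZ x y z = 0) :
    Φ.valX x y z * x ^ 6 = Φ.valU 0 (Φ.rot.rot.dU z x y) (-Φ.rot.dU y z x) ^ 2 := by
  rw [← Φ.dU_mul_valW x y z h]
  have h0 := Φ.euler x y z
  rw [h, mul_zero] at h0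
  have := sq_mul_exprX x y z (Φ.valA x y z) (Φ.rot.valA y z x) (Φ.rot.rot.valA z x y)
    (Φ.vald y z) (Φ.rot.vald z x) (Φ.rot.rot.vald x y) Φ.m Φ.a₂
    (Φ.valW x y z) (Φ.rot.valW y z x) (Φ.rot.rot.valW z x y)
    (by
      simp only [dU, rot_rot_rot, show Φ.rot.m = Φ.m from rfl,
        show Φ.rot.rot.m = Φ.m from rfl] at h0
      linear_combination h0)
    h'
  rw [valX]
  simp only [dU, rot_rot_rot, show Φ.rot.m = Φ.m from rfl, show Φ.rot.rot.m = Φ.m from rfl]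
  linear_combination x ^ 4 * this

/-- The value of the second order Taylor term of `U` at `(x, y, z)` in the direction
`(u, v, w)`. -/
def quad (u v w : R) : R :=
  Φ.valA x y z * u ^ 2 + Φ.rot.valA y z x * v ^ 2 + Φ.rot.rot.valA z x y * w ^ 2
    + Φ.valD x y z * v * w + Φ.rot.valD y z x * w * u + Φ.rot.rot.valD z x y * u * v

/-- The value of the derivative of `U` at `(x, y, z)` in the direction `(u, v, w)`. -/
def lin (u v w : R) : R :=
  Φ.dU x y z * u + Φ.rot.dU y z x * v + Φ.rot.rot.dU z x y * w

theorem lin_rot (u v w : R) : Φ.rot.lin y z x v w u = Φ.lin x y z u v w := by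
  simp only [lin, rot_rot_rot]
  ring

theorem quad_rot (u v w : R) : Φ.rot.quad y z x v w u = Φ.quad x y z u v w := by
  simp only [quad, rot_rot_rot]
  ring

end Values

section Field

variable {L : Type*} [Field L] (Φ : Model3 L) (x y z : L)

/-- The line through the points `p` and `q` is contained in the curve (for `p` on the curve). -/
def IsLineDir (p q : Fin 3 → L) : Prop :=
  (∀ c : L, q ≠ c • p) ∧ Φ.lin (p 0) (p 1) (p 2) (q 0) (q 1) (q 2) = 0 ∧
    Φ.quad (p 0) (p 1) (p 2) (q 0) (q 1) (q 2) = 0 ∧ Φ.valU (q 0) (q 1) (q 2) = 0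

/-- With x₁ ≠ 0, the conditions Z = 0 and X = 0 are those on the last two coefficients of U along
the tangent line; the first two vanish because p lies on the curve and the line is tangent. -/
theorem valZ_valX_iff_of_ne (p : Fin 3 → L) (h : Φ.valU (p 0) (p 1) (p 2) = 0) (hp : p 0 ≠ 0) :
    (Φ.valZ (p 0) (p 1) (p 2) = 0 ∧ Φ.valX (p 0) (p 1) (p 2) = 0) ↔
      ((Φ.dU (p 0) (p 1) (p 2) = 0 ∧ Φ.rot.dU (p 1) (p 2) (p 0) = 0 ∧
        Φ.rot.rot.dU (p 2) (p 0) (p 1) = 0) ∨ ∃ q, Φ.IsLineDir p q) := by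
  have hZ := Φ.valZ_mul_sq _ _ _ h
  have hX := Φ.valX_mul_pow _ _ _ h
  have he := Φ.euler (p 0) (p 1) (p 2)
  rw [h, mul_zero] at he
  constructor
  · rintro ⟨h1, h2⟩
    have hX := hX h1
    rw [h1, zero_mul, eq_comm] at hZ
    rw [h2, zero_mul, eq_comm, pow_eq_zero_iff two_ne_zero] at hX
    by_cases h3 : Φ.rot.dU (p 1) (p 2) (p 0) = 0 ∧ Φ.rot.rot.dU (p 2) (p 0) (p 1) = 0
    · left
      rw [h3.1, h3.2, mul_zero, mul_zero, add_zero, add_zero] at he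
      exact ⟨(mul_eq_zero.1 he).resolve_left hp, h3⟩
    · right
      -- The point of the tangent line on x₁ = 0. It is nonzero unless U₂ = U₃ = 0, in which case
      -- Euler's relation also gives U₁ = 0.
      refine ⟨![0, Φ.rot.rot.dU (p 2) (p 0) (p 1), -Φ.rot.dU (p 1) (p 2) (p 0)],
        fun c hc => ?_, ?_, ?_, ?_⟩
      · have h0 := congrFun hc 0
        have h0 : c = 0 := by simpa [hp] using h0
        have h4 := congrFun hc 1
        have h5 := congrFun hc 2
        simp [h0] at h4 h5
        exact h3 ⟨h5, h4⟩
      · simp [lin]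
        ring
      · simp [quad]
        linear_combination hZ
      · simpa using hX
  · have suff (h1 : Φ.rot.rot.valA (p 2) (p 0) (p 1) * Φ.rot.dU (p 1) (p 2) (p 0) ^ 2
          - Φ.valD (p 0) (p 1) (p 2) * Φ.rot.dU (p 1) (p 2) (p 0) * Φ.rot.rot.dU (p 2) (p 0) (p 1)
          + Φ.rot.valA (p 1) (p 2) (p 0) * Φ.rot.rot.dU (p 2) (p 0) (p 1) ^ 2 = 0)
        (h2 : Φ.valU 0 (Φ.rot.rot.dU (p 2) (p 0) (p 1)) (-Φ.rot.dU (p 1) (p 2) (p 0)) = 0) :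
        Φ.valZ (p 0) (p 1) (p 2) = 0 ∧ Φ.valX (p 0) (p 1) (p 2) = 0 := by
      rw [h1] at hZ
      have h3 := (mul_eq_zero.1 hZ).resolve_right (pow_ne_zero 2 hp)
      have := hX h3
      rw [h2, zero_pow two_ne_zero] at this
      exact ⟨h3, (mul_eq_zero.1 this).resolve_right (pow_ne_zero 6 hp)⟩
    rintro (⟨-, h2, h3⟩ | ⟨q, hq, h1, h2, h3⟩)
    · apply suff <;> simp [h2, h3, valU]
    -- Replace q by q - c p, the point (0, v, w) of the same line. Tangency then makes (U₃, -U₂) a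
    -- multiple μ of (v, w), possibly zero, so the vanishing along (v, w) carries over.
    · set c := q 0 / p 0
      have hc : q 0 = c * p 0 := by simp only [c]; field_simp
      set v := q 1 - c * p 1
      set w := q 2 - c * p 2
      have hv : q 1 = v + c * p 1 := by simp [v]
      have hw : q 2 = w + c * p 2 := by simp [w]
      have hvw : v ≠ 0 ∨ w ≠ 0 := by
        by_contra! h4
        apply hq c
        ext i
        fin_cases i
        · simpa using hc
        · simp [hv, h4.1]
        · simp [hw, h4.2]
      have h1' : Φ.rot.dU (p 1) (p 2) (p 0) * v + Φ.rot.rot.dU (p 2) (p 0) (p 1) * w = 0 := by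
        rw [hc, hv, hw, lin] at h1
        linear_combination h1 - c * he
      have h2' : Φ.rot.valA (p 1) (p 2) (p 0) * v ^ 2 + Φ.rot.rot.valA (p 2) (p 0) (p 1) * w ^ 2
          + Φ.valD (p 0) (p 1) (p 2) * v * w = 0 := by
        rw [hc, hv, hw] at h2
        simp only [quad, dU, valD, valA, vald, rot, valU] at h2 h1' h ⊢
        linear_combination h2 - 3 * c ^ 2 * h - 2 * c * h1'
      have h3' : Φ.valU 0 v w = 0 := by
        rw [hc, hv, hw] at h3
        simp only [dU, valD, valA, vald, rot, valU] at h2' h3 h1' h ⊢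
        linear_combination h3 - c ^ 3 * h - c ^ 2 * h1' - c * h2'
      obtain ⟨μ, h4, h5⟩ : ∃ μ, Φ.rot.dU (p 1) (p 2) (p 0) = -μ * w ∧
          Φ.rot.rot.dU (p 2) (p 0) (p 1) = μ * v := by
        rcases hvw with h0 | h0
        · refine ⟨Φ.rot.rot.dU (p 2) (p 0) (p 1) / v, ?_, by field_simp⟩
          field_simp
          linear_combination h1'
        · refine ⟨-Φ.rot.dU (p 1) (p 2) (p 0) / w, by field_simp, ?_⟩
          field_simp
          linear_combination h1'
      apply suff
      · rw [h4, h5]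
        linear_combination μ ^ 2 * h2'
      · rw [h4, h5]
        simp only [valU] at h3' ⊢
        linear_combination μ ^ 3 * h3'

theorem isLineDir_rot (p q : Fin 3 → L) :
    Φ.rot.IsLineDir ![p 1, p 2, p 0] ![q 1, q 2, q 0] ↔ Φ.IsLineDir p q := by
  have h (c : L) : ![q 1, q 2, q 0] = c • ![p 1, p 2, p 0] ↔ q = c • p := by
    simp only [funext_iff, Fin.forall_fin_succ]
    simp
    tauto
  simp only [IsLineDir, Ne, h]
  simp [lin_rot, quad_rot, valU_rot]

theorem valZ_valX_iff (p : Fin 3 → L) (h : Φ.valU (p 0) (p 1) (p 2) = 0) (hp : p ≠ 0) :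
    (Φ.valZ (p 0) (p 1) (p 2) = 0 ∧ Φ.valX (p 0) (p 1) (p 2) = 0) ↔
      ((Φ.dU (p 0) (p 1) (p 2) = 0 ∧ Φ.rot.dU (p 1) (p 2) (p 0) = 0 ∧
        Φ.rot.rot.dU (p 2) (p 0) (p 1) = 0) ∨ ∃ q, Φ.IsLineDir p q) := by
  -- Every term of the statement is invariant under cyclic rotation, so any nonzero coordinate of p
  -- may serve as the first.
  have step (Φ : Model3 L) (p : Fin 3 → L)
      (ih : Φ.rot.valU (p 1) (p 2) (p 0) = 0 →
        ((Φ.rot.valZ (p 1) (p 2) (p 0) = 0 ∧ Φ.rot.valX (p 1) (p 2) (p 0) = 0) ↔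
          ((Φ.rot.dU (p 1) (p 2) (p 0) = 0 ∧ Φ.rot.rot.dU (p 2) (p 0) (p 1) = 0 ∧
            Φ.dU (p 0) (p 1) (p 2) = 0) ∨ ∃ q, Φ.rot.IsLineDir ![p 1, p 2, p 0] q)))
      (h : Φ.valU (p 0) (p 1) (p 2) = 0) :
      (Φ.valZ (p 0) (p 1) (p 2) = 0 ∧ Φ.valX (p 0) (p 1) (p 2) = 0) ↔
        ((Φ.dU (p 0) (p 1) (p 2) = 0 ∧ Φ.rot.dU (p 1) (p 2) (p 0) = 0 ∧
          Φ.rot.rot.dU (p 2) (p 0) (p 1) = 0) ∨ ∃ q, Φ.IsLineDir p q) := by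
    rw [valU_rot, valZ_rot, valX_rot] at ih
    rw [ih h]
    refine or_congr (by tauto) ⟨fun ⟨q, hq⟩ => ⟨![q 2, q 0, q 1], ?_⟩,
      fun ⟨q, hq⟩ => ⟨_, (Φ.isLineDir_rot p q).2 hq⟩⟩
    rw [← isLineDir_rot]
    convert hq using 1
    ext i
    fin_cases i <;> rfl
  by_cases h0 : p 0 = 0
  · by_cases h1 : p 1 = 0
    · have h2 : p 2 ≠ 0 := fun h2 => hp (by ext i; fin_cases i <;> simp [h0, h1, h2])
      refine step _ _ (fun h' => step _ ![p 1, p 2, p 0] (fun h'' => ?_) h') h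
      exact Φ.rot.rot.valZ_valX_iff_of_ne ![p 2, p 0, p 1] h'' h2
    · refine step _ _ (fun h' => ?_) h
      exact Φ.rot.valZ_valX_iff_of_ne ![p 1, p 2, p 0] h' h1
  · exact Φ.valZ_valX_iff_of_ne p h h0

end Field

section Main

variable {K L : Type*} [Field K] [Field L] [Algebra K L] (Φ : Model3 K)

theorem aeval_U (v : Fin 3 → L) :
    aeval v Φ.U = (Φ.map (algebraMap K L)).valU (v 0) (v 1) (v 2) := by
  simp [U, valU, map]

theorem aeval_W (v : Fin 3 → L) (i : Fin 3) : aeval v (Φ.W i) =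
    ![(Φ.map (algebraMap K L)).valW (v 0) (v 1) (v 2),
      (Φ.map (algebraMap K L)).rot.valW (v 1) (v 2) (v 0),
      (Φ.map (algebraMap K L)).rot.rot.valW (v 2) (v 0) (v 1)] i := by
  fin_cases i <;>
  · simp only [W, valW, map, rot]
    simp [-map_add, -map_sub, -map_mul, -map_neg]
    simp only [map_add, map_sub, map_mul, map_neg, map_pow, aeval_C, aeval_X, map_ofNat]
    try ring

theorem aeval_covZ (v : Fin 3 → L) :
    aeval v Φ.covZ = (Φ.map (algebraMap K L)).valZ (v 0) (v 1) (v 2) := by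
  simp only [covZ, map_add, map_mul, aeval_X, aeval_W, valZ]
  rfl

theorem aeval_covX (v : Fin 3 → L) :
    aeval v Φ.covX = (Φ.map (algebraMap K L)).valX (v 0) (v 1) (v 2) := by
  have h2 : (Φ.map (algebraMap K L)).a₂ = algebraMap K L Φ.a₂ := by simp [a₂, map]
  simp only [covX, map_add, map_sub, map_mul, map_pow, aeval_C, aeval_X, aeval_W, aeval_covZ,
    map_ofNat, valX, valZ, h2]
  simp only [exprX, valA, vald, rot, map]
  simp
  ring

theorem eval_pderiv_U (v : Fin 3 → L) (i : Fin 3) :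
    eval v (pderiv i (MvPolynomial.map (algebraMap K L) Φ.U)) =
      ![(Φ.map (algebraMap K L)).dU (v 0) (v 1) (v 2),
      (Φ.map (algebraMap K L)).rot.dU (v 1) (v 2) (v 0),
      (Φ.map (algebraMap K L)).rot.rot.dU (v 2) (v 0) (v 1)] i := by
  fin_cases i <;>
  · simp [U, dU, valA, vald, map, rot, pderiv_X]
    ring

theorem aeval_F_G_eq_zero_iff (v : Fin 3 → L) (hv : v ≠ 0) (h : ∀ i, aeval v (Φ.eqn i) = 0) :
    (aeval v Φ.F = 0 ∧ aeval v Φ.G = 0) ↔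
      (IsSingularAt (fun i => MvPolynomial.map (algebraMap K L) (Φ.eqn i)) v ∨
        ∃ q, (Φ.map (algebraMap K L)).IsLineDir v q) := by
  have h0 := h 0
  rw [eqn, aeval_U] at h0
  rw [F, G, map_pow, aeval_covZ, aeval_covX, pow_eq_zero_iff two_ne_zero, valZ_valX_iff _ _ h0 hv,
    IsSingularAt, linearIndependent_unique_iff, not_not, funext_iff, Fin.forall_fin_succ,
    Fin.forall_fin_two]
  simp only [eqn, eval_pderiv_U]
  rfl

end Main

end Model3

/-! ### Quadratic forms in four variables: polar forms and substitutions. -/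

namespace Quadric4

section Values

variable {R S : Type*} [CommRing R] [CommRing S]

/-- Base change of a quadric. -/
def map (f : R →+* S) (q : Quadric4 R) : Quadric4 S :=
  ⟨f q.c11, f q.c12, f q.c13, f q.c14, f q.c22, f q.c23, f q.c24, f q.c33, f q.c34, f q.c44⟩

/-- The linear combination `s q + t q'`. -/
def comb (s t : R) (q q' : Quadric4 R) : Quadric4 R :=
  ⟨s * q.c11 + t * q'.c11, s * q.c12 + t * q'.c12, s * q.c13 + t * q'.c13,
    s * q.c14 + t * q'.c14, s * q.c22 + t * q'.c22, s * q.c23 + t * q'.c23,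
    s * q.c24 + t * q'.c24, s * q.c33 + t * q'.c33, s * q.c34 + t * q'.c34,
    s * q.c44 + t * q'.c44⟩

variable (q q' : Quadric4 R) (x y : Fin 4 → R)

/-- The value of a quadratic form. -/
def val : R :=
  q.c11 * x 0 ^ 2 + q.c12 * x 0 * x 1 + q.c13 * x 0 * x 2 + q.c14 * x 0 * x 3 + q.c22 * x 1 ^ 2
    + q.c23 * x 1 * x 2 + q.c24 * x 1 * x 3 + q.c33 * x 2 ^ 2 + q.c34 * x 2 * x 3
    + q.c44 * x 3 ^ 2

/-- The gradient of a quadratic form. -/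
def grad : Fin 4 → R :=
  ![2 * q.c11 * x 0 + q.c12 * x 1 + q.c13 * x 2 + q.c14 * x 3,
    q.c12 * x 0 + 2 * q.c22 * x 1 + q.c23 * x 2 + q.c24 * x 3,
    q.c13 * x 0 + q.c23 * x 1 + 2 * q.c33 * x 2 + q.c34 * x 3,
    q.c14 * x 0 + q.c24 * x 1 + q.c34 * x 2 + 2 * q.c44 * x 3]

/-- The polar form of a quadratic form. -/
def polar : R := q.grad x ⬝ᵥ y

theorem polar_eq : q.polar x y = q.val (x + y) - q.val x - q.val y := by
  simp [polar, grad, val, dotProduct, Fin.sum_univ_succ]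
  ring

theorem polar_self : q.polar x x = 2 * q.val x := by
  simp [polar, grad, val, dotProduct, Fin.sum_univ_succ]
  ring

theorem polar_comm : q.polar x y = q.polar y x := by
  rw [polar_eq, polar_eq, add_comm]
  ring

theorem polar_add (z : Fin 4 → R) : q.polar x (y + z) = q.polar x y + q.polar x z :=
  dotProduct_add _ _ _

theorem polar_smul (a : R) : q.polar x (a • y) = a * q.polar x y :=
  dotProduct_smul _ _ _

theorem val_smul (a : R) : q.val (a • x) = a ^ 2 * q.val x := by
  simp [val]
  ring

theorem val_add : q.val (x + y) = q.val x + q.polar x y + q.val y := by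
  rw [polar_eq]
  ring

theorem val_comb (s t : R) : (comb s t q q').val x = s * q.val x + t * q'.val x := by
  simp only [val, comb]
  ring

theorem polar_comb (s t : R) :
    (comb s t q q').polar x y = s * q.polar x y + t * q'.polar x y := by
  simp only [polar_eq, val_comb]
  ring

/-- The quadratic form in coordinates with respect to the family of vectors `w`. -/
def comp (w : Matrix (Fin 4) (Fin 4) R) : Quadric4 R :=
  ⟨q.val (w 0), q.polar (w 0) (w 1), q.polar (w 0) (w 2), q.polar (w 0) (w 3),
    q.val (w 1), q.polar (w 1) (w 2), q.polar (w 1) (w 3),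
    q.val (w 2), q.polar (w 2) (w 3), q.val (w 3)⟩

theorem val_comp (w : Matrix (Fin 4) (Fin 4) R) :
    (q.comp w).val x = q.val (Matrix.vecMul x w) := by
  have h : Matrix.vecMul x w = x 0 • w 0 + x 1 • w 1 + x 2 • w 2 + x 3 • w 3 := by
    ext i
    simp [Matrix.vecMul, dotProduct, Fin.sum_univ_four]
  have hc (a b c : Fin 4 → R) : q.polar (a + b) c = q.polar a c + q.polar b c := by
    rw [polar_comm, polar_add, polar_comm _ c, polar_comm _ c]
  have hs (r : R) (a c : Fin 4 → R) : q.polar (r • a) c = r * q.polar a c := by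
    rw [polar_comm, polar_smul, polar_comm]
  rw [h]
  simp only [val_add, val_smul, polar_smul, hc, hs]
  simp only [comp, val]
  ring

theorem polar_comp (w : Matrix (Fin 4) (Fin 4) R) :
    (q.comp w).polar x y = q.polar (Matrix.vecMul x w) (Matrix.vecMul y w) := by
  simp only [polar_eq, val_comp, Matrix.add_vecMul]

theorem comp_comp (w w' : Matrix (Fin 4) (Fin 4) R) :
    (q.comp w).comp w' = q.comp (w' * w) := by
  have h (i : Fin 4) : Matrix.vecMul (w' i) w = (w' * w) i := rfl
  rw [comp]
  simp only [val_comp, polar_comp, h]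
  rfl

theorem comp_one : q.comp 1 = q := by
  obtain ⟨⟩ := q
  simp [comp, val, polar, grad, dotProduct, Matrix.one_apply]

theorem comb_comp (s t : R) (w : Matrix (Fin 4) (Fin 4) R) :
    (comb s t q q').comp w = comb s t (q.comp w) (q'.comp w) := by
  simp only [comp, val_comb, polar_comb]
  rfl

theorem val_map (f : R →+* S) : (q.map f).val (f ∘ x) = f (q.val x) := by
  simp [val, map]

theorem grad_map (f : R →+* S) : (q.map f).grad (f ∘ x) = f ∘ q.grad x := by
  ext i
  fin_cases i <;> simp [grad, map, map_ofNat f 2]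

theorem polar_map (f : R →+* S) : (q.map f).polar (f ∘ x) (f ∘ y) = f (q.polar x y) := by
  simp [polar, grad_map, dotProduct]

theorem comp_map (f : R →+* S) (w : Matrix (Fin 4) (Fin 4) R) :
    (q.comp w).map f = (q.map f).comp (w.map f) := by
  have h (i : Fin 4) : w.map f i = f ∘ w i := rfl
  simp only [comp, h, val_map, polar_map]
  rfl

/-- Expands the adjugate entries, so that identities about the dual and its compatibility with base
change become polynomial computations. -/
theorem dual_eq : q.dual =
    { c11 := 4 * q.c22 * q.c33 * q.c44 - q.c22 * q.c34 ^ 2 - q.c23 ^ 2 * q.c44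
        + q.c23 * q.c24 * q.c34 - q.c24 ^ 2 * q.c33
      c22 := 4 * q.c11 * q.c33 * q.c44 - q.c11 * q.c34 ^ 2 - q.c13 ^ 2 * q.c44
        + q.c13 * q.c14 * q.c34 - q.c14 ^ 2 * q.c33
      c33 := 4 * q.c11 * q.c22 * q.c44 - q.c11 * q.c24 ^ 2 - q.c12 ^ 2 * q.c44
        + q.c12 * q.c14 * q.c24 - q.c14 ^ 2 * q.c22
      c44 := 4 * q.c11 * q.c22 * q.c33 - q.c11 * q.c23 ^ 2 - q.c12 ^ 2 * q.c33
        + q.c12 * q.c13 * q.c23 - q.c13 ^ 2 * q.c22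
      c12 := -(q.c12 * (4 * q.c33 * q.c44 - q.c34 ^ 2) - q.c13 * (2 * q.c23 * q.c44 - q.c24 * q.c34)
        + q.c14 * (q.c23 * q.c34 - 2 * q.c24 * q.c33))
      c13 := -(q.c13 * (4 * q.c22 * q.c44 - q.c24 ^ 2) - q.c12 * (2 * q.c23 * q.c44 - q.c34 * q.c24)
        + q.c14 * (q.c23 * q.c24 - 2 * q.c34 * q.c22))
      c14 := -(q.c14 * (4 * q.c22 * q.c33 - q.c23 ^ 2) - q.c12 * (2 * q.c24 * q.c33 - q.c34 * q.c23)
        + q.c13 * (q.c24 * q.c23 - 2 * q.c34 * q.c22))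
      c23 := -(q.c23 * (4 * q.c11 * q.c44 - q.c14 ^ 2) - q.c12 * (2 * q.c13 * q.c44 - q.c34 * q.c14)
        + q.c24 * (q.c13 * q.c14 - 2 * q.c34 * q.c11))
      c24 := -(q.c24 * (4 * q.c11 * q.c33 - q.c13 ^ 2) - q.c12 * (2 * q.c14 * q.c33 - q.c34 * q.c13)
        + q.c23 * (q.c14 * q.c13 - 2 * q.c34 * q.c11))
      c34 := -(q.c34 * (4 * q.c11 * q.c22 - q.c12 ^ 2) - q.c13 * (2 * q.c14 * q.c22 - q.c24 * q.c12)
        + q.c23 * (q.c14 * q.c12 - 2 * q.c24 * q.c11)) } := by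
  rw [dual, mk.injEq]
  refine ⟨rfl, ?_, ?_, ?_, rfl, ?_, ?_, rfl, ?_, rfl⟩ <;>
    simp [hess, coeffs, Matrix.adjugate_fin_succ_eq_det_submatrix, Matrix.det_fin_three,
      Fin.succAbove] <;> ring

end Values

end Quadric4

/-! ### Behaviour of pf, rd and the dual under linear substitutions. -/

namespace Quadric4

section Covariance

variable {R : Type*} [CommRing R]

theorem transvection_row (i j : Fin 4) (c : R) (k : Fin 4) :
    Matrix.transvection i j c k = Pi.single k 1 + if i = k then Pi.single j c else 0 := by
  ext l
  simp [Matrix.transvection, Matrix.one_apply, Matrix.single_apply, Pi.single_apply, eq_comm]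
  split_ifs <;> simp_all

/-- A transvection preserves det = pf² + 4 rd but not pf itself. It changes y² + pf y - rd by the
substitution y ↦ y + ρ, so the double root condition is unaffected. -/
theorem pf_rd_transvection (q : Quadric4 R) (i j : Fin 4) (hij : i ≠ j) (c : R) :
    ∃ ρ, (q.comp (Matrix.transvection i j c)).pf = q.pf + 2 * ρ ∧
      (q.comp (Matrix.transvection i j c)).rd = q.rd - ρ ^ 2 - ρ * q.pf := by
  obtain ⟨c11, c12, c13, c14, c22, c23, c24, c33, c34, c44⟩ := q
  generalize hq : comp ⟨c11, c12, c13, c14, c22, c23, c24, c33, c34, c44⟩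
    (Matrix.transvection i j c) = q'
  simp only [comp, transvection_row] at hq
  fin_cases i <;> fin_cases j
  all_goals first | exact absurd rfl hij | skip
  all_goals
    simp [val, polar, grad, dotProduct, Fin.sum_univ_succ, Pi.single_apply] at hq
    subst hq
  · refine ⟨c * (c22 * c34 + c23 * c24), ?_⟩
    constructor <;> simp only [pf, rd] <;> ring
  · refine ⟨c * (c33 * c24 + c23 * c34), ?_⟩
    constructor <;> simp only [pf, rd] <;> ring
  · refine ⟨c * (c44 * c23 + c24 * c34), ?_⟩
    constructor <;> simp only [pf, rd] <;> ring
  · refine ⟨c * (c11 * c34 + c13 * c14), ?_⟩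
    constructor <;> simp only [pf, rd] <;> ring
  · refine ⟨c * (c33 * c14 + c13 * c34), ?_⟩
    constructor <;> simp only [pf, rd] <;> ring
  · refine ⟨c * (c44 * c13 + c14 * c34), ?_⟩
    constructor <;> simp only [pf, rd] <;> ring
  · refine ⟨c * (c11 * c24 + c12 * c14), ?_⟩
    constructor <;> simp only [pf, rd] <;> ring
  · refine ⟨c * (c22 * c14 + c12 * c24), ?_⟩
    constructor <;> simp only [pf, rd] <;> ring
  · refine ⟨c * (c44 * c12 + c14 * c24), ?_⟩
    constructor <;> simp only [pf, rd] <;> ring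
  · refine ⟨c * (c11 * c23 + c12 * c13), ?_⟩
    constructor <;> simp only [pf, rd] <;> ring
  · refine ⟨c * (c22 * c13 + c12 * c23), ?_⟩
    constructor <;> simp only [pf, rd] <;> ring
  · refine ⟨c * (c33 * c12 + c13 * c23), ?_⟩
    constructor <;> simp only [pf, rd] <;> ring

theorem dual_comp_transvection (q : Quadric4 R) (i j : Fin 4) (hij : i ≠ j) (c : R) :
    (q.comp (Matrix.transvection i j c)).dual = q.dual.comp (Matrix.transvection j i (-c)) := by
  obtain ⟨c11, c12, c13, c14, c22, c23, c24, c33, c34, c44⟩ := q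
  rw [dual_eq, dual_eq]
  simp only [comp, transvection_row]
  fin_cases i <;> fin_cases j
  all_goals first | exact absurd rfl hij | skip
  all_goals
    simp [val, polar, grad, dotProduct, Fin.sum_univ_succ, Pi.single_apply]
    and_intros <;> ring

theorem pf_rd_diagonal (q : Quadric4 R) (d : Fin 4 → R) :
    (q.comp (Matrix.diagonal d)).pf = d 0 * d 1 * d 2 * d 3 * q.pf ∧
      (q.comp (Matrix.diagonal d)).rd = (d 0 * d 1 * d 2 * d 3) ^ 2 * q.rd := by
  have h (i j : Fin 4) : Matrix.diagonal d i j = if i = j then d i else 0 :=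
    Matrix.diagonal_apply d i j
  obtain ⟨c11, c12, c13, c14, c22, c23, c24, c33, c34, c44⟩ := q
  simp [comp, val, polar, grad, dotProduct, h, pf, rd]
  constructor <;> ring

theorem dual_comp_diagonal (q : Quadric4 R) (d : Fin 4 → R) :
    (q.comp (Matrix.diagonal d)).dual = q.dual.comp (Matrix.diagonal
      ![d 1 * d 2 * d 3, d 0 * d 2 * d 3, d 0 * d 1 * d 3, d 0 * d 1 * d 2]) := by
  have h (d : Fin 4 → R) (i j : Fin 4) : Matrix.diagonal d i j = if i = j then d i else 0 :=
    Matrix.diagonal_apply d i j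
  obtain ⟨c11, c12, c13, c14, c22, c23, c24, c33, c34, c44⟩ := q
  rw [dual_eq, dual_eq]
  simp [comp, val, polar, grad, dotProduct, h]
  and_intros <;> ring

theorem adjugate_transvection (i j : Fin 4) (hij : i ≠ j) (c : R) :
    (Matrix.transvection i j c).adjugate = Matrix.transvection i j (-c) := by
  have h : Matrix.transvection i j c * Matrix.transvection i j (-c) = 1 := by
    rw [Matrix.transvection_mul_transvection_same i j hij]
    simp
  calc _ = (Matrix.transvection i j c).adjugate *
        (Matrix.transvection i j c * Matrix.transvection i j (-c)) := by rw [h, mul_one]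
    _ = _ := by
      rw [← mul_assoc, Matrix.adjugate_mul, Matrix.det_transvection_of_ne i j hij, one_smul,
        one_mul]

theorem transpose_transvection (i j : Fin 4) (c : R) :
    (Matrix.transvection i j c).transpose = Matrix.transvection j i c := by
  simp [Matrix.transvection]

end Covariance

section Field

variable {L : Type*} [Field L]

/-- Taking adjugates of Hessian matrices would only determine twice the diagonal coefficients of the
dual, which is not enough in characteristic 2. The identity is therefore checked on diagonal
matrices and transvections, and composed. -/
theorem dual_comp (q : Quadric4 L) (w : Matrix (Fin 4) (Fin 4) L) :
    (q.comp w).dual = q.dual.comp w.adjugate.transpose := by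
  revert q
  refine Matrix.diagonal_transvection_induction
    (fun w => ∀ q : Quadric4 L, (q.comp w).dual = q.dual.comp w.adjugate.transpose) w ?_ ?_ ?_
  · intro d _ q
    rw [dual_comp_diagonal, Matrix.adjugate_diagonal, Matrix.diagonal_transpose]
    congr 2
    ext i
    have h0 : (Finset.univ : Finset (Fin 4)).erase 0 = {1, 2, 3} := by decide
    have h1 : (Finset.univ : Finset (Fin 4)).erase 1 = {0, 2, 3} := by decide
    have h2 : (Finset.univ : Finset (Fin 4)).erase 2 = {0, 1, 3} := by decide
    have h3 : (Finset.univ : Finset (Fin 4)).erase 3 = {0, 1, 2} := by decide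
    fin_cases i <;> simp [h0, h1, h2, h3, mul_assoc]
  · rintro ⟨i, j, hij, c⟩ q
    rw [Matrix.TransvectionStruct.toMatrix_mk, dual_comp_transvection q i j hij,
      adjugate_transvection i j hij, transpose_transvection]
  · intro a b ha hb q
    rw [← comp_comp, ha, hb, comp_comp, Matrix.adjugate_mul_distrib, Matrix.transpose_mul]

/-- Gradients transform by w itself, so the values entering T₁ and T₂ can be computed in any basis
up to the common factor det² . -/
theorem val_dual_comp (q : Quadric4 L) (w : Matrix (Fin 4) (Fin 4) L) (u : Fin 4 → L) :
    (q.comp w).dual.val (Matrix.mulVec w u) = w.det ^ 2 * q.dual.val u := by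
  rw [dual_comp, val_comp, Matrix.vecMul_transpose, Matrix.mulVec_mulVec, Matrix.adjugate_mul,
    Matrix.smul_mulVec, Matrix.one_mulVec, val_smul]

/-- The pencil `y² + pf y = rd` has a solution to first order in the parameter. -/
def HasDoubleRoot (q : Quadric4 (Polynomial L)) : Prop :=
  ∃ Y : Polynomial L, Polynomial.X ^ 2 ∣ Y ^ 2 + Y * q.pf - q.rd ∧ Polynomial.X ∣ 2 * Y + q.pf

theorem HasDoubleRoot.comp {q : Quadric4 (Polynomial L)} (hq : q.HasDoubleRoot)
    (w : Matrix (Fin 4) (Fin 4) L) : (q.comp (w.map Polynomial.C)).HasDoubleRoot := by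
  revert q
  refine Matrix.diagonal_transvection_induction
    (fun w => ∀ {q : Quadric4 (Polynomial L)}, q.HasDoubleRoot →
      (q.comp (w.map Polynomial.C)).HasDoubleRoot) w ?_ ?_ ?_
  · rintro d _ q ⟨Y, h1, h2⟩
    have hd : (Matrix.diagonal d).map Polynomial.C = Matrix.diagonal (Polynomial.C ∘ d) :=
      Matrix.diagonal_map (map_zero _)
    obtain ⟨h3, h4⟩ := q.pf_rd_diagonal (Polynomial.C ∘ d)
    rw [hd]
    set D := (Polynomial.C ∘ d) 0 * (Polynomial.C ∘ d) 1 * (Polynomial.C ∘ d) 2 *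
      (Polynomial.C ∘ d) 3
    refine ⟨D * Y, ?_, ?_⟩
    · rw [h3, h4]
      convert h1.mul_left (D ^ 2) using 1
      ring
    · rw [h3]
      convert h2.mul_left D using 1
      ring
  · rintro ⟨i, j, hij, c⟩ q ⟨Y, h1, h2⟩
    have ht : (Matrix.transvection i j c).map Polynomial.C =
        Matrix.transvection i j (Polynomial.C c) := by
      ext k l
      simp [Matrix.transvection, Matrix.one_apply, Matrix.single_apply]
      split_ifs <;> simp
    rw [Matrix.TransvectionStruct.toMatrix_mk, ht]
    obtain ⟨ρ, h3, h4⟩ := q.pf_rd_transvection i j hij (Polynomial.C c)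
    refine ⟨Y - ρ, ?_, ?_⟩
    · rw [h3, h4]
      convert h1 using 1
      ring
    · rw [h3]
      convert h2 using 1
      ring
  · intro a b ha hb q hq
    rw [Matrix.map_mul, ← comp_comp]
    exact ha (hb hq)

theorem hasDoubleRoot_comp_iff (q : Quadric4 (Polynomial L)) (w : Matrix (Fin 4) (Fin 4) L)
    (hw : w.det ≠ 0) : (q.comp (w.map Polynomial.C)).HasDoubleRoot ↔ q.HasDoubleRoot := by
  refine ⟨fun h => ?_, fun h => h.comp w⟩
  have h' := h.comp w⁻¹
  rw [comp_comp, ← Matrix.map_mul, Matrix.nonsing_inv_mul _ (isUnit_iff_ne_zero.2 hw),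
    Matrix.map_one _ (map_zero _) (map_one _), comp_one] at h'
  exact h'

end Field

end Quadric4

/-! ### Degree 4: the associated binary quartic, the forms T, and adapted coordinates. -/

namespace Model4

open MvPolynomial Quadric4

section Pencil

variable {K R : Type*} [CommRing K] [CommRing R]

/-- The homogenisation of degree `d` of a polynomial, evaluated at `(x, z)`. -/
noncomputable def homEval (f : K →+* R) (d : ℕ) (x z : R) (p : Polynomial K) : R :=
  ∑ i ∈ Finset.range (d + 1), f (p.coeff i) * x ^ (d - i) * z ^ i

variable (f : K →+* R) (x z : R)

theorem homEval_add (d : ℕ) (p q : Polynomial K) :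
    homEval f d x z (p + q) = homEval f d x z p + homEval f d x z q := by
  simp only [homEval, Polynomial.coeff_add, map_add, add_mul, Finset.sum_add_distrib]

theorem homEval_sub (d : ℕ) (p q : Polynomial K) :
    homEval f d x z (p - q) = homEval f d x z p - homEval f d x z q := by
  simp only [homEval, Polynomial.coeff_sub, map_sub, sub_mul, Finset.sum_sub_distrib]

theorem homEval_C_mul (d : ℕ) (a : K) (p : Polynomial K) :
    homEval f d x z (Polynomial.C a * p) = f a * homEval f d x z p := by
  simp only [homEval, Polynomial.coeff_C_mul, map_mul, Finset.mul_sum, mul_assoc]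

theorem homEval_mul_two (a₁ b₁ a₂ b₂ : K) :
    homEval f 2 x z ((.C a₁ + .X * .C b₁) * (.C a₂ + .X * .C b₂)) =
      (x * f a₁ + z * f b₁) * (x * f a₂ + z * f b₂) := by
  have h : ((.C a₁ + .X * .C b₁) * (.C a₂ + .X * .C b₂) : Polynomial K) =
      .C (a₁ * a₂) + .C (a₁ * b₂ + b₁ * a₂) * .X ^ 1 + .C (b₁ * b₂) * .X ^ 2 := by
    simp only [Polynomial.C_mul, Polynomial.C_add]
    ring
  rw [h]
  simp only [homEval, Finset.sum_range_succ, Finset.sum_range_zero, Polynomial.coeff_add,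
    Polynomial.coeff_C_mul, Polynomial.coeff_X_pow, Polynomial.coeff_C]
  simp
  ring

theorem homEval_mul_four (a₁ b₁ a₂ b₂ a₃ b₃ a₄ b₄ : K) :
    homEval f 4 x z ((.C a₁ + .X * .C b₁) * (.C a₂ + .X * .C b₂) * (.C a₃ + .X * .C b₃)
      * (.C a₄ + .X * .C b₄)) =
      (x * f a₁ + z * f b₁) * (x * f a₂ + z * f b₂) * (x * f a₃ + z * f b₃)
        * (x * f a₄ + z * f b₄) := by
  have h : ((.C a₁ + .X * .C b₁) * (.C a₂ + .X * .C b₂) * (.C a₃ + .X * .C b₃)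
      * (.C a₄ + .X * .C b₄) : Polynomial K) =
      .C (a₁ * a₂ * a₃ * a₄)
      + .C (b₁ * a₂ * a₃ * a₄ + a₁ * b₂ * a₃ * a₄ + a₁ * a₂ * b₃ * a₄ + a₁ * a₂ * a₃ * b₄) * .X ^ 1
      + .C (b₁ * b₂ * a₃ * a₄ + b₁ * a₂ * b₃ * a₄ + b₁ * a₂ * a₃ * b₄ + a₁ * b₂ * b₃ * a₄
        + a₁ * b₂ * a₃ * b₄ + a₁ * a₂ * b₃ * b₄) * .X ^ 2
      + .C (a₁ * b₂ * b₃ * b₄ + b₁ * a₂ * b₃ * b₄ + b₁ * b₂ * a₃ * b₄ + b₁ * b₂ * b₃ * a₄) * .X ^ 3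
      + .C (b₁ * b₂ * b₃ * b₄) * .X ^ 4 := by
    simp only [Polynomial.C_mul, Polynomial.C_add]
    ring
  rw [h]
  simp only [homEval, Finset.sum_range_succ, Finset.sum_range_zero, Polynomial.coeff_add,
    Polynomial.coeff_C_mul, Polynomial.coeff_X_pow, Polynomial.coeff_C]
  simp
  ring

/-- The coefficients were read off at x₁ = 1. `homEval` restores the homogeneous form and is
multiplicative on products of exactly two, or four, linear factors, which is all that pf and rd
involve. A general target ring allows evaluation at points moving in a polynomial parameter. -/
theorem valP_toModel2 (Φ : Model4 K) : (Φ.toModel2.map f).valP x z =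
    (comb x z (Φ.Q₁.map f) (Φ.Q₂.map f)).pf := by
  have h : (Φ.toModel2.map f).valP x z = homEval f 2 x z Φ.pencil.pf := by
    simp [homEval, Finset.sum_range_succ, Model2.valP, Model2.map, toModel2]
  rw [h]
  simp only [pencil, pf, homEval_add, homEval_mul_two]
  rfl

theorem valQ_toModel2 (Φ : Model4 K) : (Φ.toModel2.map f).valQ x z =
    (comb x z (Φ.Q₁.map f) (Φ.Q₂.map f)).rd := by
  have h : (Φ.toModel2.map f).valQ x z = homEval f 4 x z Φ.pencil.rd := by
    simp [homEval, Finset.sum_range_succ, Model2.valQ, Model2.map, toModel2]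
  have h4 : (4 : Polynomial K) = .C 4 := rfl
  rw [h]
  simp only [pencil, rd, homEval_add, homEval_sub, sq, h4, mul_assoc,
    homEval_C_mul]
  simp only [← mul_assoc, homEval_mul_four, comb, Quadric4.map, map_ofNat]

end Pencil

section T

variable {K L : Type*} [CommRing K] [CommRing L] [Algebra K L]

/-- The sum splits in two. The first part has the factor ∑ Aᵢⱼ vᵢ vⱼ = 2 q(v) = 0; the second is
minus the dual of q' at the gradient of q. -/
theorem aeval_T (q q' : Quadric4 K) (v : Fin 4 → L) (hv : (q.map (algebraMap K L)).val v = 0) :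
    aeval v (T q q') = -(q'.map (algebraMap K L)).dual.val ((q.map (algebraMap K L)).grad v) := by
  have hd : (q'.map (algebraMap K L)).dual = q'.dual.map (algebraMap K L) := by
    rw [dual_eq, dual_eq]
    simp only [Quadric4.map, map_add, map_sub, map_mul, map_neg, map_pow, map_ofNat]
  have h (A B : Fin 4 → Fin 4 → L) : ∑ i, ∑ j, ∑ r, ∑ s,
      B r s * (A i j * A r s - A i s * A j r) * v i * v j =
      (∑ r, ∑ s, B r s * A r s) * (∑ i, ∑ j, A i j * v i * v j)
      - ∑ r, ∑ s, B r s * (∑ i, A i s * v i) * (∑ j, A j r * v j) := by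
    have e1 : (∑ r, ∑ s, B r s * A r s) * (∑ i, ∑ j, A i j * v i * v j) =
        ∑ i, ∑ j, ∑ r, ∑ s, B r s * A r s * (A i j * v i * v j) := by
      simp only [Finset.mul_sum]
      refine Finset.sum_congr rfl fun i _ => Finset.sum_congr rfl fun j _ => ?_
      simp only [Finset.sum_mul]
    have e2 : ∑ r, ∑ s, B r s * (∑ i, A i s * v i) * (∑ j, A j r * v j) =
        ∑ i, ∑ j, ∑ r, ∑ s, B r s * (A i s * v i) * (A j r * v j) := by
      have hc (F : Fin 4 → Fin 4 → Fin 4 → Fin 4 → L) :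
          ∑ r, ∑ s, ∑ i, ∑ j, F r s i j = ∑ i, ∑ j, ∑ r, ∑ s, F r s i j :=
        calc _ = ∑ r, ∑ i, ∑ s, ∑ j, F r s i j := Finset.sum_congr rfl fun r _ => Finset.sum_comm
          _ = ∑ i, ∑ r, ∑ s, ∑ j, F r s i j := Finset.sum_comm
          _ = ∑ i, ∑ r, ∑ j, ∑ s, F r s i j := Finset.sum_congr rfl fun i _ =>
            Finset.sum_congr rfl fun r _ => Finset.sum_comm
          _ = _ := Finset.sum_congr rfl fun i _ => Finset.sum_comm
      rw [← hc]
      refine Finset.sum_congr rfl fun r _ => Finset.sum_congr rfl fun s _ => ?_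
      simp only [Finset.mul_sum, Finset.sum_mul]
      exact Finset.sum_comm
    rw [e1, e2]
    simp only [← Finset.sum_sub_distrib]
    refine Finset.sum_congr rfl fun i _ => Finset.sum_congr rfl fun j _ =>
      Finset.sum_congr rfl fun r _ => Finset.sum_congr rfl fun s _ => ?_
    ring
  simp only [T, map_sum, map_mul, aeval_C, aeval_X, map_sub]
  rw [h]
  have h1 : ∑ i, ∑ j, algebraMap K L (q.hess i j) * v i * v j = 0 := by
    have := (q.map (algebraMap K L)).polar_self v
    rw [hv, mul_zero] at this
    rw [← this]
    simp [hess, Quadric4.coeffs, Fin.sum_univ_succ, polar, grad, dotProduct, Quadric4.map]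
    ring
  have h2 (s : Fin 4) : ∑ i, algebraMap K L (q.hess i s) * v i =
      (q.map (algebraMap K L)).grad v s := by
    fin_cases s <;> simp [hess, Quadric4.coeffs, Fin.sum_univ_succ, grad, Quadric4.map] <;> ring
  rw [h1, mul_zero, zero_sub, hd]
  simp only [h2]
  generalize (q.map (algebraMap K L)).grad v = u
  simp [Quadric4.coeffs, Fin.sum_univ_succ, Quadric4.map, val]
  ring

end T

section Field

variable {L : Type*} [Field L]

/-- A basis adapted to a nonsingular point of the intersection of two quadrics. -/
theorem exists_adapted_basis (u₁ u₂ p : Fin 4 → L) (hu : LinearIndependent L ![u₁, u₂])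
    (hp : p ≠ 0) (h₁ : u₁ ⬝ᵥ p = 0) (h₂ : u₂ ⬝ᵥ p = 0) :
    ∃ w : Matrix (Fin 4) (Fin 4) L, w.det ≠ 0 ∧ w 0 = p ∧
      w.mulVec u₁ = ![0, 0, 0, 1] ∧ w.mulVec u₂ = ![0, 0, 1, 0] := by
  set A : (Fin 4 → L) →ₗ[L] (Fin 2 → L) := (Matrix.of ![u₁, u₂]).mulVecLin
  have hA (x : Fin 4 → L) : A x = ![u₁ ⬝ᵥ x, u₂ ⬝ᵥ x] := by
    ext i
    fin_cases i <;> rfl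
  have hrk : Module.finrank L (LinearMap.range A) = 2 := by
    have := LinearIndependent.rank_matrix (M := Matrix.of ![u₁, u₂]) hu
    simpa [Matrix.rank] using this
  have hsurj : Function.Surjective A := by
    rw [← LinearMap.range_eq_top]
    exact Submodule.eq_top_of_finrank_eq (by simp [hrk])
  have hker : Module.finrank L (LinearMap.ker A) = 2 := by
    have := A.finrank_range_add_finrank_ker
    simp [hrk] at this
    omega
  -- The vectors p and q span the common kernel of the two gradients, the cone over the tangent
  -- line. The vectors a and b below are dual to the gradients modulo this kernel.
  obtain ⟨q, hq, hqp⟩ : ∃ q ∈ LinearMap.ker A, q ∉ Submodule.span L {p} := by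
    by_contra! h
    have h1 := Submodule.finrank_mono (s := LinearMap.ker A) (t := Submodule.span L {p}) h
    rw [hker, finrank_span_singleton hp] at h1
    omega
  obtain ⟨a, ha⟩ := hsurj ![0, 1]
  obtain ⟨b, hb⟩ := hsurj ![1, 0]
  have hq' : A q = 0 := hq
  rw [hA, funext_iff, Fin.forall_fin_two] at hq' ha hb
  simp at hq' ha hb
  refine ⟨Matrix.of ![p, q, a, b], ?_, rfl, ?_, ?_⟩
  · rw [← isUnit_iff_ne_zero, ← Matrix.isUnit_iff_isUnit_det, ← Matrix.linearIndependent_rows_iff_isUnit,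
      Fintype.linearIndependent_iff]
    intro g hg
    simp [Fin.sum_univ_four] at hg
    have e1 := congrArg (u₁ ⬝ᵥ ·) hg
    have e2 := congrArg (u₂ ⬝ᵥ ·) hg
    simp [dotProduct_add, h₁, h₂, hq', ha, hb] at e1 e2
    rw [e1, e2] at hg
    simp at hg
    have h1 : g 1 = 0 := by
      by_contra h1
      apply hqp
      rw [Submodule.mem_span_singleton]
      refine ⟨-(g 0) / g 1, ?_⟩
      have : q = -((g 1)⁻¹ • g 0 • p) := by
        rw [eq_neg_iff_add_eq_zero]
        calc _ = (g 1)⁻¹ • (g 0 • p + g 1 • q) := by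
              rw [smul_add, smul_smul (g 1)⁻¹ (g 1), inv_mul_cancel₀ h1, one_smul, add_comm]
          _ = 0 := by rw [hg, smul_zero]
      rw [this, smul_smul, ← neg_smul]
      congr 1
      ring
    have h0 : g 0 = 0 := by simpa [h1, hp] using hg
    intro i
    fin_cases i <;> assumption
  · ext i
    fin_cases i <;> simp [Matrix.mulVec, dotProduct_comm _ u₁, h₁, hq', ha, hb]
  · ext i
    fin_cases i <;> simp [Matrix.mulVec, dotProduct_comm _ u₂, h₂, hq', ha, hb]

/-- The criterion for a double root, for a pencil in adapted coordinates. -/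
theorem hasDoubleRoot_iff_of_adapted (q₁ q₂ : Quadric4 L) (s t s' t' : L)
    (h1 : q₁.c11 = 0) (h2 : q₁.c12 = 0) (h3 : q₁.c13 = 0) (h4 : q₁.c14 = 1)
    (h1' : q₂.c11 = 0) (h2' : q₂.c12 = 0) (h3' : q₂.c13 = 1) (h4' : q₂.c14 = 0)
    (h5 : s * q₁.c22 + t * q₂.c22 = 0) (h5' : s' * q₁.c22 + t' * q₂.c22 ≠ 0) :
    (comb (.C s + .X * .C s') (.C t + .X * .C t') (q₁.map Polynomial.C)
      (q₂.map Polynomial.C)).HasDoubleRoot ↔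
    s * (comb s t q₁ q₂).c23 = t * (comb s t q₁ q₂).c24 ∧
      (comb s t q₁ q₂).c33 * s ^ 2 - (comb s t q₁ q₂).c34 * s * t
        + (comb s t q₁ q₂).c44 * t ^ 2 = 0 := by
  obtain ⟨a11, a12, a13, a14, α, a23, a24, a33, a34, a44⟩ := q₁
  obtain ⟨b11, b12, b13, b14, β, b23, b24, b33, b34, b44⟩ := q₂
  simp only at h1 h2 h3 h4 h1' h2' h3' h4' h5 h5'
  subst h1 h2 h3 h4 h1' h2' h3' h4'
  simp only [HasDoubleRoot, X_sq_dvd_iff, Polynomial.X_dvd_iff, Polynomial.coeff_zero_eq_eval_zero]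
  simp [comb, Quadric4.map, pf, rd, Polynomial.derivative_pow]
  constructor
  · rintro ⟨Y, ⟨h1, h2⟩, h3⟩
    set y := Y.eval 0
    set y' := Y.derivative.eval 0
    -- When the coefficient of x₂² in the member (s, t) vanishes, Y² + pf Y - rd factors. The double
    -- root condition `h3` makes both factors vanish.
    have h6 : (y + s * (s * a23 + t * b23)) * (y + t * (s * a24 + t * b24)) = 0 := by
      linear_combination h1 - ((s * a33 + t * b33) * s ^ 2 - (s * a34 + t * b34) * s * t
        + (s * a44 + t * b44) * t ^ 2) * h5
    have h7 : y = -(s * (s * a23 + t * b23)) ∧ y = -(t * (s * a24 + t * b24)) := by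
      rcases mul_eq_zero.1 h6 with h | h
      · exact ⟨by linear_combination h, by linear_combination h3 - h⟩
      · exact ⟨by linear_combination h3 - h, by linear_combination h⟩
    -- In the first order term the contributions of Y' and of the two factors cancel. What remains
    -- is the wanted quadratic expression times the derivative of the x₂² coefficient, nonzero by
    -- `h5'`.
    refine ⟨by linear_combination h7.1 - h7.2, (mul_eq_zero.1 ?_).resolve_left h5'⟩
    linear_combination h2 - y' * h3 - (t' * (s * a24 + t * b24) + t * (s' * a24 + t' * b24)) * h7.1
      - (s' * (s * a23 + t * b23) + s * (s' * a23 + t' * b23)) * h7.2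
      - (t ^ 2 * (s' * a44 + t' * b44) + 2 * t * t' * (s * a44 + t * b44)
        - (t' * s + t * s') * (s * a34 + t * b34) - t * s * (s' * a34 + t' * b34)
        + 2 * s * s' * (s * a33 + t * b33) + s ^ 2 * (s' * a33 + t' * b33)) * h5
  · rintro ⟨h1, h2⟩
    refine ⟨.C (-(s * (s * a23 + t * b23))), ⟨?_, ?_⟩, ?_⟩
    · simp
      linear_combination ((s * a33 + t * b33) * s ^ 2 - (s * a34 + t * b34) * s * t
        + (s * a44 + t * b44) * t ^ 2) * h5
    · simp
      linear_combination (s' * α + t' * β) * h2 - (s' * (s * a23 + t * b23) + s * (s' * a23 + t' * b23)) * h1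
        + (t ^ 2 * (s' * a44 + t' * b44) + 2 * t * t' * (s * a44 + t * b44)
        - (t' * s + t * s') * (s * a34 + t * b34) - t * s * (s' * a34 + t' * b34)
        + 2 * s * s' * (s * a33 + t * b33) + s ^ 2 * (s' * a33 + t' * b33)) * h5
    · simp
      linear_combination -h1

end Field

end Model4

/-! ### Degree 4: the criterion in terms of tangent lines and tangent planes. -/

namespace Model4

open MvPolynomial Quadric4

section Field

variable {L : Type*} [Field L]

/-- The line through the points `p` and `q` is contained in the intersection of two quadrics
(for `p` on this intersection). -/
def IsLineDir (q₁ q₂ : Quadric4 L) (p q : Fin 4 → L) : Prop :=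
  (∀ c : L, q ≠ c • p) ∧ q₁.polar p q = 0 ∧ q₂.polar p q = 0 ∧ q₁.val q = 0 ∧ q₂.val q = 0

/-- Some quadric in the pencil contains its tangent plane at `p`. -/
def HasPlane (q₁ q₂ : Quadric4 L) (p : Fin 4 → L) : Prop :=
  ∃ s t : L, (s ≠ 0 ∨ t ≠ 0) ∧ ∀ x, (comb s t q₁ q₂).polar p x = 0 → (comb s t q₁ q₂).val x = 0

theorem exists_det_ne_zero (p : Fin 4 → L) (hp : p ≠ 0) :
    ∃ w : Matrix (Fin 4) (Fin 4) L, w.det ≠ 0 ∧ w 0 = p := by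
  by_cases h0 : p 0 = 0
  · by_cases h1 : p 1 = 0
    · by_cases h2 : p 2 = 0
      · have h3 : p 3 ≠ 0 := fun h3 => hp (by ext i; fin_cases i <;> assumption)
        refine ⟨Matrix.of ![p, Pi.single 0 1, Pi.single 1 1, Pi.single 2 1], ?_, rfl⟩
        simp [Matrix.det_succ_row_zero, Fin.sum_univ_succ, Fin.succAbove, h0, h1, h2, h3]
      · refine ⟨Matrix.of ![p, Pi.single 0 1, Pi.single 1 1, Pi.single 3 1], ?_, rfl⟩
        simp [Matrix.det_succ_row_zero, Fin.sum_univ_succ, Fin.succAbove, h0, h1, h2]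
    · refine ⟨Matrix.of ![p, Pi.single 0 1, Pi.single 2 1, Pi.single 3 1], ?_, rfl⟩
      simp [Matrix.det_succ_row_zero, Fin.sum_univ_succ, Fin.succAbove, h0, h1]
  · refine ⟨Matrix.of ![p, Pi.single 1 1, Pi.single 2 1, Pi.single 3 1], ?_, rfl⟩
    simp [Matrix.det_succ_row_zero, Fin.sum_univ_succ, Fin.succAbove, h0]

theorem grad_comp (q : Quadric4 L) (w : Matrix (Fin 4) (Fin 4) L) :
    w.mulVec (q.grad (w 0)) = ![2 * (q.comp w).c11, (q.comp w).c12, (q.comp w).c13,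
      (q.comp w).c14] := by
  ext i
  fin_cases i
  · simp [Matrix.mulVec, comp, ← polar_self, polar, dotProduct_comm]
  all_goals simp [Matrix.mulVec, comp, polar, dotProduct_comm]

/-- In a basis starting with p, the first row of the Hessian matrix is b times the coordinate vector
of y, whose first entry is y · p = 0. The dual at y then vanishes identically, including when b = 0
and p is a singular point of the quadric. -/
theorem val_dual_grad_eq_zero (q : Quadric4 L) (p y : Fin 4 → L) (b : L) (hp : p ≠ 0)
    (hq : q.val p = 0) (hy : y ⬝ᵥ p = 0) (h : q.grad p = b • y) : q.dual.val y = 0 := by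
  obtain ⟨w, hw, rfl⟩ := exists_det_ne_zero p hp
  have key := q.val_dual_comp w y
  suffices hs : (q.comp w).dual.val (w.mulVec y) = 0 by
    rw [hs, eq_comm] at key
    exact (mul_eq_zero.1 key).resolve_left (pow_ne_zero 2 hw)
  have h1 := grad_comp q w
  rw [h, Matrix.mulVec_smul] at h1
  have h2 : w.mulVec y 0 = 0 := by
    rw [← hy, dotProduct_comm]
    rfl
  have h11 : (q.comp w).c11 = 0 := hq
  generalize w.mulVec y = z at *
  have e1 := congrFun h1 1
  have e2 := congrFun h1 2
  have e3 := congrFun h1 3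
  simp at e1 e2 e3
  rw [dual_eq]
  simp only [val, h11, ← e1, ← e2, ← e3, h2]
  ring

/-- At a singular point both gradients are multiples of one y orthogonal to p, so T₁ and T₂ vanish
there and F₄ = G₄ = 0 for trivial reasons. -/
theorem val_dual_eq_zero_of_not_linearIndependent (q₁ q₂ : Quadric4 L) (p : Fin 4 → L)
    (hp : p ≠ 0) (h₁ : q₁.val p = 0) (h₂ : q₂.val p = 0)
    (h : ¬ LinearIndependent L ![q₁.grad p, q₂.grad p]) :
    q₂.dual.val (q₁.grad p) = 0 ∧ q₁.dual.val (q₂.grad p) = 0 := by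
  have h₁' : q₁.grad p ⬝ᵥ p = 0 := by
    rw [← polar, polar_self, h₁, mul_zero]
  have h₂' : q₂.grad p ⬝ᵥ p = 0 := by
    rw [← polar, polar_self, h₂, mul_zero]
  obtain ⟨y, a, b, hy, ha, hb⟩ : ∃ (y : Fin 4 → L) (a b : L), y ⬝ᵥ p = 0 ∧
      q₁.grad p = a • y ∧ q₂.grad p = b • y := by
    rw [LinearIndependent.pair_iff] at h
    push Not at h
    obtain ⟨s, t, hst, h0⟩ := h
    by_cases hs : s = 0
    · have ht := h0 hs
      refine ⟨q₁.grad p, 1, 0, h₁', (one_smul _ _).symm, ?_⟩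
      rw [hs, zero_smul, zero_add, smul_eq_zero] at hst
      rw [zero_smul]
      exact hst.resolve_left ht
    · refine ⟨q₂.grad p, -(s⁻¹ * t), 1, h₂', ?_, (one_smul _ _).symm⟩
      rw [neg_smul, eq_neg_iff_add_eq_zero, mul_smul, ← smul_right_injective _ hs |>.eq_iff]
      simpa [smul_smul, hs] using hst
  constructor
  · rw [ha, val_smul, val_dual_grad_eq_zero q₂ p y b hp h₂ hy hb, mul_zero]
  · rw [hb, val_smul, val_dual_grad_eq_zero q₁ p y a hp h₁ hy ha, mul_zero]

/-- In an adapted basis w 0 = p and w 1 spans the tangent direction. The dual values reduce to minus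
the x₂² coefficients of the two forms, so (τ₁, τ₂) is proportional to the member of the pencil
vanishing on the tangent line. The first order double root condition there becomes the two equations
saying that this member vanishes on its tangent plane at p. -/
theorem isLineDir_or_hasPlane_iff [IsAlgClosed L] (Ψ : Model2 L) (q₁ q₂ : Quadric4 L)
    (hP : ∀ x z, (Ψ.map Polynomial.C).valP x z =
      (comb x z (q₁.map Polynomial.C) (q₂.map Polynomial.C)).pf)
    (hQ : ∀ x z, (Ψ.map Polynomial.C).valQ x z =
      (comb x z (q₁.map Polynomial.C) (q₂.map Polynomial.C)).rd)
    (p : Fin 4 → L) (hp : p ≠ 0) (h₁ : q₁.val p = 0) (h₂ : q₂.val p = 0)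
    (hs : LinearIndependent L ![q₁.grad p, q₂.grad p]) :
    (Ψ.valF (-q₂.dual.val (q₁.grad p)) (q₁.dual.val (q₂.grad p)) = 0 ∧
      Ψ.valG (-q₂.dual.val (q₁.grad p)) (q₁.dual.val (q₂.grad p)) = 0) ↔
      ((∃ q, IsLineDir q₁ q₂ p q) ∨ HasPlane q₁ q₂ p) := by
  have h₁' : q₁.grad p ⬝ᵥ p = 0 := by
    rw [← polar, polar_self, h₁, mul_zero]
  have h₂' : q₂.grad p ⬝ᵥ p = 0 := by
    rw [← polar, polar_self, h₂, mul_zero]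
  obtain ⟨w, hw, rfl, hw1, hw2⟩ := exists_adapted_basis _ _ p hs hp h₁' h₂'
  have hT1 := q₂.val_dual_comp w (q₁.grad (w 0))
  have hT2 := q₁.val_dual_comp w (q₂.grad (w 0))
  have hg1 := grad_comp q₁ w
  have hg2 := grad_comp q₂ w
  rw [hw1] at hT1 hg1
  rw [hw2] at hT2 hg2
  generalize q₂.dual.val (q₁.grad (w 0)) = T at hT1 ⊢
  generalize q₁.dual.val (q₂.grad (w 0)) = τ₂ at hT2 ⊢
  obtain ⟨τ₁, rfl⟩ : ∃ τ₁, T = -τ₁ := ⟨-T, (neg_neg T).symm⟩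
  rw [neg_neg]
  rw [mul_neg] at hT1
  rw [dual_eq] at hT1 hT2
  have a11 : (q₁.comp w).c11 = 0 := h₁
  have b11 : (q₂.comp w).c11 = 0 := h₂
  have a12 : (q₁.comp w).c12 = 0 := (congrFun hg1 1).symm
  have a13 : (q₁.comp w).c13 = 0 := (congrFun hg1 2).symm
  have a14 : (q₁.comp w).c14 = 1 := (congrFun hg1 3).symm
  have b12 : (q₂.comp w).c12 = 0 := (congrFun hg2 1).symm
  have b13 : (q₂.comp w).c13 = 1 := (congrFun hg2 2).symm
  have b14 : (q₂.comp w).c14 = 0 := (congrFun hg2 3).symm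
  simp [val, a11, b11, a12, b12, a13, b13, a14, b14] at hT1 hT2
  have hdC := hasDoubleRoot_comp_iff (w := w) (hw := hw)
  have hcompC (q : Quadric4 L) := q.comp_map Polynomial.C w
  have hw0 : w 0 = Matrix.vecMul (Pi.single 0 1) w := by simp [Matrix.row]
  have hvec (x : Fin 4 → L) : ∃ y, x = Matrix.vecMul y w :=
    ⟨Matrix.vecMul x w⁻¹, by
      rw [Matrix.vecMul_vecMul, Matrix.nonsing_inv_mul _ (isUnit_iff_ne_zero.2 hw),
        Matrix.vecMul_one]⟩
  have hval (s t : L) (y : Fin 4 → L) : (comb s t q₁ q₂).val (Matrix.vecMul y w) =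
      (comb s t (q₁.comp w) (q₂.comp w)).val y := by
    rw [← comb_comp, val_comp]
  have hpol (s t : L) (y : Fin 4 → L) : (comb s t q₁ q₂).polar (w 0) (Matrix.vecMul y w) =
      t * y 2 + s * y 3 := by
    rw [hw0, ← polar_comp, comb_comp]
    simp [polar, grad, dotProduct, Fin.sum_univ_succ, comb, a11, a12, a13, a14, b11, b12, b13, b14]
  have hval₁ (y : Fin 4 → L) : q₁.val (Matrix.vecMul y w) = (q₁.comp w).val y := by
    rw [val_comp]
  have hval₂ (y : Fin 4 → L) : q₂.val (Matrix.vecMul y w) = (q₂.comp w).val y := by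
    rw [val_comp]
  have hpol₁ (y : Fin 4 → L) : q₁.polar (w 0) (Matrix.vecMul y w) = y 3 := by
    rw [hw0, ← polar_comp]
    simp [polar, grad, dotProduct, Fin.sum_univ_succ, a11, a12, a13, a14]
  have hpol₂ (y : Fin 4 → L) : q₂.polar (w 0) (Matrix.vecMul y w) = y 2 := by
    rw [hw0, ← polar_comp]
    simp [polar, grad, dotProduct, Fin.sum_univ_succ, b11, b12, b13, b14]
  have hne (y : Fin 4 → L) : (∀ c : L, Matrix.vecMul y w ≠ c • w 0) ↔
      y 1 ≠ 0 ∨ y 2 ≠ 0 ∨ y 3 ≠ 0 := by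
    constructor
    · intro h
      by_contra! h'
      apply h (y 0)
      have : y = y 0 • Pi.single 0 1 := by
        ext i
        fin_cases i <;> simp [h']
      rw [this, Matrix.smul_vecMul, ← hw0]
      simp
    · rintro h c hc
      have h0 : Matrix.vecMul (y - c • Pi.single 0 1) w = 0 := by
        rw [Matrix.sub_vecMul, hc, Matrix.smul_vecMul, ← hw0, sub_self]
      have h0 := Matrix.eq_zero_of_vecMul_eq_zero hw h0
      have h1 := congrFun h0 1
      have h2 := congrFun h0 2
      have h3 := congrFun h0 3
      simp at h1 h2 h3
      tauto
  have hd : w.det ^ 2 ≠ 0 := pow_ne_zero 2 hw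
  generalize w.det ^ 2 = d at *
  set r₁ := q₁.comp w
  set r₂ := q₂.comp w
  -- Both forms vanish on the tangent line: it lies in the curve, and τ₁ = τ₂ = 0.
  by_cases h0 : r₁.c22 = 0 ∧ r₂.c22 = 0
  · have hτ₁ : τ₁ = 0 := by simpa [h0.2, hd] using hT1.symm
    have hτ₂ : τ₂ = 0 := by simpa [h0.1, hd] using hT2.symm
    refine iff_of_true (by simp [hτ₁, hτ₂, Model2.valF, Model2.valG, Model2.valP, Model2.valQ])
      (Or.inl ⟨Matrix.vecMul (Pi.single 1 1) w, (hne _).2 (by simp), ?_, ?_, ?_, ?_⟩)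
    · rw [hpol₁]
      simp
    · rw [hpol₂]
      simp
    · rw [hval₁]
      simp [val, h0.1]
    · rw [hval₂]
      simp [val, h0.2]
  have hτ : τ₁ ≠ 0 ∨ τ₂ ≠ 0 := by
    by_contra! h
    apply h0
    rw [h.1, mul_zero] at hT1
    rw [h.2, mul_zero, neg_eq_zero] at hT2
    exact ⟨hT2, hT1⟩
  obtain ⟨s', t', hst⟩ : ∃ s' t', τ₁ * t' - τ₂ * s' ≠ 0 := by
    by_cases h : τ₁ = 0
    · exact ⟨1, 0, by simpa [h] using hτ⟩
    · exact ⟨0, 1, by simpa using h⟩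
  -- The member (τ₁, τ₂) vanishes at w 1, hence on the tangent line. Any independent direction (s',
  -- t') changes the x₂² coefficient to first order.
  have h5 : τ₁ * r₁.c22 + τ₂ * r₂.c22 = 0 := by
    apply mul_left_cancel₀ hd
    linear_combination -r₁.c22 * hT1 - r₂.c22 * hT2
  rw [Ψ.valF_valG_eq_zero_iff_exists τ₁ τ₂ s' t' hst, hP, hQ]
  change HasDoubleRoot _ ↔ _
  rw [← hdC, comb_comp, ← hcompC, ← hcompC, hasDoubleRoot_iff_of_adapted _ _ _ _ _ _ a11 a12 a13 a14
    b11 b12 b13 b14]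
  rotate_left
  · exact h5
  · intro h
    apply mul_ne_zero hd hst
    linear_combination h - t' * hT1 + s' * hT2
  constructor
  · rintro ⟨h1, h2⟩
    refine Or.inr ⟨τ₁, τ₂, hτ, fun x hx => ?_⟩
    obtain ⟨y, rfl⟩ := hvec x
    rw [hpol] at hx
    rw [hval]
    obtain ⟨c, h3, h4⟩ : ∃ c, y 2 = c * τ₁ ∧ y 3 = -(c * τ₂) := by
      rcases hτ with h | h
      · refine ⟨y 2 / τ₁, by field_simp, ?_⟩
        field_simp
        linear_combination hx
      · refine ⟨-y 3 / τ₂, ?_, by field_simp⟩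
        field_simp
        linear_combination hx
    simp only [comb, val, a11, a12, a13, a14, b11, b12, b13, b14, h3, h4] at h1 h2 ⊢
    linear_combination c * y 1 * h1 + c ^ 2 * h2 + y 1 ^ 2 * h5
  · rintro (⟨q, hq, h1, h2, h3, h4⟩ | ⟨s, t, hst', h⟩)
    -- A line through p in both quadrics is tangent to both, so it is the line spanned by p and w 1,
    -- contrary to `h0`.
    · exfalso
      obtain ⟨y, rfl⟩ := hvec q
      rw [hpol₁] at h1
      rw [hpol₂] at h2
      rw [hval₁] at h3
      rw [hval₂] at h4
      have hy : y 1 ≠ 0 := by simpa [h1, h2] using (hne y).1 hq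
      simp [val, a11, b11, a12, b12, h1, h2, hy] at h3 h4
      exact h0 ⟨h3, h4⟩
    -- Vanishing at w 1 forces (s, t) to be proportional to (τ₁, τ₂). The values a = 0 and a = 1
    -- isolate the square term and the cross term of the form on the tangent plane.
    · have key (a : L) := h (Matrix.vecMul ![0, a, s, -t] w) (by
        rw [hpol]
        simp
        ring)
      have key0 := h (Matrix.vecMul ![0, 1, 0, 0] w) (by
        rw [hpol]
        simp)
      rw [hval] at key0
      simp only [hval] at key
      have key1 := key 0
      have key2 := key 1
      simp [val, comb, a11, a12, a13, a14, b11, b12, b13, b14] at key0 key1 key2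
      have h6 : s * τ₂ = t * τ₁ := by
        apply mul_left_cancel₀ hd
        linear_combination t * hT1 - s * hT2 - key0
      obtain ⟨c, rfl, rfl⟩ : ∃ c, τ₁ = c * s ∧ τ₂ = c * t := by
        rcases hst' with h | h
        · refine ⟨τ₁ / s, by field_simp, ?_⟩
          field_simp
          linear_combination h6
        · refine ⟨τ₂ / t, ?_, by field_simp⟩
          field_simp
          linear_combination -h6
      simp only [comb]
      constructor
      · linear_combination c ^ 2 * (key2 - key1 - key0)
      · linear_combination c ^ 3 * key1

end Field

section Main

variable {K L : Type*} [Field K] [Field L] [Algebra K L] (Φ : Model4 K)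

theorem aeval_toPoly (q : Quadric4 K) (v : Fin 4 → L) :
    aeval v q.toPoly = (q.map (algebraMap K L)).val v := by
  simp [toPoly, Quadric4.coeffs, Fin.sum_univ_succ, val, Quadric4.map]
  ring

theorem eval_pderiv_toPoly (q : Quadric4 K) (v : Fin 4 → L) (i : Fin 4) :
    eval v (pderiv i (MvPolynomial.map (algebraMap K L) q.toPoly)) =
      (q.map (algebraMap K L)).grad v i := by
  fin_cases i <;>
  · simp [toPoly, Quadric4.coeffs, Fin.sum_univ_succ, grad, Quadric4.map, pderiv_X]
    ring

theorem isSingularAt_iff (v : Fin 4 → L) :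
    IsSingularAt (fun i => MvPolynomial.map (algebraMap K L) (Φ.eqn i)) v ↔
      ¬ LinearIndependent L ![(Φ.Q₁.map (algebraMap K L)).grad v,
        (Φ.Q₂.map (algebraMap K L)).grad v] := by
  rw [IsSingularAt]
  have h : (fun j i => eval v (pderiv i (MvPolynomial.map (algebraMap K L) (Φ.eqn j)))) =
      ![(Φ.Q₁.map (algebraMap K L)).grad v, (Φ.Q₂.map (algebraMap K L)).grad v] := by
    ext j i
    fin_cases j
    · exact eval_pderiv_toPoly _ _ _
    · exact eval_pderiv_toPoly _ _ _
  rw [h]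

theorem aeval_F_G_eq_zero_iff [IsAlgClosed L] (v : Fin 4 → L) (hv : v ≠ 0)
    (h : ∀ i, aeval v (Φ.eqn i) = 0) :
    (aeval v Φ.F = 0 ∧ aeval v Φ.G = 0) ↔
      (IsSingularAt (fun i => MvPolynomial.map (algebraMap K L) (Φ.eqn i)) v ∨
        (∃ q, IsLineDir (Φ.Q₁.map (algebraMap K L)) (Φ.Q₂.map (algebraMap K L)) v q) ∨
        HasPlane (Φ.Q₁.map (algebraMap K L)) (Φ.Q₂.map (algebraMap K L)) v) := by
  have h1 : (Φ.Q₁.map (algebraMap K L)).val v = 0 := by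
    rw [← aeval_toPoly]
    exact h 0
  have h2 : (Φ.Q₂.map (algebraMap K L)).val v = 0 := by
    rw [← aeval_toPoly]
    exact h 1
  have hcomp (p : MvPolynomial (Fin 2) K) : aeval v (aeval ![Φ.T₁, -Φ.T₂] p) =
      aeval ![-(Φ.Q₂.map (algebraMap K L)).dual.val ((Φ.Q₁.map (algebraMap K L)).grad v),
        (Φ.Q₁.map (algebraMap K L)).dual.val ((Φ.Q₂.map (algebraMap K L)).grad v)] p := by
    rw [← AlgHom.comp_apply, comp_aeval]
    congr 2
    ext i
    fin_cases i
    · simp [T₁, aeval_T _ _ _ h1]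
    · simp [T₂, aeval_T _ _ _ h2]
  rw [isSingularAt_iff, F, G, hcomp, hcomp, Model2.aeval_F, Model2.aeval_G]
  by_cases hs : LinearIndependent L ![(Φ.Q₁.map (algebraMap K L)).grad v,
      (Φ.Q₂.map (algebraMap K L)).grad v]
  · rw [isLineDir_or_hasPlane_iff _ _ _ (fun x z => ?_) (fun x z => ?_) v hv h1 h2 hs]
    · simp [hs]
    · exact valP_toModel2 (Polynomial.C.comp (algebraMap K L)) x z Φ
    · exact valQ_toModel2 (Polynomial.C.comp (algebraMap K L)) x z Φ
  · obtain ⟨h3, h4⟩ := val_dual_eq_zero_of_not_linearIndependent _ _ v hv h1 h2 hs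
    rw [h3, h4]
    simp [hs, Model2.valF, Model2.valG, Model2.valP, Model2.valQ]

end Main

end Model4

/-! ### Cones, vanishing ideals and heights. -/

section Cone

open MvPolynomial

variable {L : Type*} [Field L] {n : ℕ}

/-- An ideal that contains the homogeneous components of its elements. -/
def IsCone (I : Ideal (MvPolynomial (Fin n) L)) : Prop :=
  ∀ f ∈ I, ∀ i, homogeneousComponent i f ∈ I

attribute [local instance] MvPolynomial.gradedAlgebra

/-- The homogeneous core of a minimal prime is again prime and contains the generators, so
minimality makes the two equal. -/
theorem isCone_of_mem_minimalPrimes {ι : Type*} {f : ι → MvPolynomial (Fin n) L} {d : ℕ}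
    (hf : ∀ i, (f i).IsHomogeneous d) {I : Ideal (MvPolynomial (Fin n) L)}
    (hI : I ∈ (Ideal.span (Set.range f)).minimalPrimes) : IsCone I := by
  have h1 : (Ideal.span (Set.range f)).IsHomogeneous (homogeneousSubmodule (Fin n) L) := by
    refine Ideal.homogeneous_span _ _ ?_
    rintro _ ⟨i, rfl⟩
    exact ⟨d, hf i⟩
  have h2 : Ideal.span (Set.range f) ≤
      (I.homogeneousCore (homogeneousSubmodule (Fin n) L)).toIdeal := by
    rw [Ideal.span_le]
    rintro _ ⟨i, rfl⟩
    exact Ideal.mem_homogeneousCore_of_homogeneous_of_mem ⟨d, hf i⟩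
      (hI.1.2 (Ideal.subset_span ⟨i, rfl⟩))
  have h3 := hI.2 ⟨Ideal.IsPrime.homogeneousCore hI.1.1, h2⟩
    (Ideal.toIdeal_homogeneousCore_le _ I)
  have h4 : I.IsHomogeneous (homogeneousSubmodule (Fin n) L) := by
    rw [Ideal.IsHomogeneous.iff_eq]
    exact le_antisymm (Ideal.toIdeal_homogeneousCore_le _ I) h3
  intro g hg i
  exact (mem_iff_homogeneousComponent_mem h4 g).1 hg i

theorem eval_smul_of_isHomogeneous {f : MvPolynomial (Fin n) L} {d : ℕ} (hf : f.IsHomogeneous d)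
    (c : L) (v : Fin n → L) : eval (c • v) f = c ^ d * eval v f := by
  rw [eval_eq', eval_eq', Finset.mul_sum]
  refine Finset.sum_congr rfl fun e he => ?_
  have h : ∑ i, e i = d := by
    rw [← hf (mem_support_iff.1 he), Finsupp.weight_apply, Finsupp.sum_fintype _ _ (by simp)]
    simp
  simp only [Pi.smul_apply, smul_eq_mul, mul_pow, Finset.prod_mul_distrib, Finset.prod_pow_eq_pow_sum,
    h]
  ring

theorem IsCone.smul_mem {I : Ideal (MvPolynomial (Fin n) L)} (hI : IsCone I) {v : Fin n → L}
    (hv : v ∈ zeroLocus L I) (c : L) : c • v ∈ zeroLocus L I := by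
  intro f hf
  rw [← sum_homogeneousComponent f, map_sum]
  refine Finset.sum_eq_zero fun i _ => ?_
  have h1 := hv _ (hI f hf i)
  rw [aeval_eq_eval] at h1 ⊢
  rw [eval_smul_of_isHomogeneous (homogeneousComponent_isHomogeneous i f), h1, mul_zero]

theorem IsCone.mk_mem_projZeros_iff {I : Ideal (MvPolynomial (Fin n) L)} (hI : IsCone I)
    (v : Fin n → L) (hv : v ≠ 0) :
    Projectivization.mk L v hv ∈ projZeros I ↔ v ∈ zeroLocus L I := by
  obtain ⟨a, ha⟩ := Projectivization.exists_smul_eq_mk_rep L v hv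
  have : Projectivization.mk L v hv ∈ projZeros I ↔ a • v ∈ zeroLocus L I := by
    rw [ha]
    simp only [mem_zeroLocus_iff, aeval_eq_eval]
    rfl
  rw [this]
  refine ⟨fun h => ?_, fun h => hI.smul_mem h _⟩
  simpa [Units.smul_def, smul_smul] using hI.smul_mem h (a⁻¹ : Lˣ)

theorem rep_mem_zeroLocus_iff {I : Ideal (MvPolynomial (Fin n) L)} (p : ℙ L (Fin n → L)) :
    p.rep ∈ zeroLocus L I ↔ p ∈ projZeros I := by
  simp only [mem_zeroLocus_iff, aeval_eq_eval]
  rfl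

theorem mk_mem_linearLocus (W : Submodule L (Fin n → L)) (v : Fin n → L) (hv : v ≠ 0) :
    Projectivization.mk L v hv ∈ linearLocus W ↔ v ∈ W := by
  simp [linearLocus, Projectivization.submodule_mk]

theorem rep_mem_iff (W : Submodule L (Fin n → L)) (p : ℙ L (Fin n → L)) :
    p.rep ∈ W ↔ p ∈ linearLocus W := by
  rw [← mk_mem_linearLocus _ _ p.rep_nonzero, Projectivization.mk_rep]

/-- The ideal is the kernel of substitution of γ, a homomorphism to a polynomial ring, which is a
domain. -/
theorem vanishingIdeal_isPrime_of_param [Infinite L] {σ : Type*}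
    (γ : Fin n → MvPolynomial σ L) :
    (vanishingIdeal L (Set.range fun t : σ → L => fun i => eval t (γ i))).IsPrime := by
  have : vanishingIdeal L (Set.range fun t : σ → L => fun i => eval t (γ i)) =
      RingHom.ker (aeval γ : MvPolynomial (Fin n) L →ₐ[L] MvPolynomial σ L) := by
    ext f
    rw [mem_vanishingIdeal_iff, RingHom.mem_ker]
    have key (t : σ → L) : aeval (fun i => eval t (γ i)) f = eval t (aeval γ f) := by
      have := congrArg (fun φ => φ f) (comp_aeval γ (aeval t : MvPolynomial σ L →ₐ[L] L))
      simpa [aeval_eq_eval] using this.symm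
    simp only [Set.forall_mem_range, key]
    exact ⟨fun h => MvPolynomial.funext fun t => by rw [h, map_zero], fun h t => by rw [h, map_zero]⟩
  rw [this]
  exact RingHom.ker_isPrime _

theorem exists_param (W : Submodule L (Fin n → L)) : ∃ γ : Fin n → MvPolynomial
    (Fin (Module.finrank L W)) L,
    (W : Set (Fin n → L)) = Set.range fun t : Fin (Module.finrank L W) → L => fun i =>
      eval t (γ i) := by
  let b := Module.finBasis L W
  refine ⟨fun i => ∑ j, C ((b j : Fin n → L) i) * X j, ?_⟩
  have key (t : Fin (Module.finrank L W) → L) :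
      (fun i => eval t (∑ j, C ((b j : Fin n → L) i) * X j)) =
        ((∑ j, t j • b j : W) : Fin n → L) := by
    ext i
    simp [mul_comm]
  ext v
  constructor
  · intro hv
    refine ⟨b.repr ⟨v, hv⟩, ?_⟩
    beta_reduce
    rw [key, b.sum_repr]
  · rintro ⟨t, rfl⟩
    beta_reduce
    rw [key]
    exact Subtype.prop _

instance vanishingIdeal_submodule_isPrime [Infinite L] (W : Submodule L (Fin n → L)) :
    (vanishingIdeal L (W : Set (Fin n → L))).IsPrime := by
  obtain ⟨γ, h⟩ := exists_param W
  rw [h]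
  exact vanishingIdeal_isPrime_of_param γ

/-- A linear form vanishing on a subspace but not at a given vector. -/
theorem exists_linear_form (W : Submodule L (Fin n → L)) (v : Fin n → L) (hv : v ∉ W) :
    ∃ u : Fin n → L, (∀ w ∈ W, u ⬝ᵥ w = 0) ∧ u ⬝ᵥ v ≠ 0 := by
  obtain ⟨φ, hφ, hW⟩ := W.exists_le_ker_of_notMem hv
  have key (w : Fin n → L) : (fun i => φ (Pi.single i 1)) ⬝ᵥ w = φ w := by
    conv_rhs => rw [pi_eq_sum_univ' w, map_sum]
    simp [dotProduct, mul_comm]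
  exact ⟨_, fun w hw => (key w).trans (hW hw), by rw [key]; exact hφ⟩

theorem aeval_linear_form (u v : Fin n → L) :
    aeval v (∑ i, C (u i) * X i : MvPolynomial (Fin n) L) = u ⬝ᵥ v := by
  simp [dotProduct]

theorem vanishingIdeal_lt {S : Set (Fin n → L)} {W : Submodule L (Fin n → L)}
    (h : (W : Set (Fin n → L)) ⊆ S) {v : Fin n → L} (hv : v ∈ S) (hvW : v ∉ W) :
    vanishingIdeal L S < vanishingIdeal L (W : Set (Fin n → L)) := by
  refine lt_of_le_not_ge (vanishingIdeal_anti_mono h) fun h' => ?_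
  obtain ⟨u, hu, huv⟩ := exists_linear_form W v hvW
  refine huv ?_
  rw [← aeval_linear_form]
  refine h' (fun w hw => ?_) v hv
  rw [aeval_linear_form, hu w hw]

/-- Enlarging W one dimension at a time gives a strictly descending chain of primes. Together with
`height_vanishingIdeal_add_le`, which shrinks W instead, this makes the height equal to the
codimension. -/
theorem le_height_vanishingIdeal [Infinite L] (k : ℕ) (W : Submodule L (Fin n → L))
    (hk : Module.finrank L W + k ≤ n) :
    (k : ℕ∞) ≤ (vanishingIdeal L (W : Set (Fin n → L))).height := by
  induction k generalizing W with
  | zero => simp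
  | succ k ih =>
    obtain ⟨v, hv⟩ : ∃ v, v ∉ W := by
      by_contra! h
      rw [(Submodule.eq_top_iff'.2 h), finrank_top, Module.finrank_fin_fun] at hk
      omega
    have h1 : Module.finrank L (W ⊔ Submodule.span L {v} : Submodule L (Fin n → L)) ≤
        Module.finrank L W + 1 :=
      (Submodule.finrank_add_le_finrank_add_finrank W (Submodule.span L {v})).trans
        (Nat.add_le_add_left ((finrank_span_le_card _).trans (by simp)) _)
    have h2 := vanishingIdeal_lt (W := W)
      (S := (W ⊔ Submodule.span L {v} : Submodule L (Fin n → L)))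
      (SetLike.coe_subset_coe.2 le_sup_left)
      (SetLike.le_def.1 le_sup_right (Submodule.mem_span_singleton_self v)) hv
    have h3 := Ideal.height_add_one_le_of_lt_of_isPrime h2
    exact (Nat.cast_succ k).trans_le ((add_le_add_left (ih _ (by omega)) 1).trans h3)

theorem height_le (I : Ideal (MvPolynomial (Fin n) L)) [I.IsPrime] : I.height ≤ n := by
  have h := Ideal.height_le_ringKrullDim_of_isPrime (I := I)
  rw [ringKrullDim_of_isNoetherianRing, ringKrullDim_eq_zero_of_field, zero_add,
    Nat.card_eq_fintype_card, Fintype.card_fin] at h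
  exact_mod_cast h

theorem height_vanishingIdeal_add_le [Infinite L] (W : Submodule L (Fin n → L)) :
    (vanishingIdeal L (W : Set (Fin n → L))).height + Module.finrank L W ≤ n := by
  obtain ⟨d, hd⟩ : ∃ d, Module.finrank L W = d := ⟨_, rfl⟩
  induction d generalizing W with
  | zero => rw [hd, Nat.cast_zero, add_zero]; exact height_le _
  | succ d ih =>
    obtain ⟨W', h1, h2⟩ : ∃ W' ≤ W, Module.finrank L W' = d := by
      obtain ⟨f, hf⟩ := exists_linearIndependent_of_le_finrank (R := L) (M := W) (n := d) (by omega)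
      have hf' := hf.map' W.subtype W.ker_subtype
      refine ⟨Submodule.span L (Set.range (W.subtype ∘ f)), ?_, ?_⟩
      · rw [Submodule.span_le]
        rintro _ ⟨i, rfl⟩
        exact (f i).2
      · rw [finrank_span_eq_card hf', Fintype.card_fin]
    obtain ⟨v, hv, hv'⟩ : ∃ v ∈ W, v ∉ W' := by
      by_contra! h
      have := Submodule.finrank_mono h
      omega
    have h3 := Ideal.height_add_one_le_of_lt_of_isPrime
      (vanishingIdeal_lt (S := (W : Set (Fin n → L))) h1 hv hv')
    have h4 := ih W' h2
    rw [hd]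
    rw [h2] at h4
    calc _ = (vanishingIdeal L (W : Set (Fin n → L))).height + 1 + (d : ℕ∞) := by
            push_cast; ring
      _ ≤ _ := (add_le_add_left h3 _).trans h4

/-- A cone of dimension at least two contains infinitely many lines through the origin. -/
theorem projZeros_infinite [IsAlgClosed L] {k : ℕ} (hk : k + 1 < n)
    {f : Fin k → MvPolynomial (Fin n) L} {I : Ideal (MvPolynomial (Fin n) L)} (hI : IsCone I)
    (hmin : I ∈ (Ideal.span (Set.range f)).minimalPrimes) : (projZeros I).Infinite := by
  intro hfin
  have : I.IsPrime := hmin.1.1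
  -- The zero subspace accounts for the origin in case the projective zero set is empty.
  have hle : (insert ⊥ (Projectivization.submodule '' projZeros I)).Finite :=
    (hfin.image _).insert _
  have h1 : hle.toFinset.inf (fun W : Submodule L (Fin n → L) =>
      vanishingIdeal L (W : Set (Fin n → L))) ≤ I := by
    intro g hg
    rw [← IsPrime.vanishingIdeal_zeroLocus (K := L) I]
    intro v hv
    have hg' : ∀ W ∈ hle.toFinset, g ∈ vanishingIdeal L (W : Set (Fin n → L)) :=
      fun W hW => Finset.inf_le (f := fun W : Submodule L (Fin n → L) =>
        vanishingIdeal L (W : Set (Fin n → L))) hW hg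
    by_cases h0 : v = 0
    · exact hg' ⊥ (by simp) v (by simp [h0])
    · refine hg' (Projectivization.mk L v h0).submodule ?_ v ?_
      · rw [Set.Finite.mem_toFinset]
        exact Or.inr ⟨_, (hI.mk_mem_projZeros_iff v h0).2 hv, rfl⟩
      · rw [Projectivization.submodule_mk]
        exact Submodule.mem_span_singleton_self v
  obtain ⟨W, hW, hWI⟩ := (Ideal.IsPrime.inf_le' this).1 h1
  have hrank : Module.finrank L W ≤ 1 := by
    rw [Set.Finite.mem_toFinset] at hW
    rcases hW with rfl | ⟨p, -, rfl⟩
    · simp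
    · exact (Projectivization.finrank_submodule p).le
  have h2 := (le_height_vanishingIdeal (n - 1) W (by omega)).trans (Ideal.height_mono hWI)
  have h3 := Ideal.height_le_card_of_mem_minimalPrimes_span (Set.finite_range f) hmin
  have h4 : (Set.range f).ncard ≤ k := by
    rw [← Set.image_univ]
    exact (Set.ncard_image_le Set.finite_univ).trans (by simp)
  have h5 : ((n - 1 : ℕ) : ℕ∞) ≤ (k : ℕ∞) := h2.trans (h3.trans (by exact_mod_cast h4))
  have : n - 1 ≤ k := by exact_mod_cast h5
  omega

end Cone

/-! ### Degrees of lines and conics; lines contained in cones. -/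

section Degree

open MvPolynomial

variable {L : Type*} [Field L] {n : ℕ}

theorem aeval_line (f : MvPolynomial (Fin n) L) (a b : Fin n → L) (r : L) :
    (aeval (fun i => Polynomial.C (b i) + Polynomial.X * Polynomial.C (a i)) f).eval r =
      aeval (b + r • a) f := by
  have := congrArg (fun φ => φ f) (comp_aeval
    (fun i => Polynomial.C (b i) + Polynomial.X * Polynomial.C (a i))
    (Polynomial.aeval r : Polynomial L →ₐ[L] L))
  simp only [AlgHom.comp_apply] at this
  rw [Polynomial.coe_aeval_eq_eval] at this
  refine this.trans ?_
  congr 2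
  ext i
  simp [mul_comm r]

theorem subsingleton_rep_eq_smul (a : Fin n → L) :
    {p : ℙ L (Fin n → L) | ∃ s : L, p.rep = s • a}.Subsingleton := by
  rintro p ⟨s, hs⟩ q ⟨t, ht⟩
  have ht0 : t ≠ 0 := fun h => q.rep_nonzero (by rw [ht, h, zero_smul])
  rw [← p.mk_rep, ← q.mk_rep, Projectivization.mk_eq_mk_iff']
  exact ⟨s * t⁻¹, by rw [ht, hs, smul_smul, inv_mul_cancel_right₀ ht0]⟩

/-- A cone that meets a plane through the origin in infinitely many lines contains the plane. -/
theorem IsCone.le_vanishingIdeal_span [Infinite L] {I : Ideal (MvPolynomial (Fin n) L)}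
    (hI : IsCone I) (a b : Fin n → L)
    (hinf : (projZeros I ∩ linearLocus (Submodule.span L {a, b})).Infinite) :
    I ≤ vanishingIdeal L (Submodule.span L {a, b} : Set (Fin n → L)) := by
  have h1 : {r : L | b + r • a ∈ zeroLocus L I}.Infinite := by
    intro hfin
    refine hinf (((subsingleton_rep_eq_smul a).finite.union
      (hfin.biUnion fun r _ => (subsingleton_rep_eq_smul (b + r • a)).finite)).subset ?_)
    rintro p ⟨hp, hpW⟩
    obtain ⟨s, t, hst⟩ := Submodule.mem_span_pair.1 ((rep_mem_iff _ p).2 hpW)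
    by_cases ht : t = 0
    · exact Or.inl ⟨s, by rw [← hst, ht, zero_smul, add_zero]⟩
    · refine Or.inr (Set.mem_biUnion (x := t⁻¹ * s) ?_ ⟨t, ?_⟩)
      · have := hI.smul_mem ((rep_mem_zeroLocus_iff p).2 hp) t⁻¹
        rwa [← hst, smul_add, smul_smul, inv_smul_smul₀ ht, add_comm] at this
      · rw [← hst, smul_add, smul_smul, mul_inv_cancel_left₀ ht, add_comm]
  have h2 (f) (hf : f ∈ I) (r : L) : aeval (b + r • a) f = 0 := by
    have h0 : aeval (fun i => Polynomial.C (b i) + Polynomial.X * Polynomial.C (a i)) f =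
        (0 : Polynomial L) :=
      Polynomial.eq_zero_of_infinite_isRoot _ (h1.mono fun r hr =>
        (aeval_line f a b r).trans ((show b + r • a ∈ zeroLocus L I from hr) f hf))
    rw [← aeval_line, h0, Polynomial.eval_zero]
  have h3 (s t : L) (ht : t ≠ 0) : s • a + t • b ∈ zeroLocus L I := by
    have := hI.smul_mem (v := b + (t⁻¹ * s) • a) (fun f hf => h2 f hf _) t
    rwa [smul_add, smul_smul, mul_inv_cancel_left₀ ht, add_comm] at this
  have h4 : a ∈ zeroLocus L I := by
    intro f hf
    have : (aeval (fun i => Polynomial.C (a i) + Polynomial.X * Polynomial.C (b i)) f) =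
        (0 : Polynomial L) := by
      refine Polynomial.eq_zero_of_infinite_isRoot _
        (((Set.finite_singleton (0 : L)).infinite_compl).mono fun r hr =>
          (aeval_line f b a r).trans ?_)
      have := h3 1 r hr f hf
      rwa [one_smul] at this
    have h5 := aeval_line f b a 0
    rw [this] at h5
    simpa using h5.symm
  intro f hf v hv
  obtain ⟨s, t, rfl⟩ := Submodule.mem_span_pair.1 hv
  by_cases ht : t = 0
  · rw [ht, zero_smul, add_zero]
    exact hI.smul_mem h4 s f hf
  · exact h3 s t ht f hf

theorem add_smul_ne_zero {a b : Fin n → L} (h : LinearIndependent L ![a, b]) (r : L) :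
    b + r • a ≠ 0 := by
  intro h0
  have := LinearIndependent.pair_iff.1 h r 1 (by rw [one_smul, add_comm, h0])
  exact one_ne_zero this.2

theorem exists_eq_span_pair {W : Submodule L (Fin n → L)} (hW : Module.finrank L W = 2) :
    ∃ a b, LinearIndependent L ![a, b] ∧ W = Submodule.span L {a, b} := by
  let e := Module.finBasisOfFinrankEq L W hW
  have he := e.linearIndependent.map' W.subtype W.ker_subtype
  have hee : W.subtype ∘ e = ![(e 0 : Fin n → L), (e 1 : Fin n → L)] := by
    ext i
    fin_cases i <;> rfl
  rw [hee] at he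
  refine ⟨_, _, he, ?_⟩
  have h1 : Submodule.map W.subtype (Submodule.span L (Set.range e)) = W := by
    rw [e.span_eq, Submodule.map_top, Submodule.range_subtype]
  rw [Submodule.map_span, ← Set.range_comp, hee] at h1
  rw [Matrix.range_cons_cons_empty] at h1
  exact h1.symm

theorem finrank_span_pair {a b : Fin n → L} (h : LinearIndependent L ![a, b]) :
    Module.finrank L (Submodule.span L {a, b}) = 2 := by
  have := finrank_span_eq_card h
  rwa [Matrix.range_cons_cons_empty, Fintype.card_fin] at this

theorem linearLocus_span_pair_infinite [Infinite L] {a b : Fin n → L}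
    (h : LinearIndependent L ![a, b]) : (linearLocus (Submodule.span L {a, b})).Infinite := by
  refine Set.infinite_of_injective_forall_mem
    (f := fun r : L => Projectivization.mk L (b + r • a) (add_smul_ne_zero h r)) ?_ fun r => ?_
  · intro r s hrs
    obtain ⟨c, hc⟩ := (Projectivization.mk_eq_mk_iff' L _ _ _ _).1 hrs
    have h1 := LinearIndependent.pair_iff.1 h (c * s - r) (c - 1) (by
      rw [← sub_eq_zero.2 hc]
      module)
    have h2 := sub_eq_zero.1 h1.2
    simpa [h2, sub_eq_zero, eq_comm] using h1.1
  · rw [mk_mem_linearLocus]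
    exact Submodule.mem_span_pair.2 ⟨r, 1, by rw [one_smul, add_comm]⟩

theorem span_rep_le {W : Submodule L (Fin n → L)} {p q : ℙ L (Fin n → L)}
    (hp : p ∈ linearLocus W) (hq : q ∈ linearLocus W) : Submodule.span L {p.rep, q.rep} ≤ W := by
  rw [Submodule.span_le]
  rintro _ (rfl | rfl)
  exacts [(rep_mem_iff _ _).2 hp, (rep_mem_iff _ _).2 hq]

theorem linearLocus_mono {W W' : Submodule L (Fin n → L)} (h : W ≤ W') :
    linearLocus W ⊆ linearLocus W' := fun _ hp => le_trans hp h

/-- A linear subspace containing two points of the line contains the whole line, which is infinite.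
-/
theorem IsLine.projDegree_le [Infinite L] {Z : Set (ℙ L (Fin n → L))} (hZ : IsLine Z) :
    projDegree Z ≤ 1 := by
  obtain ⟨W, -, rfl⟩ := hZ
  refine iSup₂_le fun W' hfin => Set.encard_le_one_iff.2 fun p q hp hq => ?_
  by_contra hpq
  exact linearLocus_span_pair_infinite (Projectivization.linearIndependent_pair_iff_ne.2 hpq)
    (hfin.subset (Set.subset_inter (linearLocus_mono (span_rep_le hp.1 hq.1))
      (linearLocus_mono (span_rep_le hp.2 hq.2))))

/-- The bilinear form is not required to be symmetric, so no division by 2 occurs. -/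
theorem exists_bilin {q : MvPolynomial (Fin n) L} (hq : q.IsHomogeneous 2) :
    ∃ B : (Fin n → L) →ₗ[L] (Fin n → L) →ₗ[L] L, ∀ v, eval v q = B v v := by
  have key (d : Fin n →₀ ℕ) (hd : d ∈ q.support) :
      ∃ φ ψ : (Fin n → L) →ₗ[L] L, ∀ v : Fin n → L, ∏ k, v k ^ d k = φ v * ψ v := by
    have h1 : ∑ i, d i = 2 := by
      rw [← hq (mem_support_iff.1 hd), Finsupp.weight_apply, Finsupp.sum_fintype _ _ (by simp)]
      simp
    have h2 : Multiset.card (Finsupp.toMultiset d) = 2 := by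
      rw [Finsupp.card_toMultiset, Finsupp.sum_fintype _ _ (by simp)]
      exact h1
    obtain ⟨i, j, hij⟩ := Multiset.card_eq_two.1 h2
    refine ⟨LinearMap.proj i, LinearMap.proj j, fun v => ?_⟩
    have h4 := congrArg (fun s => (Multiset.map v s).prod) hij
    simp only [Finsupp.toMultiset_map, Finsupp.prod_toMultiset] at h4
    rw [Finsupp.prod_mapDomain_index (by simp) (by simp [pow_add]),
      Finsupp.prod_fintype _ _ (by simp)] at h4
    simpa using h4
  choose! φ ψ h using key
  refine ⟨∑ d ∈ q.support, coeff d q • (φ d).smulRight (ψ d), fun v => ?_⟩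
  rw [eval_eq', LinearMap.sum_apply, LinearMap.sum_apply]
  refine Finset.sum_congr rfl fun d hd => ?_
  rw [h d hd]
  simp

/-- Suppose a finite linear section contains three points. Since the conic contains no line, the
polar form is nonzero on each pair, so on their span the form is c xy + b xz + a yz with a, b, c
nonzero. This has infinitely many zeros, all in the same section. -/
theorem IsConic.projDegree_le [Infinite L] {Z : Set (ℙ L (Fin n → L))} (hZ : IsConic Z) :
    projDegree Z ≤ 2 := by
  obtain ⟨⟨W, q, -, hq, -, rfl⟩, hline⟩ := hZ
  obtain ⟨B, hB⟩ := exists_bilin hq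
  simp only [hB] at hline ⊢
  have hpq (p q : ℙ L (Fin n → L)) (hne : p ≠ q) (hp : p ∈ linearLocus W)
      (hq : q ∈ linearLocus W) (hp' : B p.rep p.rep = 0) (hq' : B q.rep q.rep = 0) :
      B p.rep q.rep + B q.rep p.rep ≠ 0 := by
    intro h0
    refine hline ⟨_, ⟨Submodule.span L {p.rep, q.rep}, finrank_span_pair
      (Projectivization.linearIndependent_pair_iff_ne.2 hne), rfl⟩, fun x hx => ?_⟩
    refine ⟨linearLocus_mono (span_rep_le hp hq) hx, ?_⟩
    obtain ⟨s, t, hst⟩ := Submodule.mem_span_pair.1 ((rep_mem_iff _ x).2 hx)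
    rw [← hst]
    simp only [map_add, map_smul, LinearMap.add_apply, LinearMap.smul_apply, smul_eq_mul]
    linear_combination s ^ 2 * hp' + t ^ 2 * hq' + s * t * h0
  refine iSup₂_le fun W' hfin => not_lt.1 fun hlt => ?_
  rw [← hfin.cast_ncard_eq] at hlt
  obtain ⟨p₁, p₂, p₃, ⟨⟨h₁, h₁'⟩, h₁''⟩, ⟨⟨h₂, h₂'⟩, h₂''⟩, ⟨⟨h₃, h₃'⟩, h₃''⟩, h12, h13, h23⟩ :=
    (Set.two_lt_ncard_iff hfin).1 (by exact_mod_cast hlt)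
  have hc := hpq _ _ h12 h₁ h₂ h₁' h₂'
  have hb := hpq _ _ h13 h₁ h₃ h₁' h₃'
  have ha := hpq _ _ h23 h₂ h₃ h₂' h₃'
  rw [← rep_mem_iff] at h₁ h₂ h₃ h₁'' h₂'' h₃''
  generalize hc' : B p₁.rep p₂.rep + B p₂.rep p₁.rep = c at hc
  generalize hb' : B p₁.rep p₃.rep + B p₃.rep p₁.rep = b at hb
  generalize ha' : B p₂.rep p₃.rep + B p₃.rep p₂.rep = a at ha
  have hq (x y z : L) : B (x • p₁.rep + y • p₂.rep + z • p₃.rep)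
      (x • p₁.rep + y • p₂.rep + z • p₃.rep) = c * x * y + b * x * z + a * y * z := by
    simp only [map_add, map_smul, LinearMap.add_apply, LinearMap.smul_apply, smul_eq_mul]
    rw [← hc', ← hb', ← ha']
    linear_combination x ^ 2 * h₁' + y ^ 2 * h₂' + z ^ 2 * h₃'
  -- The polar Gram determinant is 2abc, useless in characteristic 2. The relation c x y = 0, from
  -- evaluating the form at x p₁ + y p₂ = -z p₃, replaces it.
  have hli : ∀ x y z : L, x • p₁.rep + y • p₂.rep + z • p₃.rep = 0 → x = 0 ∧ y = 0 := by
    intro x y z h0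
    have e2 := congrArg (fun v => B p₂.rep v + B v p₂.rep) h0
    have e3 := congrArg (fun v => B p₃.rep v + B v p₃.rep) h0
    simp only [map_add, map_smul, map_zero, LinearMap.add_apply, LinearMap.smul_apply, smul_eq_mul,
      LinearMap.zero_apply, add_zero, h₂', h₃'] at e2 e3
    have e4 : c * x * y = 0 := by
      have h4 : x • p₁.rep + y • p₂.rep + (0 : L) • p₃.rep = -(z • p₃.rep) := by
        rw [zero_smul, add_zero]
        exact eq_neg_of_add_eq_zero_left h0
      have h5 := hq x y 0
      rw [h4] at h5
      simp only [map_neg, map_smul, LinearMap.neg_apply, LinearMap.smul_apply, smul_eq_mul,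
        h₃'] at h5
      linear_combination -h5
    have e2' : c * x + a * z = 0 := by rw [← hc', ← ha']; linear_combination e2
    have e3' : b * x + a * y = 0 := by rw [← hb', ← ha']; linear_combination e3
    rcases mul_eq_zero.1 e4 with h | h
    · have hx := (mul_eq_zero.1 h).resolve_left hc
      rw [hx, mul_zero, zero_add] at e3'
      exact ⟨hx, (mul_eq_zero.1 e3').resolve_left ha⟩
    · rw [h, mul_zero, add_zero] at e3'
      exact ⟨(mul_eq_zero.1 e3').resolve_left hb, h⟩
  have hT : Infinite {t : L // b + a * t ≠ 0} := by
    refine Set.infinite_coe_iff.2 (Set.Finite.infinite_compl (s := {t : L | b + a * t = 0})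
      (Set.Subsingleton.finite ?_))
    intro s hs t ht
    exact mul_left_cancel₀ ha (add_left_cancel (Eq.trans hs (Eq.symm ht)))
  -- The second intersection of the conic with the line y = t x through p₃.
  have hne (t : {t : L // b + a * t ≠ 0}) : (b + a * t) • p₁.rep + (t * (b + a * t)) • p₂.rep +
      (-(c * t)) • p₃.rep ≠ 0 := fun h => t.2 (hli _ _ _ h).1
  refine Set.infinite_of_injective_forall_mem
    (f := fun t : {t : L // b + a * t ≠ 0} => Projectivization.mk L _ (hne t)) ?_ ?_ hfin
  · intro s t hst
    obtain ⟨r, hr⟩ := (Projectivization.mk_eq_mk_iff' L _ _ _ _).1 hst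
    have h1 := hli (r * (b + a * t) - (b + a * s)) (r * (t * (b + a * t)) - s * (b + a * s))
      (r * -(c * t) + c * s) (by
        rw [← sub_eq_zero.2 hr]
        module)
    have h2 : (s - t : L) * (b + a * s) = 0 := by linear_combination t * h1.1 - h1.2
    exact Subtype.ext (sub_eq_zero.1 ((mul_eq_zero.1 h2).resolve_right s.2))
  · intro t
    refine ⟨⟨?_, ?_⟩, ?_⟩
    · rw [mk_mem_linearLocus]
      exact add_mem (add_mem (W.smul_mem _ h₁) (W.smul_mem _ h₂)) (W.smul_mem _ h₃)
    · obtain ⟨r, hr⟩ := Projectivization.exists_smul_eq_mk_rep L _ (hne t)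
      rw [← hr, Units.smul_def, map_smul, map_smul, LinearMap.smul_apply, hq]
      rw [smul_eq_mul, smul_eq_mul]
      ring
    · rw [mk_mem_linearLocus]
      exact add_mem (add_mem (W'.smul_mem _ h₁'') (W'.smul_mem _ h₂'')) (W'.smul_mem _ h₃'')

end Degree

/-! ### From subvarieties through a nonsingular point to components. -/

section Component

open MvPolynomial

variable {L : Type*} [Field L] {n k : ℕ} {f : Fin k → MvPolynomial (Fin n) L} {d : ℕ}

/-- A lower bound for the height of the primes through a point turns a prime of at most this
height into a component. -/
theorem projZeros_mem_components (hf : ∀ i, (f i).IsHomogeneous d) (v : Fin n → L) (hv : v ≠ 0)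
    (hht : ∀ I : Ideal (MvPolynomial (Fin n) L), I.IsPrime → (∀ i, f i ∈ I) →
      v ∈ zeroLocus L I → (k : ℕ∞) ≤ I.height)
    (I : Ideal (MvPolynomial (Fin n) L)) [I.IsPrime] (hfI : ∀ i, f i ∈ I) (hvI : v ∈ zeroLocus L I)
    (hI : I.height ≤ k) :
    projZeros I ∈ components f ∧ Projectivization.mk L v hv ∈ projZeros I := by
  have hle : Ideal.span (Set.range f) ≤ I := by
    rw [Ideal.span_le]
    rintro _ ⟨i, rfl⟩
    exact hfI i
  obtain ⟨J, hJ, hJI⟩ := Ideal.exists_minimalPrimes_le hle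
  have := hJ.1.1
  have h1 := hht J this (fun i => hJ.1.2 (Ideal.subset_span ⟨i, rfl⟩))
    (zeroLocus_anti_mono hJI hvI)
  have h2 := Ideal.eq_of_le_of_height_le _ hJI (hI.trans h1)
  subst h2
  have hmem := ((isCone_of_mem_minimalPrimes hf hJ).mk_mem_projZeros_iff v hv).2 hvI
  exact ⟨⟨⟨_, hmem⟩, J, hJ, rfl⟩, hmem⟩

theorem mem_of_mem_zeroLocus {S : Set (Fin n → L)} {W : Submodule L (Fin n → L)}
    (hS : S ⊆ W) {v : Fin n → L} (hv : v ∈ zeroLocus L (vanishingIdeal L S)) : v ∈ W := by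
  by_contra h
  obtain ⟨u, hu, huv⟩ := exists_linear_form W v h
  rw [← aeval_linear_form] at huv
  exact huv (hv _ fun w hw => by rw [aeval_linear_form, hu w (hS hw)])

theorem projZeros_vanishingIdeal (W : Submodule L (Fin n → L)) :
    projZeros (vanishingIdeal L (W : Set (Fin n → L))) = linearLocus W := by
  ext p
  rw [← rep_mem_zeroLocus_iff, ← rep_mem_iff]
  exact ⟨mem_of_mem_zeroLocus subset_rfl, fun h => zeroLocus_vanishingIdeal_le _ h⟩

/-- A line through a point is a component. -/
theorem exists_line_component [Infinite L] (hn : k + 2 = n) (hf : ∀ i, (f i).IsHomogeneous d)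
    (v : Fin n → L) (hv : v ≠ 0)
    (hht : ∀ I : Ideal (MvPolynomial (Fin n) L), I.IsPrime → (∀ i, f i ∈ I) →
      v ∈ zeroLocus L I → (k : ℕ∞) ≤ I.height)
    (q : Fin n → L) (hq : ∀ c : L, q ≠ c • v) (h : ∀ i, ∀ s t : L, eval (s • v + t • q) (f i) = 0) :
    ∃ Z ∈ components f, Projectivization.mk L v hv ∈ Z ∧ IsLine Z := by
  have hli : LinearIndependent L ![v, q] :=
    (LinearIndependent.pair_iff' hv).2 fun c hc => hq c hc.symm
  have h1 := height_vanishingIdeal_add_le (Submodule.span L {v, q})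
  rw [finrank_span_pair hli] at h1
  have h2 : (vanishingIdeal L (Submodule.span L {v, q} : Set (Fin n → L))).height ≤ k := by
    refine (ENat.add_le_add_iff_right (k := 2) (by decide)).1 ?_
    exact h1.trans (by rw [← hn]; push_cast; rfl)
  obtain ⟨h3, h4⟩ := projZeros_mem_components hf v hv hht
    (vanishingIdeal L (Submodule.span L {v, q} : Set (Fin n → L))) (fun i w hw => by
      obtain ⟨s, t, rfl⟩ := Submodule.mem_span_pair.1 hw
      rw [aeval_eq_eval]
      exact h i s t)
    (zeroLocus_vanishingIdeal_le _ (Submodule.subset_span (by simp))) h2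
  exact ⟨_, h3, h4, Submodule.span L {v, q}, finrank_span_pair hli, projZeros_vanishingIdeal _⟩

theorem le_height_of_ne_zero {g : MvPolynomial (Fin n) L} (hg : g ≠ 0)
    (I : Ideal (MvPolynomial (Fin n) L)) [I.IsPrime] (hgI : g ∈ I) : 1 ≤ I.height := by
  rw [Order.one_le_iff_ne_zero, Ne, Ideal.height_eq_zero_iff_eq_bot]
  rintro rfl
  exact hg hgI

/-- A prime of height one is principal, say (g), by unique factorisation. If g vanishes at v and
divides both equations, their gradients at v are multiples of that of g, hence dependent. -/
theorem two_le_height {f : Fin 2 → MvPolynomial (Fin n) L} {v : Fin n → L}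
    (h : ¬ IsSingularAt f v) (I : Ideal (MvPolynomial (Fin n) L)) (hI : I.IsPrime)
    (hf : ∀ i, f i ∈ I) (hv : v ∈ zeroLocus L I) : ((2 : ℕ) : ℕ∞) ≤ I.height := by
  rw [IsSingularAt, not_not] at h
  have h0 : f 0 ≠ 0 := fun h0 => h.ne_zero 0 (by ext i; simp [h0])
  have h1 := le_height_of_ne_zero h0 I (hf 0)
  by_contra! h2
  have h3 : I.height = 1 := le_antisymm (Order.le_of_lt_add_one (h2.trans_eq (by norm_num))) h1
  obtain ⟨g, hgI, hgp⟩ := hI.exists_mem_prime_of_ne_bot (Ideal.ne_bot_of_height_eq_one h3)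
  have hg := Ideal.eq_span_singleton_of_height_eq_one h3 hgI hgp
  have hgv : eval v g = 0 := by
    rw [← aeval_eq_eval]
    exact hv g hgI
  have hd (j : Fin 2) : ∃ a, f j = g * a := by
    have := hf j
    rw [hg, Ideal.mem_span_singleton] at this
    exact this
  choose a ha using hd
  have hj (j : Fin 2) : (fun i => eval v (pderiv i (f j))) =
      eval v (a j) • fun i => eval v (pderiv i g) := by
    ext i
    rw [ha, Derivation.leibniz]
    simp [hgv]
  have h5 := h
  have e : (fun j i => eval v (pderiv i (f j))) = ![fun i => eval v (pderiv i (f 0)),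
    fun i => eval v (pderiv i (f 1))] := by
    ext j i
    fin_cases j <;> rfl
  rw [e, hj, hj, LinearIndependent.pair_iff] at h5
  have h6 := h5 (eval v (a 1)) (-eval v (a 0)) (by module)
  refine h.ne_zero 0 ?_
  rw [hj, neg_eq_zero.1 h6.2, zero_smul]

end Component

/-! ### Degree 3: tangent lines in the curve and components. -/

namespace Model3

open MvPolynomial

theorem isHomogeneous_U {R : Type*} [CommRing R] (Φ : Model3 R) : Φ.U.IsHomogeneous 3 := by
  have h (a : R) {p : MvPolynomial (Fin 3) R} (hp : p.IsHomogeneous 3) :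
      (C a * p).IsHomogeneous 3 := by
    simpa using (isHomogeneous_C _ a).mul hp
  have h3 (i : Fin 3) : (X i ^ 3 : MvPolynomial (Fin 3) R).IsHomogeneous 3 := isHomogeneous_X_pow i 3
  have h21 (i j : Fin 3) : (X i ^ 2 * X j : MvPolynomial (Fin 3) R).IsHomogeneous 3 :=
    (isHomogeneous_X_pow i 2).mul (isHomogeneous_X R j)
  have h12 (i j : Fin 3) : (X i * X j ^ 2 : MvPolynomial (Fin 3) R).IsHomogeneous 3 :=
    (isHomogeneous_X R i).mul (isHomogeneous_X_pow j 2)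
  have h111 : (X 0 * X 1 * X 2 : MvPolynomial (Fin 3) R).IsHomogeneous 3 :=
    ((isHomogeneous_X R 0).mul (isHomogeneous_X R 1)).mul (isHomogeneous_X R 2)
  simp only [U, mul_assoc] at h111 ⊢
  exact (((((((((h _ (h3 0)).add (h _ (h3 1))).add (h _ (h3 2))).add (h _ (h21 1 2))).add
    (h _ (h21 2 0))).add (h _ (h21 0 1))).add (h _ (h12 1 2))).add (h _ (h12 2 0))).add (h _ (h12 0 1))).add (h _ h111)

theorem valU_smul_add {R : Type*} [CommRing R] (Φ : Model3 R) (x y z u v w s t : R) :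
    Φ.valU (s * x + t * u) (s * y + t * v) (s * z + t * w) = s ^ 3 * Φ.valU x y z +
      s ^ 2 * t * Φ.lin x y z u v w + s * t ^ 2 * Φ.quad x y z u v w + t ^ 3 * Φ.valU u v w := by
  simp only [valU, lin, quad, dU, valA, valD, vald, rot]
  ring

theorem isHomogeneous_map_eqn {K L : Type*} [Field K] [Field L] [Algebra K L] (Φ : Model3 K)
    (i : Fin 1) : (MvPolynomial.map (algebraMap K L) (Φ.eqn i)).IsHomogeneous 3 :=
  Φ.isHomogeneous_U.map _

section

variable {K L : Type*} [Field K] [Field L] [Algebra K L] [IsAlgClosed L] (Φ : Model3 K)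

theorem exists_line_of_isLineDir (v : Fin 3 → L) (hv : v ≠ 0) (h : ∀ i, aeval v (Φ.eqn i) = 0)
    (hs : ¬ IsSingularAt (fun i => MvPolynomial.map (algebraMap K L) (Φ.eqn i)) v)
    {q : Fin 3 → L} (hq : (Φ.map (algebraMap K L)).IsLineDir v q) :
    ∃ Z ∈ components (fun i => MvPolynomial.map (algebraMap K L) (Φ.eqn i)),
      Projectivization.mk L v hv ∈ Z ∧ IsLine Z := by
  obtain ⟨h0, h1, h2, h3⟩ := hq
  have hU : (Φ.map (algebraMap K L)).valU (v 0) (v 1) (v 2) = 0 := by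
    rw [← aeval_U]
    exact h 0
  refine exists_line_component rfl Φ.isHomogeneous_map_eqn v hv (fun I hI hf _ => ?_) q h0
    fun i s t => ?_
  · rw [Nat.cast_one]
    refine le_height_of_ne_zero (fun h0 => hs ?_) I (hf 0)
    rw [IsSingularAt]
    exact fun hli => hli.ne_zero 0 (by ext i; simp [h0])
  · rw [eval_map, ← aeval_def]
    refine (Φ.aeval_U _).trans ?_
    simp only [Pi.add_apply, Pi.smul_apply, smul_eq_mul, valU_smul_add, h1, h2, h3, hU]
    ring

/-- The component is infinite, so it has a second point p. The line through v and p meets it in two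
points, hence by the degree bound in infinitely many, and so lies in it. -/
theorem exists_isLineDir_of_projDegree_le (v : Fin 3 → L) (hv : v ≠ 0)
    (h : ∃ Z ∈ components (fun i => MvPolynomial.map (algebraMap K L) (Φ.eqn i)),
      Projectivization.mk L v hv ∈ Z ∧ projDegree Z ≤ 1) :
    ∃ q, (Φ.map (algebraMap K L)).IsLineDir v q := by
  obtain ⟨_, ⟨-, I, hI, rfl⟩, hvI, hdeg⟩ := h
  have hcone := isCone_of_mem_minimalPrimes Φ.isHomogeneous_map_eqn hI
  have hinf := projZeros_infinite (by norm_num) hcone hI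
  obtain ⟨p, hp, hpv⟩ := hinf.exists_notMem_finite (Set.finite_singleton (Projectivization.mk L v hv))
  have hinf' : (projZeros I ∩ linearLocus (Submodule.span L {v, p.rep})).Infinite := by
    intro hfin
    refine hpv (Set.encard_le_one_iff.1 ((le_iSup₂ (f := fun (W : Submodule L (Fin 3 → L))
      (_ : (projZeros I ∩ linearLocus W).Finite) => (projZeros I ∩ linearLocus W).encard) _
        hfin).trans hdeg) _ _ ⟨hp, ?_⟩ ⟨hvI, ?_⟩)
    · exact (rep_mem_iff _ _).1 (Submodule.subset_span (by simp))
    · exact (mk_mem_linearLocus _ _ _).2 (Submodule.subset_span (by simp))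
  have hle := hcone.le_vanishingIdeal_span _ _ hinf'
  have hU : MvPolynomial.map (algebraMap K L) (Φ.eqn 0) ∈ I :=
    hI.1.2 (Ideal.subset_span (Set.mem_range_self (0 : Fin 1)))
  have hval (s t : L) : (Φ.map (algebraMap K L)).valU (s * v 0 + t * p.rep 0)
      (s * v 1 + t * p.rep 1) (s * v 2 + t * p.rep 2) = 0 := by
    have h1 := hle hU (s • v + t • p.rep) (Submodule.mem_span_pair.2 ⟨s, t, rfl⟩)
    rw [aeval_map_algebraMap, eqn, aeval_U] at h1
    exact h1
  -- A third affine value beyond 0 and 1 separates the two middle coefficients of the cubic on the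
  -- line; it exists because L is infinite.
  obtain ⟨t, ht⟩ := (Set.toFinite ({0, 1} : Set L)).exists_notMem
  simp only [Set.mem_insert_iff, Set.mem_singleton_iff, not_or] at ht
  have e0 := hval 1 0
  have e1 := hval 0 1
  have e2 := hval 1 1
  have e3 := hval 1 t
  rw [valU_smul_add] at e0 e1 e2 e3
  have h3 : (Φ.map (algebraMap K L)).valU (p.rep 0) (p.rep 1) (p.rep 2) = 0 := by
    linear_combination e1
  have h2 : (Φ.map (algebraMap K L)).quad (v 0) (v 1) (v 2) (p.rep 0) (p.rep 1) (p.rep 2) = 0 := by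
    have : t * (t - 1) ≠ 0 := mul_ne_zero ht.1 (sub_ne_zero.2 ht.2)
    refine (mul_eq_zero.1 (?_ : t * (t - 1) * _ = 0)).resolve_left this
    linear_combination e3 - t * e2 - (1 - t) * e0 + (t - t ^ 3) * h3
  refine ⟨p.rep, fun c hc => hpv ?_, ?_, h2, h3⟩
  · rw [Set.mem_singleton_iff, ← p.mk_rep, Projectivization.mk_eq_mk_iff']
    exact ⟨c, hc.symm⟩
  · linear_combination e2 - e0 - h2 - h3

end

end Model3

/-! ### Plane sections of quadrics and conic components. -/

namespace Quadric4

open MvPolynomial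

theorem isHomogeneous_toPoly {R : Type*} [CommRing R] (q : Quadric4 R) :
    q.toPoly.IsHomogeneous 2 :=
  IsHomogeneous.sum _ _ _ fun i _ => IsHomogeneous.sum _ _ _ fun j _ => by
    simpa using ((isHomogeneous_C (Fin 4) (q.coeffs i j)).mul (isHomogeneous_X R i)).mul
      (isHomogeneous_X R j)

variable {L : Type*} [Field L]

theorem aeval_toPoly_self (q : Quadric4 L) (v : Fin 4 → L) : aeval v q.toPoly = q.val v :=
  Model4.aeval_toPoly q v

theorem grad_comb (a b : L) (q q' : Quadric4 L) (v : Fin 4 → L) :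
    (comb a b q q').grad v = a • q.grad v + b • q'.grad v := by
  ext i
  fin_cases i <;> simp [grad, comb] <;> ring

/-- The polar form at a point as a linear form. -/
def polarLin (q : Quadric4 L) (v : Fin 4 → L) : (Fin 4 → L) →ₗ[L] L where
  toFun := q.polar v
  map_add' := q.polar_add v
  map_smul' a x := q.polar_smul v x a

/-- The tangent space of a quadric. -/
def tangent (q : Quadric4 L) (v : Fin 4 → L) : Submodule L (Fin 4 → L) := LinearMap.ker (q.polarLin v)

theorem mem_tangent (q : Quadric4 L) (v x : Fin 4 → L) : x ∈ q.tangent v ↔ q.polar v x = 0 := Iff.rfl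

theorem finrank_tangent (q : Quadric4 L) (v : Fin 4 → L) (h : q.grad v ≠ 0) :
    Module.finrank L (q.tangent v) = 3 := by
  have h1 : q.polarLin v ≠ 0 := by
    intro h0
    refine h (funext fun i => ?_)
    have := LinearMap.congr_fun h0 (Pi.single i 1)
    simpa [polarLin, polar] using this
  have h2 := LinearMap.finrank_range_add_finrank_ker (q.polarLin v)
  rw [LinearMap.range_eq_top.2 (LinearMap.surjective h1), finrank_top, Module.finrank_self,
    Module.finrank_fin_fun] at h2
  exact Nat.add_left_cancel (n := 1) h2

/-- The cone over the plane section of a quadric `N` by the tangent plane of `M` at `v`. -/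
def tangentSection (M N : Quadric4 L) (v : Fin 4 → L) : Set (Fin 4 → L) :=
  {x | M.polar v x = 0 ∧ N.val x = 0}

end Quadric4

namespace Model4

open MvPolynomial Quadric4

/-- Projection from the point (1, 0, 0, 0) of the conic: (s : t) is the ratio y₂ : y₃ and u a scale
that reaches the whole cone. If y₃ = 0 the equation and b ≠ 0 force y₂ = 0. -/
theorem quadric_cone_param {L : Type*} [Field L] (b c d : L) (hb : b ≠ 0) (y : Fin 4 → L)
    (h3 : y 3 = 0) (h : y 0 * y 2 + b * y 1 ^ 2 + c * y 1 * y 2 + d * y 2 ^ 2 = 0) :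
    ∃ s t u : L, y = ![-(b * s ^ 2 + c * s * t + d * t ^ 2) * u, s * t * u, t ^ 2 * u, 0] := by
  by_cases h2 : y 2 = 0
  · have h1 : y 1 = 0 := by
      rw [h2] at h
      have : b * y 1 ^ 2 = 0 := by linear_combination h
      exact pow_eq_zero_iff two_ne_zero |>.1 ((mul_eq_zero.1 this).resolve_left hb)
    refine ⟨1, 0, -(y 0 / b), ?_⟩
    ext i
    fin_cases i
    · simp
      field_simp
    · simpa using h1
    · simpa using h2
    · simpa using h3
  · refine ⟨y 1 / y 2, 1, y 2, ?_⟩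
    ext i
    fin_cases i
    · simp
      field_simp
      linear_combination h
    · simp
      field_simp
    · simp
    · simpa using h3

section Conic

variable {L : Type*} [Field L] {M N : Quadric4 L} {v : Fin 4 → L}

/-- In adapted coordinates the section is y₁ y₃ + b y₂² + c y₂ y₃ + d y₃² = 0 in the plane y₄ = 0.
It is the image of a polynomial map, so its ideal is prime. -/
theorem section_isPrime [Infinite L] (hv : v ≠ 0) (hM : M.val v = 0) (hN : N.val v = 0)
    (hli : LinearIndependent L ![M.grad v, N.grad v])
    (hno : ∀ a, (∀ c : L, a ≠ c • v) → M.polar v a = 0 → N.polar v a = 0 → N.val a ≠ 0) :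
    (vanishingIdeal L (M.tangentSection N v)).IsPrime ∧ ∃ x ∈ M.tangentSection N v, ∀ c : L, x ≠ c • v := by
  obtain ⟨w, hw, hw0, hwM, hwN⟩ := exists_adapted_basis (M.grad v) (N.grad v) v hli hv
    (by rw [← polar, polar_self, hM, mul_zero]) (by rw [← polar, polar_self, hN, mul_zero])
  have hpol (q : Quadric4 L) (y : Fin 4 → L) :
      q.polar v (Matrix.vecMul y w) = y ⬝ᵥ w.mulVec (q.grad v) := by
    rw [polar, Matrix.dotProduct_mulVec, dotProduct_comm]
  have hpM (y : Fin 4 → L) : M.polar v (Matrix.vecMul y w) = y 3 := by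
    rw [hpol, hwM]; simp [dotProduct, Fin.sum_univ_four]
  have hpN (y : Fin 4 → L) : N.polar v (Matrix.vecMul y w) = y 2 := by
    rw [hpol, hwN]; simp [dotProduct, Fin.sum_univ_four]
  have hwi (i : Fin 4) : Matrix.vecMul (Pi.single i 1) w = w i := by simp; rfl
  have hrow (q : Quadric4 L) (i : Fin 4) : q.polar v (w i) = w.mulVec (q.grad v) i := by
    rw [polar, dotProduct_comm]; rfl
  have hval (y : Fin 4 → L) (h3 : y 3 = 0) : N.val (Matrix.vecMul y w) =
      y 0 * y 2 + N.val (w 1) * y 1 ^ 2 + N.polar (w 1) (w 2) * y 1 * y 2 +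
        N.val (w 2) * y 2 ^ 2 := by
    have e1 : N.polar (w 0) (w 1) = 0 := by rw [hw0, hrow, hwN]; rfl
    have e2 : N.polar (w 0) (w 2) = 1 := by rw [hw0, hrow, hwN]; rfl
    have e0 : N.val (w 0) = 0 := by rw [hw0, hN]
    rw [← val_comp]
    simp only [comp, val, h3] at e0 ⊢
    rw [e0, e1, e2]
    ring
  have hsurj (x : Fin 4 → L) : ∃ y, Matrix.vecMul y w = x := by
    refine ⟨Matrix.vecMul x w⁻¹, ?_⟩
    rw [Matrix.vecMul_vecMul, Matrix.nonsing_inv_mul _ (isUnit_iff_ne_zero.2 hw), Matrix.vecMul_one]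
  -- Here w 1 is the tangent direction at v of the section; if N vanished at it, the section would
  -- contain a line through v.
  have hb : N.val (w 1) ≠ 0 := by
    refine hno _ (fun c hc => ?_) (by rw [hrow, hwM]; rfl) (by rw [hrow, hwN]; rfl)
    have h1 : Matrix.vecMul (Pi.single 1 1 - c • Pi.single 0 1) w = 0 := by
      rw [Matrix.sub_vecMul, Matrix.smul_vecMul, hwi, hwi, hw0, hc, sub_self]
    have h2 := congrFun (Matrix.eq_zero_of_vecMul_eq_zero hw h1) 1
    simp at h2
  let p : Fin 4 → MvPolynomial (Fin 3) L :=
    ![-(C (N.val (w 1)) * X 0 ^ 2 + C (N.polar (w 1) (w 2)) * X 0 * X 1 +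
      C (N.val (w 2)) * X 1 ^ 2) * X 2, X 0 * X 1 * X 2, X 1 ^ 2 * X 2, 0]
  have hp : (fun τ : Fin 3 → L => fun i => eval τ (∑ j, p j * C (w j i))) = fun τ =>
      Matrix.vecMul ![-(N.val (w 1) * τ 0 ^ 2 + N.polar (w 1) (w 2) * τ 0 * τ 1 +
        N.val (w 2) * τ 1 ^ 2) * τ 2, τ 0 * τ 1 * τ 2, τ 1 ^ 2 * τ 2, 0] w := by
    ext τ i
    simp [Matrix.vecMul, dotProduct, Fin.sum_univ_four, p]
  have hmem (y : Fin 4 → L) (h3 : y 3 = 0) (h : y 0 * y 2 + N.val (w 1) * y 1 ^ 2 +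
      N.polar (w 1) (w 2) * y 1 * y 2 + N.val (w 2) * y 2 ^ 2 = 0) :
      Matrix.vecMul y w ∈ M.tangentSection N v :=
    ⟨by rw [hpM, h3], by rw [hval y h3, h]⟩
  have hS : M.tangentSection N v = Set.range fun τ : Fin 3 → L => fun i =>
      eval τ (∑ j, p j * C (w j i)) := by
    rw [hp]
    ext x
    constructor
    · rintro ⟨h1, h2⟩
      obtain ⟨y, rfl⟩ := hsurj x
      rw [hpM] at h1
      rw [hval y h1] at h2
      obtain ⟨s, t, u, hy⟩ := quadric_cone_param _ _ _ hb y h1 h2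
      exact ⟨![s, t, u], by rw [hy]; simp⟩
    · rintro ⟨τ, rfl⟩
      refine hmem _ rfl ?_
      simp
      ring
  refine ⟨?_, ?_⟩
  · rw [hS]
    exact vanishingIdeal_isPrime_of_param _
  · refine ⟨_, hmem ![-(N.val (w 1) + N.polar (w 1) (w 2) + N.val (w 2)), 1, 1, 0] rfl ?_,
      fun c hc => ?_⟩
    · simp
      ring
    · have h1 := congrArg (N.polar v) hc
      rw [hpN, polar_smul, polar_self, hN] at h1
      simp at h1

/-- The cone strictly contains the span of v, whose ideal has height at most 3. -/
theorem height_section_le [Infinite L] (hM : M.val v = 0) (hN : N.val v = 0) (hv : v ≠ 0)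
    (hprime : (vanishingIdeal L (M.tangentSection N v)).IsPrime)
    (hx : ∃ x ∈ M.tangentSection N v, ∀ c : L, x ≠ c • v) :
    (vanishingIdeal L (M.tangentSection N v)).height ≤ (2 : ℕ) := by
  obtain ⟨x, hx, hxv⟩ := hx
  have hsub : (Submodule.span L {v} : Set (Fin 4 → L)) ⊆ M.tangentSection N v := by
    intro y hy
    obtain ⟨c, rfl⟩ := Submodule.mem_span_singleton.1 hy
    exact ⟨by rw [polar_smul, polar_self, hM]; ring, by rw [val_smul, hN, mul_zero]⟩
  have h1 := Ideal.height_add_one_le_of_lt_of_isPrime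
    (vanishingIdeal_lt hsub hx fun h => by
      obtain ⟨c, hc⟩ := Submodule.mem_span_singleton.1 h
      exact hxv c hc.symm)
  have h2 := height_vanishingIdeal_add_le (Submodule.span L {v})
  rw [finrank_span_singleton hv] at h2
  have h3 := (add_le_add_left h1 _).trans h2
  rw [add_assoc] at h3
  refine (ENat.add_le_add_iff_right (k := 2) (by decide)).1 ?_
  exact_mod_cast h3

theorem zeroLocus_section : zeroLocus L (vanishingIdeal L (M.tangentSection N v)) = M.tangentSection N v := by
  refine subset_antisymm (fun x hx => ⟨?_, ?_⟩) (zeroLocus_vanishingIdeal_le _)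
  · exact mem_of_mem_zeroLocus (W := M.tangent v) (fun y hy => hy.1) hx
  · rw [← aeval_toPoly_self]
    exact hx _ fun y hy => by rw [aeval_toPoly_self]; exact hy.2

/-- Suppose a line in the section corresponds to a plane W through the origin. By `hno`, vectors of
W annihilated by the polar form of N at v are multiples of v. If v ∈ W, then N(v + x) = 0 makes all
of W such multiples; if v ∉ W, the polar form is injective on the two-dimensional W. Both are
impossible. -/
theorem isConic_section (hN : N.val v = 0) (hM0 : M.grad v ≠ 0)
    (hx : ∃ x ∈ M.tangent v, N.val x ≠ 0)
    (hno : ∀ a, (∀ c : L, a ≠ c • v) → M.polar v a = 0 → N.polar v a = 0 → N.val a ≠ 0) :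
    IsConic (projZeros (vanishingIdeal L (M.tangentSection N v))) := by
  have hmem (p : ℙ L (Fin 4 → L)) : p ∈ projZeros (vanishingIdeal L (M.tangentSection N v)) ↔
      p.rep ∈ M.tangentSection N v := by
    rw [← rep_mem_zeroLocus_iff, zeroLocus_section]
  have hval (x : Fin 4 → L) : eval x N.toPoly = N.val x := by
    rw [← aeval_eq_eval, aeval_toPoly_self]
  refine ⟨⟨M.tangent v, N.toPoly, finrank_tangent M v hM0, isHomogeneous_toPoly N, ?_, ?_⟩, ?_⟩
  · simpa only [hval] using hx
  · ext p
    rw [hmem, Set.mem_ofPred_eq, ← rep_mem_iff, hval]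
    rfl
  · rintro ⟨_, ⟨W, hW, rfl⟩, hsub⟩
    obtain ⟨c, d, hcd, rfl⟩ := exists_eq_span_pair hW
    have hS (x : Fin 4 → L) (hx : x ∈ Submodule.span L {c, d}) : x ∈ M.tangentSection N v := by
      by_cases h0 : x = 0
      · rw [h0]
        exact ⟨(M.tangent v).zero_mem, by simp [val]⟩
      · have h1 := (hmem _).1 (hsub ((mk_mem_linearLocus _ x h0).2 hx))
        obtain ⟨a, ha⟩ := Projectivization.exists_smul_eq_mk_rep L x h0
        rw [← ha] at h1
        refine ⟨?_, ?_⟩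
        · have := h1.1
          rw [Units.smul_def, polar_smul] at this
          exact (mul_eq_zero.1 this).resolve_left a.ne_zero
        · have := h1.2
          rw [Units.smul_def, val_smul] at this
          exact (mul_eq_zero.1 this).resolve_left (pow_ne_zero 2 a.ne_zero)
    have hprop (x : Fin 4 → L) (hx : x ∈ Submodule.span L {c, d}) (h0 : N.polar v x = 0) :
        ∃ r : L, x = r • v := by
      by_contra! h
      exact hno x h (hS x hx).1 h0 (hS x hx).2
    have hc : c ∈ Submodule.span L {c, d} := Submodule.subset_span (by simp)
    have hd : d ∈ Submodule.span L {c, d} := Submodule.subset_span (by simp)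
    have hpair (r s : L) (hr : c = r • v) (hs : d = s • v) : False := by
      have h1 := LinearIndependent.pair_iff.1 hcd s (-r) (by rw [hr, hs]; module)
      exact hcd.ne_zero 1 (show d = 0 by rw [hs, h1.1, zero_smul])
    have hvW : v ∉ Submodule.span L {c, d} := by
      intro hvW
      have h1 (x : Fin 4 → L) (hx : x ∈ Submodule.span L {c, d}) : ∃ r : L, x = r • v := by
        refine hprop x hx ?_
        have := (hS _ (add_mem hvW hx)).2
        rw [val_add, hN, (hS x hx).2] at this
        linear_combination this
      obtain ⟨r, hr⟩ := h1 c hc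
      obtain ⟨s, hs⟩ := h1 d hd
      exact hpair r s hr hs
    have hz (x : Fin 4 → L) (hx : x ∈ Submodule.span L {c, d}) (h0 : N.polar v x = 0) : x = 0 := by
      obtain ⟨r, rfl⟩ := hprop x hx h0
      by_cases hr : r = 0
      · rw [hr, zero_smul]
      · exact absurd ((Submodule.smul_mem_iff _ hr).1 hx) hvW
    have h1 := hz (N.polar v d • c - N.polar v c • d)
      (sub_mem (Submodule.smul_mem _ _ hc) (Submodule.smul_mem _ _ hd)) (by
        rw [sub_eq_add_neg, ← neg_smul, polar_add, polar_smul, polar_smul]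
        ring)
    have h2 := LinearIndependent.pair_iff.1 hcd (N.polar v d) (-N.polar v c) (by
      rw [← h1]; module)
    exact hcd.ne_zero 1 (hz d hd h2.1)

/-- Let M be the member containing its tangent plane and N any other member. Within that plane the
curve is the zero set of N, an irreducible conic since no line through v lies in it, and the height
bound at v makes it a component. -/
theorem exists_conic_component [Infinite L] {f : Fin 2 → MvPolynomial (Fin 4) L}
    {q₁ q₂ : Quadric4 L} (hf : ∀ i, (f i).IsHomogeneous 2)
    (hq₁ : ∀ x, aeval x (f 0) = q₁.val x) (hq₂ : ∀ x, aeval x (f 1) = q₂.val x) (hv : v ≠ 0)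
    (h₁ : q₁.val v = 0) (h₂ : q₂.val v = 0) (hs : ¬ IsSingularAt f v)
    (hli : LinearIndependent L ![q₁.grad v, q₂.grad v]) (hno : ¬ ∃ q, IsLineDir q₁ q₂ v q)
    (hp : HasPlane q₁ q₂ v) :
    ∃ Z ∈ components f, Projectivization.mk L v hv ∈ Z ∧ IsConic Z := by
  obtain ⟨s, t, hst, hM⟩ := hp
  obtain ⟨s', t', hdet⟩ : ∃ s' t' : L, s * t' - t * s' ≠ 0 := by
    rcases hst with h | h
    · exact ⟨0, 1, by simpa using h⟩
    · exact ⟨1, 0, by simpa using h⟩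
  have hc₁ {x y : L} (h : s * x + t * y = 0) (h' : s' * x + t' * y = 0) : x = 0 :=
    (mul_eq_zero.1 (by linear_combination t' * h - t * h')).resolve_left hdet
  have hc₂ {x y : L} (h : s * x + t * y = 0) (h' : s' * x + t' * y = 0) : y = 0 :=
    (mul_eq_zero.1 (by linear_combination s * h' - s' * h)).resolve_left hdet
  have hMv : (comb s t q₁ q₂).val v = 0 := by rw [val_comb, h₁, h₂]; ring
  have hNv : (comb s' t' q₁ q₂).val v = 0 := by rw [val_comb, h₁, h₂]; ring
  have hli' : LinearIndependent L ![(comb s t q₁ q₂).grad v, (comb s' t' q₁ q₂).grad v] := by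
    rw [LinearIndependent.pair_iff]
    intro x y hxy
    rw [grad_comb, grad_comb] at hxy
    have h3 := LinearIndependent.pair_iff.1 hli (x * s + y * s') (x * t + y * t') (by
      rw [← hxy]; module)
    refine ⟨(mul_eq_zero.1 (?_ : (s * t' - t * s') * x = 0)).resolve_left hdet,
      (mul_eq_zero.1 (?_ : (s * t' - t * s') * y = 0)).resolve_left hdet⟩
    · linear_combination t' * h3.1 - s' * h3.2
    · linear_combination s * h3.2 - t * h3.1
  have hno' (a : Fin 4 → L) (ha : ∀ c : L, a ≠ c • v) (hMa : (comb s t q₁ q₂).polar v a = 0)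
      (hNa : (comb s' t' q₁ q₂).polar v a = 0) : (comb s' t' q₁ q₂).val a ≠ 0 := by
    intro h3
    have h4 := hM a hMa
    rw [polar_comb] at hMa hNa
    rw [val_comb] at h3 h4
    exact hno ⟨a, ha, hc₁ hMa hNa, hc₂ hMa hNa, hc₁ h4 h3, hc₂ h4 h3⟩
  obtain ⟨hprime, hx⟩ := section_isPrime hv hMv hNv hli' hno'
  have hsec {x : Fin 4 → L} (hx : x ∈ (comb s t q₁ q₂).tangentSection (comb s' t' q₁ q₂) v) :
      q₁.val x = 0 ∧ q₂.val x = 0 := by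
    have h3 := hM x hx.1
    have h4 := hx.2
    rw [val_comb] at h3 h4
    exact ⟨hc₁ h3 h4, hc₂ h3 h4⟩
  obtain ⟨h5, h6⟩ := projZeros_mem_components hf v hv (two_le_height hs)
    (vanishingIdeal L ((comb s t q₁ q₂).tangentSection (comb s' t' q₁ q₂) v)) (fun i x hx => by
      fin_cases i
      · exact (hq₁ x).trans (hsec hx).1
      · exact (hq₂ x).trans (hsec hx).2)
    (zeroLocus_vanishingIdeal_le _ ⟨by rw [polar_self, hMv, mul_zero], hNv⟩)
    (height_section_le hMv hNv hv hprime hx)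
  obtain ⟨x, hx, hxv⟩ := hx
  -- The point v + x of the plane is not on N: its value is the polar of v and x, and if that were
  -- zero the line through v and x would lie in the curve.
  refine ⟨_, h5, h6, isConic_section hNv (hli'.ne_zero 0) ⟨v + x, ?_, fun h => ?_⟩ hno'⟩
  · rw [mem_tangent, polar_add, polar_self, hMv, hx.1]
    ring
  · rw [val_add, hNv, hx.2, zero_add, add_zero] at h
    exact hno' x hxv hx.1 h hx.2

end Conic

end Model4

/-! ### Degree 4: components of degree at most 2. -/

namespace Model4

open MvPolynomial Quadric4

section

variable {L : Type*} [Field L] {q₁ q₂ : Quadric4 L} {v : Fin 4 → L}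

theorem isLineDir_of_forall_mem {W : Submodule L (Fin 4 → L)} {q : Fin 4 → L}
    (h : ∀ x ∈ W, q₁.val x = 0 ∧ q₂.val x = 0) (hv : v ∈ W) (hq : q ∈ W) (hqv : ∀ c : L, q ≠ c • v) :
    IsLineDir q₁ q₂ v q := by
  have h1 := h _ (add_mem hv hq)
  rw [val_add, val_add, (h v hv).1, (h v hv).2, (h q hq).1, (h q hq).2] at h1
  exact ⟨hqv, by linear_combination h1.1, by linear_combination h1.2, h q hq⟩

theorem encard_le_of_projDegree_le {n : ℕ} {Z : Set (ℙ L (Fin n → L))} {d : ℕ∞}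
    (hZ : projDegree Z ≤ d) (W : Submodule L (Fin n → L)) (hW : (Z ∩ linearLocus W).Finite) :
    (Z ∩ linearLocus W).encard ≤ d :=
  (le_iSup₂ (f := fun (W : Submodule L (Fin n → L)) (_ : (Z ∩ linearLocus W).Finite) =>
    (Z ∩ linearLocus W).encard) W hW).trans hZ

/-- Choose further points r, s of the component. By the degree bound, every linear space through v,
r, s meets it infinitely often. Unless a line through v already lies in both quadrics, some member M
contains the line vr. On the plane vrs it either vanishes, so that M contains its tangent plane at
v, or cuts out two lines, one of which lies in the component. -/
theorem isLineDir_or_hasPlane_of_projDegree_le [IsAlgClosed L] {f : Fin 2 → MvPolynomial (Fin 4) L}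
    (hf : ∀ i, (f i).IsHomogeneous 2)
    (hq₁ : ∀ x, aeval x (f 0) = q₁.val x) (hq₂ : ∀ x, aeval x (f 1) = q₂.val x) (hv : v ≠ 0)
    (hs : ¬ IsSingularAt f v) (hli : LinearIndependent L ![q₁.grad v, q₂.grad v])
    (h : ∃ Z ∈ components f, Projectivization.mk L v hv ∈ Z ∧ projDegree Z ≤ 2) :
    (∃ q, IsLineDir q₁ q₂ v q) ∨ HasPlane q₁ q₂ v := by
  obtain ⟨_, ⟨-, I, hI, rfl⟩, hvI, hdeg⟩ := h
  have hprime := hI.1.1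
  have hfI (i : Fin 2) : f i ∈ I := hI.1.2 (Ideal.subset_span (Set.mem_range_self i))
  have hcone := isCone_of_mem_minimalPrimes hf hI
  have hinf := projZeros_infinite (by norm_num) hcone hI
  have hvI' := (hcone.mk_mem_projZeros_iff v hv).1 hvI
  have hzero {x : Fin 4 → L} (hx : x ∈ zeroLocus L I) : q₁.val x = 0 ∧ q₂.val x = 0 :=
    ⟨(hq₁ x).symm.trans (hx _ (hfI 0)), (hq₂ x).symm.trans (hx _ (hfI 1))⟩
  have hlocus {W : Submodule L (Fin 4 → L)} (hW : I ≤ vanishingIdeal L (W : Set (Fin 4 → L)))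
      (x : Fin 4 → L) (hx : x ∈ W) : x ∈ zeroLocus L I := fun g hg => hW hg x hx
  obtain ⟨r, hr, hrv⟩ := hinf.exists_notMem_finite
    (Set.finite_singleton (Projectivization.mk L v hv))
  obtain ⟨s, hs', hsv⟩ := hinf.exists_notMem_finite
    (Set.toFinite {Projectivization.mk L v hv, r})
  rw [Set.mem_singleton_iff] at hrv
  rw [Set.mem_insert_iff, Set.mem_singleton_iff, not_or] at hsv
  have hne (p : ℙ L (Fin 4 → L)) (hp : p ≠ Projectivization.mk L v hv) (c : L) : p.rep ≠ c • v := by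
    intro hc
    refine hp ?_
    rw [← p.mk_rep, Projectivization.mk_eq_mk_iff']
    exact ⟨c, hc.symm⟩
  have hrI := (rep_mem_zeroLocus_iff r).2 hr
  have hsI := (rep_mem_zeroLocus_iff s).2 hs'
  have hinfW : ∀ W : Submodule L (Fin 4 → L), v ∈ W → r.rep ∈ W → s.rep ∈ W →
      (projZeros I ∩ linearLocus W).Infinite := by
    intro W h1 h2 h3 hfin
    have h4 := encard_le_of_projDegree_le hdeg W hfin
    rw [← hfin.cast_ncard_eq] at h4
    refine absurd ((Set.two_lt_ncard_iff hfin).2 ⟨_, r, s, ⟨hvI, ?_⟩, ⟨hr, ?_⟩, ⟨hs', ?_⟩,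
      Ne.symm hrv, Ne.symm hsv.1, Ne.symm hsv.2⟩) (not_lt.2 (by exact_mod_cast h4))
    · exact (mk_mem_linearLocus _ _ _).2 h1
    · exact (rep_mem_iff _ _).1 h2
    · exact (rep_mem_iff _ _).1 h3
  have hvr : LinearIndependent L ![v, r.rep] :=
    (LinearIndependent.pair_iff' hv).2 fun c hc => hne r hrv c hc.symm
  set P : Submodule L (Fin 4 → L) := Submodule.span L {v, r.rep} with hP
  have hvP : v ∈ P := Submodule.subset_span (by simp)
  have hrP : r.rep ∈ P := Submodule.subset_span (by simp)
  have hPline (h : (projZeros I ∩ linearLocus P).Infinite) : ∃ q, IsLineDir q₁ q₂ v q :=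
    ⟨r.rep, isLineDir_of_forall_mem (W := P) (fun x hx =>
      hzero (hlocus (hcone.le_vanishingIdeal_span _ _ h) x hx)) hvP hrP (hne r hrv)⟩
  by_cases hsP : s.rep ∈ P
  · exact Or.inl (hPline (hinfW P hvP hrP hsP))
  by_cases hpr : q₁.polar v r.rep = 0 ∧ q₂.polar v r.rep = 0
  · exact Or.inl ⟨r.rep, hne r hrv, hpr.1, hpr.2, hzero hrI⟩
  -- The combination for which v and r are conjugate; being zero at v and r, it vanishes on the line
  -- joining them.
  set M := comb (q₂.polar v r.rep) (-q₁.polar v r.rep) q₁ q₂ with hM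
  have hMI {x : Fin 4 → L} (hx : x ∈ zeroLocus L I) : M.val x = 0 := by
    rw [hM, val_comb, (hzero hx).1, (hzero hx).2]; ring
  have hMvr : M.polar v r.rep = 0 := by rw [hM, polar_comb]; ring
  have hMval (x y z : L) : M.val (x • v + y • r.rep + z • s.rep) =
      z * (x * M.polar v s.rep + y * M.polar r.rep s.rep) := by
    have e1 : M.polar (x • v + y • r.rep) s.rep = x * M.polar v s.rep + y * M.polar r.rep s.rep := by
      rw [polar_comm, polar_add, polar_smul, polar_smul, polar_comm _ v, polar_comm _ r.rep]
    have e2 : M.polar (x • v) r.rep = x * M.polar v r.rep := by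
      rw [polar_comm, polar_smul, polar_comm]
    rw [val_add, val_add, val_smul, val_smul, val_smul, polar_smul, polar_smul, e1, e2, hMvr,
      hMI hvI', hMI hrI, hMI hsI]
    ring
  have hdec (x : Fin 4 → L) (hx : x ∈ P ⊔ Submodule.span L {s.rep}) :
      ∃ a b c : L, x = a • v + b • r.rep + c • s.rep := by
    obtain ⟨y, hy, z, hz, rfl⟩ := Submodule.mem_sup.1 hx
    obtain ⟨a, b, rfl⟩ := Submodule.mem_span_pair.1 hy
    obtain ⟨c, rfl⟩ := Submodule.mem_span_singleton.1 hz
    exact ⟨a, b, c, rfl⟩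
  by_cases hab : M.polar v s.rep = 0 ∧ M.polar r.rep s.rep = 0
  -- M vanishes on the span of v, r, s, which lies in the tangent space of M at v and equals it by
  -- dimension.
  · right
    refine ⟨q₂.polar v r.rep, -q₁.polar v r.rep, ?_, fun x hx => ?_⟩
    · by_contra! h
      exact hpr ⟨neg_eq_zero.1 h.2, h.1⟩
    · have hgrad : M.grad v ≠ 0 := by
        intro h0
        rw [hM, grad_comb] at h0
        have h1 := LinearIndependent.pair_iff.1 hli _ _ h0
        exact hpr ⟨neg_eq_zero.1 h1.2, h1.1⟩
      have hle : P ⊔ Submodule.span L {s.rep} ≤ M.tangent v := by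
        intro x hx
        obtain ⟨a, b, c, rfl⟩ := hdec x hx
        rw [mem_tangent, polar_add, polar_add, polar_smul, polar_smul, polar_smul, polar_self,
          hMI hvI', hMvr, hab.1]
        ring
      have hlt : P < P ⊔ Submodule.span L {s.rep} := by
        refine lt_of_le_of_ne le_sup_left fun h => hsP ?_
        rw [h]
        exact le_sup_right (a := P) (Submodule.mem_span_singleton_self _)
      have h1 := Submodule.finrank_lt_finrank_of_lt hlt
      rw [hP, finrank_span_pair hvr, ← hP] at h1
      have h2 := Submodule.eq_of_le_of_finrank_le hle (by rw [finrank_tangent M v hgrad]; exact h1)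
      obtain ⟨a, b, c, rfl⟩ := hdec x (by rw [h2]; exact hx)
      rw [hMval, hab.1, hab.2]
      ring
  left
  set Λ : Submodule L (Fin 4 → L) := Submodule.span L
    {M.polar r.rep s.rep • v - M.polar v s.rep • r.rep, s.rep}
  -- On this plane M is the product of z and x M(v, s) + y M(r, s), with M(·, ·) its polar form; P
  -- and Λ are the corresponding two lines.
  have hcover : projZeros I ∩ linearLocus (P ⊔ Submodule.span L {s.rep}) ⊆
      (projZeros I ∩ linearLocus P) ∪ (projZeros I ∩ linearLocus Λ) := by
    rintro p ⟨hp, hpW⟩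
    obtain ⟨x, y, z, hxyz⟩ := hdec _ ((rep_mem_iff _ p).2 hpW)
    have h0 := hMI ((rep_mem_zeroLocus_iff p).2 hp)
    rw [hxyz, hMval] at h0
    by_cases hz : z = 0
    · refine Or.inl ⟨hp, (rep_mem_iff _ p).1 ?_⟩
      rw [hxyz, hz, zero_smul, add_zero]
      exact Submodule.mem_span_pair.2 ⟨x, y, rfl⟩
    · refine Or.inr ⟨hp, (rep_mem_iff _ p).1 ?_⟩
      have h1 := (mul_eq_zero.1 h0).resolve_left hz
      rw [hxyz]
      by_cases hb : M.polar r.rep s.rep = 0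
      · have ha : M.polar v s.rep ≠ 0 := fun ha => hab ⟨ha, hb⟩
        have hx : x = 0 := by
          rw [hb, mul_zero, add_zero] at h1
          exact (mul_eq_zero.1 h1).resolve_right ha
        refine Submodule.mem_span_pair.2 ⟨-(y / M.polar v s.rep), z, ?_⟩
        rw [hx, hb, zero_smul, zero_sub, smul_neg, neg_smul, neg_neg, smul_smul,
          div_mul_cancel₀ _ ha, zero_add]
      · have hy : y = -(x / M.polar r.rep s.rep * M.polar v s.rep) := by
          field_simp
          linear_combination h1
        refine Submodule.mem_span_pair.2 ⟨x / M.polar r.rep s.rep, z, ?_⟩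
        rw [smul_sub, smul_smul, smul_smul, div_mul_cancel₀ _ hb, hy, neg_smul, sub_eq_add_neg]
  have hinf' := (hinfW (P ⊔ Submodule.span L {s.rep}) (le_sup_left (a := P) hvP)
    (le_sup_left (a := P) hrP)
    (le_sup_right (a := P) (Submodule.mem_span_singleton_self _))).mono hcover
  rcases Set.infinite_union.1 hinf' with h | h
  · exact hPline h
  · have hle := hcone.le_vanishingIdeal_span _ _ h
    have hvec : M.polar r.rep s.rep • v - M.polar v s.rep • r.rep ≠ 0 := by
      intro h0
      have h1 := LinearIndependent.pair_iff.1 hvr (M.polar r.rep s.rep) (-M.polar v s.rep) (by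
        rw [← h0]; module)
      exact hab ⟨neg_eq_zero.1 h1.2, h1.1⟩
    have hrank : Module.finrank L Λ = 2 := finrank_span_pair
      ((LinearIndependent.pair_iff' hvec).2 fun c hc => hsP (hc ▸ Submodule.smul_mem _ _
        (sub_mem (Submodule.smul_mem _ _ hvP) (Submodule.smul_mem _ _ hrP))))
    have h1 := height_vanishingIdeal_add_le Λ
    rw [hrank] at h1
    have h2 : (vanishingIdeal L (Λ : Set (Fin 4 → L))).height ≤ (2 : ℕ) := by
      refine (ENat.add_le_add_iff_right (k := 2) (by decide)).1 ?_
      exact_mod_cast h1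
    -- The component contains Λ, and comparison of heights makes them equal. Hence v, a point of the
    -- component, lies on Λ.
    have h3 := Ideal.eq_of_le_of_height_le _ hle (h2.trans (two_le_height hs I hprime hfI hvI'))
    rw [h3] at hvI'
    exact ⟨s.rep, isLineDir_of_forall_mem (W := Λ) (fun x hx => hzero (hlocus hle x hx))
      (mem_of_mem_zeroLocus subset_rfl hvI') (Submodule.subset_span (by simp)) (hne s hsv.1)⟩

end

end Model4

/-! ### Assembly of the degree 3 and degree 4 statements. -/

open MvPolynomial

variable {K L : Type*} [Field K] [Field L] [Algebra K L] [IsAlgClosed L]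

theorem Model3.main (Φ : Model3 K) (v : Fin 3 → L) (hv : v ≠ 0)
    (h : ∀ i, aeval v (Φ.eqn i) = 0) :
    ((aeval v Φ.F = 0 ∧ aeval v Φ.G = 0) ↔
      (IsSingularAt (fun i => MvPolynomial.map (algebraMap K L) (Φ.eqn i)) v ∨
        ∃ Z ∈ components (fun i => MvPolynomial.map (algebraMap K L) (Φ.eqn i)),
          Projectivization.mk L v hv ∈ Z ∧ projDegree Z ≤ 1)) ∧
    ((aeval v Φ.F = 0 ∧ aeval v Φ.G = 0) ↔
      (IsSingularAt (fun i => MvPolynomial.map (algebraMap K L) (Φ.eqn i)) v ∨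
        ∃ Z ∈ components (fun i => MvPolynomial.map (algebraMap K L) (Φ.eqn i)),
          Projectivization.mk L v hv ∈ Z ∧ IsLine Z)) := by
  rw [Φ.aeval_F_G_eq_zero_iff v hv h]
  by_cases hs : IsSingularAt (fun i => MvPolynomial.map (algebraMap K L) (Φ.eqn i)) v
  · simp only [hs, true_or]
    exact ⟨trivial, trivial⟩
  simp only [hs, false_or]
  have h1 := fun hl : ∃ q, (Φ.map (algebraMap K L)).IsLineDir v q =>
    Φ.exists_line_of_isLineDir v hv h hs hl.choose_spec
  have h2 := Φ.exists_isLineDir_of_projDegree_le v hv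
  exact ⟨⟨fun hl => (h1 hl).imp fun Z hZ => ⟨hZ.1, hZ.2.1, hZ.2.2.projDegree_le⟩, h2⟩,
    ⟨h1, fun hl => h2 (hl.imp fun Z hZ => ⟨hZ.1, hZ.2.1, hZ.2.2.projDegree_le⟩)⟩⟩

theorem Model4.main (Φ : Model4 K) (v : Fin 4 → L) (hv : v ≠ 0)
    (h : ∀ i, aeval v (Φ.eqn i) = 0) :
    ((aeval v Φ.F = 0 ∧ aeval v Φ.G = 0) ↔
      (IsSingularAt (fun i => MvPolynomial.map (algebraMap K L) (Φ.eqn i)) v ∨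
        ∃ Z ∈ components (fun i => MvPolynomial.map (algebraMap K L) (Φ.eqn i)),
          Projectivization.mk L v hv ∈ Z ∧ projDegree Z ≤ 2)) ∧
    ((aeval v Φ.F = 0 ∧ aeval v Φ.G = 0) ↔
      (IsSingularAt (fun i => MvPolynomial.map (algebraMap K L) (Φ.eqn i)) v ∨
        ∃ Z ∈ components (fun i => MvPolynomial.map (algebraMap K L) (Φ.eqn i)),
          Projectivization.mk L v hv ∈ Z ∧ (IsLine Z ∨ IsConic Z))) := by
  rw [Φ.aeval_F_G_eq_zero_iff v hv h]
  by_cases hs : IsSingularAt (fun i => MvPolynomial.map (algebraMap K L) (Φ.eqn i)) v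
  · simp only [hs, true_or]
    exact ⟨trivial, trivial⟩
  simp only [hs, false_or]
  have hli := hs
  rw [Φ.isSingularAt_iff, not_not] at hli
  have hf (i : Fin 2) : (MvPolynomial.map (algebraMap K L) (Φ.eqn i)).IsHomogeneous 2 := by
    fin_cases i
    · exact Φ.Q₁.isHomogeneous_toPoly.map _
    · exact Φ.Q₂.isHomogeneous_toPoly.map _
  have hq₁ (x : Fin 4 → L) : aeval x (MvPolynomial.map (algebraMap K L) (Φ.eqn 0)) =
      (Φ.Q₁.map (algebraMap K L)).val x := by
    rw [aeval_map_algebraMap]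
    exact aeval_toPoly _ _
  have hq₂ (x : Fin 4 → L) : aeval x (MvPolynomial.map (algebraMap K L) (Φ.eqn 1)) =
      (Φ.Q₂.map (algebraMap K L)).val x := by
    rw [aeval_map_algebraMap]
    exact aeval_toPoly _ _
  have e₁ : (Φ.Q₁.map (algebraMap K L)).val v = 0 := by
    rw [← aeval_toPoly]
    exact h 0
  have e₂ : (Φ.Q₂.map (algebraMap K L)).val v = 0 := by
    rw [← aeval_toPoly]
    exact h 1
  have h1 : ((∃ q, IsLineDir (Φ.Q₁.map (algebraMap K L)) (Φ.Q₂.map (algebraMap K L)) v q) ∨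
      HasPlane (Φ.Q₁.map (algebraMap K L)) (Φ.Q₂.map (algebraMap K L)) v) →
      ∃ Z ∈ components (fun i => MvPolynomial.map (algebraMap K L) (Φ.eqn i)),
        Projectivization.mk L v hv ∈ Z ∧ (IsLine Z ∨ IsConic Z) := by
    intro hp
    by_cases hl : ∃ q, IsLineDir (Φ.Q₁.map (algebraMap K L)) (Φ.Q₂.map (algebraMap K L)) v q
    · obtain ⟨q, hqv, hp₁, hp₂, hv₁, hv₂⟩ := hl
      obtain ⟨Z, h3, h4, h5⟩ := exists_line_component rfl hf v hv (two_le_height hs) q hqv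
        fun i s t => by
          rw [← aeval_eq_eval]
          fin_cases i
          · refine (hq₁ _).trans ?_
            rw [Quadric4.val_add, Quadric4.val_smul, Quadric4.val_smul, Quadric4.polar_smul,
              Quadric4.polar_comm, Quadric4.polar_smul, Quadric4.polar_comm, e₁, hp₁, hv₁]
            ring
          · refine (hq₂ _).trans ?_
            rw [Quadric4.val_add, Quadric4.val_smul, Quadric4.val_smul, Quadric4.polar_smul,
              Quadric4.polar_comm, Quadric4.polar_smul, Quadric4.polar_comm, e₂, hp₂, hv₂]
            ring
      exact ⟨Z, h3, h4, Or.inl h5⟩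
    · obtain ⟨Z, h3, h4, h5⟩ := exists_conic_component hf hq₁ hq₂ hv e₁ e₂ hs hli hl
        (hp.resolve_left hl)
      exact ⟨Z, h3, h4, Or.inr h5⟩
  have h2 := isLineDir_or_hasPlane_of_projDegree_le hf hq₁ hq₂ hv hs hli
  have h3 {Z : Set (ℙ L (Fin 4 → L))} (hZ : IsLine Z ∨ IsConic Z) : projDegree Z ≤ 2 :=
    hZ.elim (fun hZ => hZ.projDegree_le.trans (by norm_num)) fun hZ => hZ.projDegree_le
  exact ⟨⟨fun hl => (h1 hl).imp fun Z hZ => ⟨hZ.1, hZ.2.1, h3 hZ.2.2⟩, h2⟩,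
    ⟨h1, fun hl => h2 (hl.imp fun Z hZ => ⟨hZ.1, hZ.2.1, h3 hZ.2.2⟩)⟩⟩

end GenusOne

theorem mainTheorem3 {K L : Type*} [Field K] [Field L] [Algebra K L] [IsAlgClosed L] :
    -- degree 2: points `(x₁ : x₂ : y)` of the curve in the weighted projective plane
    (∀ (Φ : GenusOne.Model2 K) (v : Fin 3 → L), v ≠ 0 → (∀ i, MvPolynomial.aeval v (Φ.eqn i) = 0) →
      ((MvPolynomial.aeval ![v 0, v 1] Φ.F = 0 ∧ MvPolynomial.aeval ![v 0, v 1] Φ.G = 0) ↔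
        GenusOne.IsSingularAt (fun i => MvPolynomial.map (algebraMap K L) (Φ.eqn i)) v)) ∧
    -- degree 3
    (∀ (Φ : GenusOne.Model3 K) (v : Fin 3 → L) (hv : v ≠ 0),
      (∀ i, MvPolynomial.aeval v (Φ.eqn i) = 0) →
      ((MvPolynomial.aeval v Φ.F = 0 ∧ MvPolynomial.aeval v Φ.G = 0) ↔
        (GenusOne.IsSingularAt (fun i => MvPolynomial.map (algebraMap K L) (Φ.eqn i)) v ∨
          ∃ Z ∈ GenusOne.components (fun i => MvPolynomial.map (algebraMap K L) (Φ.eqn i)),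
            Projectivization.mk L v hv ∈ Z ∧ GenusOne.projDegree Z ≤ 1)) ∧
      ((MvPolynomial.aeval v Φ.F = 0 ∧ MvPolynomial.aeval v Φ.G = 0) ↔
        (GenusOne.IsSingularAt (fun i => MvPolynomial.map (algebraMap K L) (Φ.eqn i)) v ∨
          ∃ Z ∈ GenusOne.components (fun i => MvPolynomial.map (algebraMap K L) (Φ.eqn i)),
            Projectivization.mk L v hv ∈ Z ∧ GenusOne.IsLine Z))) ∧
    -- degree 4
    (∀ (Φ : GenusOne.Model4 K) (v : Fin 4 → L) (hv : v ≠ 0),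
      (∀ i, MvPolynomial.aeval v (Φ.eqn i) = 0) →
      ((MvPolynomial.aeval v Φ.F = 0 ∧ MvPolynomial.aeval v Φ.G = 0) ↔
        (GenusOne.IsSingularAt (fun i => MvPolynomial.map (algebraMap K L) (Φ.eqn i)) v ∨
          ∃ Z ∈ GenusOne.components (fun i => MvPolynomial.map (algebraMap K L) (Φ.eqn i)),
            Projectivization.mk L v hv ∈ Z ∧ GenusOne.projDegree Z ≤ 2)) ∧
      ((MvPolynomial.aeval v Φ.F = 0 ∧ MvPolynomial.aeval v Φ.G = 0) ↔
        (GenusOne.IsSingularAt (fun i => MvPolynomial.map (algebraMap K L) (Φ.eqn i)) v ∨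
          ∃ Z ∈ GenusOne.components (fun i => MvPolynomial.map (algebraMap K L) (Φ.eqn i)),
            Projectivization.mk L v hv ∈ Z ∧ (GenusOne.IsLine Z ∨ GenusOne.IsConic Z)))) := by
  exact ⟨fun Φ v hv h => Φ.main v hv h, fun Φ v hv h => Φ.main v hv h, fun Φ v hv h => Φ.main v hv h⟩
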